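/- **Lemma 3.1 (variational characterization).** Let $\kappa>0$. Let $X_\kappa$ be the set of functions $m>0$ on $\mathbb R$ with $m-\kappa\in H^2(\mathbb R)$, and for $m\in X_\kappa$ put $$F_1(m)=\int_{\mathbb R}\Big(\frac1m+\frac{m}{\kappa^2}-\frac2\kappa\Big)dx,\qquad F_2(m)=\int_{\mathbb R}\Big(\frac{m_x^2}{m^5}+\frac1{4m^3}+\frac{3m}{4\kappa^4}-\frac1{\kappa^3}\Big)dx,$$ $$F_3(m)=\int_{\mathbb R}\Big(\frac{m_{xx}^2}{2m^7}+\frac{5m_x^2}{4m^7}-\frac{7m_x^4}{2m^9}+\frac1{16m^5}+\frac{5m}{16\kappa^6}-\frac3{8\kappa^5}\Big)dx .$$ A critical point in $X_\kappa$ of a functional $\Phi$ on $X_\kappa$ is an $m\in X_\kappa$ at which the Fréchet derivative of $\Phi$, with respect to variations in $H^2(\mathbb R)$, exists and vanishes. Put $$G_1(m)=\frac1{\kappa^2}-\frac1{m^2},\qquad G_2(m)=-\frac{2m_{xx}}{m^5}+\frac{5m_x^2}{m^6}-\frac3{4m^4}+\frac3{4\kappa^4},$$ $$G_3(m)=\frac{m_{xxxx}}{m^7}-\frac{14m_xm_{xxx}}{m^8}-\frac{21m_{xx}^2}{2m^8}+\frac{98m_x^2m_{xx}}{m^9}-\frac{189m_x^4}{2m^{10}}-\frac{5m_{xx}}{2m^7}+\frac{35m_x^2}{4m^8}-\frac5{16m^6}+\frac5{16\kappa^6}.$$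 *Solitons of the modified Camassa–Holm equation $m_t+((u^2-u_x^2)m)_x=0$, $m=u-u_{xx}$.* For speeds $c,c_i\in(3\kappa^2,9\kappa^2)$ let $k=\frac1\kappa\sqrt{\frac{c-3\kappa^2}{c-\kappa^2}}$, $\xi=k\big(y-\frac{2\kappa^3}{1-(\kappa k)^2}\tau+y_0\big)$, $e^{-\psi}=\frac{1-\kappa k}{1+\kappa k}$, and similarly $k_i,\xi_i,\psi_i$ from $c_i$ and $y_{i0}$ ($i=1,2$). The 1-soliton $U^{(1)}$ with phase $y_0\in\mathbb R$ and the 2-soliton $U^{(2)}$ with phases $y_{10},y_{20}\in\mathbb R$ are given, at time $t=\tau$, by the parametric representation $$x=\frac y\kappa+\kappa^2\tau+2\ln\frac gf+d,\qquad U=\kappa-\big(\ln (fg)\big)_{\tau y},\qquad y\in\mathbb R,$$ with an arbitrary constant $d\in\mathbb R$, where $f=1+e^{\xi}$, $g=1+e^{\xi-\psi}$ for $U^{(1)}$, and $$f=1+e^{\xi_1}+e^{\xi_2}+\Big(\frac{k_1-k_2}{k_1+k_2}\Big)^2e^{\xi_1+\xi_2},\qquad g=1+e^{\xi_1-\psi_1}+e^{\xi_2-\psi_2}+\Big(\frac{k_1-k_2}{k_1+k_2}\Big)^2e^{\xi_1+\xi_2-\psi_1-\psi_2}$$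 for $U^{(2)}$. Put $\mu_c=U^{(1)}-U^{(1)}_{xx}$ and $\tilde\mu=U^{(2)}-U^{(2)}_{xx}$, as functions of $x$ at a fixed time $t$. (a) Let $3\kappa^2<c<9\kappa^2$. For all $y_0,d,t$, the map $y\mapsto x$ is a bijection of $\mathbb R$, $\mu_c\in X_\kappa$, and for $i=1,2,3$ the functional $F_i$ is Fréchet differentiable at $\mu_c$ with $L^2$ gradient $G_i(\mu_c)\in L^2(\mathbb R)$. Moreover, for constants $\omega_1,\omega_2\in\mathbb R$, $$G_2(\mu_c)=\omega_1G_1(\mu_c)\iff \omega_1=\frac{c+3\kappa^2}{2\kappa^2(c-\kappa^2)},\qquad G_3(\mu_c)=\omega_2G_1(\mu_c)\iff\omega_2=\frac{3c^2+2c\kappa^2+27\kappa^4}{16\kappa^4(c-\kappa^2)^2}.$$ (b) Let $3\kappa^2<c_2<c_1<9\kappa^2$. For all $y_{10},y_{20},d,t$, the map $y\mapsto x$ is a bijection of $\mathbb R$, and for all $\lambda_1,\lambda_2\in\mathbb R$, the 2-soliton profile $\tilde\mu$ is a critical point in $X_\kappa$ of $F=F_3+\lambda_1F_1+\lambda_2F_2$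 if and only if $$\lambda_1=-\frac1{16\kappa^4}+\frac1{2\kappa^2}\Big(\frac1{c_1-\kappa^2}+\frac1{c_2-\kappa^2}\Big)+\frac2{(c_1-\kappa^2)(c_2-\kappa^2)},\qquad \lambda_2=-\Big(\frac1{4\kappa^2}+\frac1{c_1-\kappa^2}+\frac1{c_2-\kappa^2}\Big).$$ -/

import Mathlib

open MeasureTheory

noncomputable section

namespace MCH

/-! ### The Sobolev space `H²(ℝ)` -/

/-- `h` is (the continuous representative of) an element of `H²(ℝ)`: it is differentiable, `h'` is
locally absolutely continuous, and `h`, `h'`, `h''` are square integrable. -/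
def IsH2 (h : ℝ → ℝ) : Prop :=
  Differentiable ℝ h ∧ (∀ a b : ℝ, AbsolutelyContinuousOnInterval (deriv h) a b) ∧
    MemLp h 2 volume ∧ MemLp (deriv h) 2 volume ∧ MemLp (deriv (deriv h)) 2 volume

lemma ae_differentiableAt_of_ac {f : ℝ → ℝ}
    (hf : ∀ a b : ℝ, AbsolutelyContinuousOnInterval f a b) :
    ∀ᵐ x ∂(volume : Measure ℝ), DifferentiableAt ℝ f x := by
  have h : ∀ n : ℕ, ∀ᵐ x ∂(volume : Measure ℝ),
      x ∈ Set.uIcc (-(n : ℝ)) n → DifferentiableAt ℝ f x :=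
    fun n => (hf (-(n : ℝ)) n).ae_differentiableAt
  filter_upwards [ae_all_iff.2 h] with x hx
  obtain ⟨n, hn⟩ := exists_nat_ge |x|
  refine hx n ?_
  rw [Set.uIcc_of_le (by linarith [abs_nonneg x])]
  exact abs_le.1 hn

lemma IsH2.deriv_add {h k : ℝ → ℝ} (hh : IsH2 h) (hk : IsH2 k) :
    deriv (h + k) = deriv h + deriv k := by
  funext x
  exact _root_.deriv_add (hh.1 x) (hk.1 x)

lemma IsH2.deriv2_add {h k : ℝ → ℝ} (hh : IsH2 h) (hk : IsH2 k) :
    deriv (deriv (h + k)) =ᵐ[volume] deriv (deriv h) + deriv (deriv k) := by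
  filter_upwards [ae_differentiableAt_of_ac hh.2.1, ae_differentiableAt_of_ac hk.2.1] with x h1 h2
  rw [hh.deriv_add hk]
  exact _root_.deriv_add h1 h2

lemma deriv_smul_fun (c : ℝ) (h : ℝ → ℝ) : deriv (c • h) = c • deriv h := by
  funext x
  exact deriv_const_mul_field (v := h) (x := x) c

/-- `H²(ℝ)` as a space of functions. -/
def h2Submodule : Submodule ℝ (ℝ → ℝ) where
  carrier := {h | IsH2 h}
  zero_mem' := by
    have h0 : deriv (0 : ℝ → ℝ) = 0 := by
      funext x; exact deriv_const x (0 : ℝ)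
    have hac : ∀ a b : ℝ, AbsolutelyContinuousOnInterval (0 : ℝ → ℝ) a b := fun a b =>
      ((LipschitzWith.const (0 : ℝ)).lipschitzOnWith).absolutelyContinuousOnInterval
    refine ⟨differentiable_const (0 : ℝ), ?_, MemLp.zero, ?_, ?_⟩
    · rw [h0]; exact hac
    · rw [h0]; exact MemLp.zero
    · rw [h0, h0]; exact MemLp.zero
  add_mem' := by
    intro h k hh hk
    refine ⟨hh.1.add hk.1, ?_, hh.2.2.1.add hk.2.2.1, ?_, ?_⟩
    · rw [hh.deriv_add hk]
      exact fun a b => (hh.2.1 a b).add (hk.2.1 a b)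
    · rw [hh.deriv_add hk]
      exact hh.2.2.2.1.add hk.2.2.2.1
    · exact (memLp_congr_ae (hh.deriv2_add hk)).2 (hh.2.2.2.2.add hk.2.2.2.2)
  smul_mem' := by
    intro c h hh
    refine ⟨hh.1.const_smul c, ?_, hh.2.2.1.const_smul c, ?_, ?_⟩
    · rw [deriv_smul_fun]
      exact fun a b => (hh.2.1 a b).const_mul c
    · rw [deriv_smul_fun]
      exact hh.2.2.2.1.const_smul c
    · rw [deriv_smul_fun, deriv_smul_fun]
      exact hh.2.2.2.2.const_smul c

/-- `H²(ℝ)`. A separate type, so that its only topology is the one of the `H²` norm below (and not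
the topology of pointwise convergence of functions). -/
def H2 : Type := h2Submodule

instance : AddCommGroup H2 := inferInstanceAs (AddCommGroup h2Submodule)

instance : Module ℝ H2 := inferInstanceAs (Module ℝ h2Submodule)

instance : CoeFun H2 (fun _ => ℝ → ℝ) := ⟨fun v => v.1⟩

/-- A function with the `H²` property, as an element of `H²(ℝ)`. -/
def H2.mk (h : ℝ → ℝ) (hh : IsH2 h) : H2 := ⟨h, hh⟩

lemma H2.isH2 (v : H2) : IsH2 v := v.2

/-- The map `v ↦ (v, v', v'')` from `H²(ℝ)` to `L² × L² × L²` (with the Euclidean product norm). -/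
def H2.toL2 : H2 →ₗ[ℝ] PiLp 2 (fun _ : Fin 3 => Lp ℝ 2 (volume : Measure ℝ)) where
  toFun v := WithLp.toLp 2
    ![v.isH2.2.2.1.toLp _, v.isH2.2.2.2.1.toLp _, v.isH2.2.2.2.2.toLp _]
  map_add' v w := by
    have h1 : deriv ((v + w : H2) : ℝ → ℝ) = deriv v + deriv w := v.isH2.deriv_add w.isH2
    have h2 : deriv (deriv ((v + w : H2) : ℝ → ℝ)) =ᵐ[volume] deriv (deriv v) + deriv (deriv w) :=
      v.isH2.deriv2_add w.isH2
    ext1 i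
    fin_cases i
    · exact MemLp.toLp_add v.isH2.2.2.1 w.isH2.2.2.1
    · exact (MemLp.toLp_congr (v + w).isH2.2.2.2.1 (v.isH2.2.2.2.1.add w.isH2.2.2.2.1)
        (Filter.EventuallyEq.of_eq h1)).trans
        (MemLp.toLp_add v.isH2.2.2.2.1 w.isH2.2.2.2.1)
    · exact (MemLp.toLp_congr (v + w).isH2.2.2.2.2 (v.isH2.2.2.2.2.add w.isH2.2.2.2.2) h2).trans
        (MemLp.toLp_add v.isH2.2.2.2.2 w.isH2.2.2.2.2)
  map_smul' c v := by
    have h1 : deriv ((c • v : H2) : ℝ → ℝ) = c • deriv v := deriv_smul_fun c v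
    have h2 : deriv (deriv ((c • v : H2) : ℝ → ℝ)) = c • deriv (deriv v) := by
      rw [h1, deriv_smul_fun]
    ext1 i
    fin_cases i
    · exact MemLp.toLp_const_smul c v.isH2.2.2.1
    · exact (MemLp.toLp_congr (c • v).isH2.2.2.2.1 (v.isH2.2.2.2.1.const_smul c)
        (Filter.EventuallyEq.of_eq h1)).trans
        (MemLp.toLp_const_smul c v.isH2.2.2.2.1)
    · exact (MemLp.toLp_congr (c • v).isH2.2.2.2.2 (v.isH2.2.2.2.2.const_smul c)
        (Filter.EventuallyEq.of_eq h2)).trans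
        (MemLp.toLp_const_smul c v.isH2.2.2.2.2)

lemma H2.toL2_injective : Function.Injective H2.toL2 := by
  intro v w h
  have h0 : v.isH2.2.2.1.toLp _ = w.isH2.2.2.1.toLp _ :=
    congrArg (fun z : PiLp 2 (fun _ : Fin 3 => Lp ℝ 2 (volume : Measure ℝ)) => z 0) h
  have h1 : (v : ℝ → ℝ) =ᵐ[volume] w := (MemLp.toLp_eq_toLp_iff _ _).1 h0
  have h2 : (v : ℝ → ℝ) = w :=
    (Continuous.ae_eq_iff_eq volume v.isH2.1.continuous w.isH2.1.continuous).1 h1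
  exact Subtype.ext h2

/-- The `H²` norm, `‖v‖² = ‖v‖²_{L²} + ‖v'‖²_{L²} + ‖v''‖²_{L²}`. -/
instance : NormedAddCommGroup H2 :=
  NormedAddCommGroup.induced H2 _ H2.toL2 H2.toL2_injective

instance : NormedSpace ℝ H2 := NormedSpace.induced ℝ H2 _ H2.toL2

/-- The phase space `X_κ`: positive functions `m` with `m - κ ∈ H²(ℝ)`. -/
def XSpace (κ : ℝ) : Set (ℝ → ℝ) :=
  {m | IsH2 (fun x => m x - κ) ∧ ∀ x, 0 < m x}

/-! ### The functionals and their formal gradients -/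

/-- `F₁(m) = ∫ (1/m + m/κ² - 2/κ) dx`. -/
def F1 (κ : ℝ) (m : ℝ → ℝ) : ℝ :=
  ∫ x, (1 / m x + 1 / κ ^ 2 * m x - 2 / κ)

/-- `F₂(m) = ∫ (m_x²/m⁵ + 1/(4m³) + 3m/(4κ⁴) - 1/κ³) dx`. -/
def F2 (κ : ℝ) (m : ℝ → ℝ) : ℝ :=
  ∫ x, (deriv m x ^ 2 / m x ^ 5 + 1 / (4 * m x ^ 3) + 3 / (4 * κ ^ 4) * m x - 1 / κ ^ 3)

/-- `F₃(m) = ∫ (m_xx²/(2m⁷) + 5m_x²/(4m⁷) - 7m_x⁴/(2m⁹) + 1/(16m⁵) + 5m/(16κ⁶) - 3/(8κ⁵)) dx`. -/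
def F3 (κ : ℝ) (m : ℝ → ℝ) : ℝ :=
  ∫ x, (deriv (deriv m) x ^ 2 / (2 * m x ^ 7) + 5 * deriv m x ^ 2 / (4 * m x ^ 7)
    - 7 * deriv m x ^ 4 / (2 * m x ^ 9) + 1 / (16 * m x ^ 5) + 5 / (16 * κ ^ 6) * m x
    - 3 / (8 * κ ^ 5))

/-- The Lagrangian `F = F₃ + l₁ F₁ + l₂ F₂`. -/
def lagrangian (κ l₁ l₂ : ℝ) (m : ℝ → ℝ) : ℝ :=
  F3 κ m + l₁ * F1 κ m + l₂ * F2 κ m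

/-- `G₁(m)`, the variational derivative of `F₁`. -/
def G1 (κ : ℝ) (m : ℝ → ℝ) (x : ℝ) : ℝ :=
  1 / κ ^ 2 - 1 / m x ^ 2

/-- `G₂(m)`, the variational derivative of `F₂`. -/
def G2 (κ : ℝ) (m : ℝ → ℝ) (x : ℝ) : ℝ :=
  -2 * deriv (deriv m) x / m x ^ 5 + 5 * deriv m x ^ 2 / m x ^ 6 - 3 / (4 * m x ^ 4)
    + 3 / (4 * κ ^ 4)

/-- `G₃(m)`, the variational derivative of `F₃`. -/
def G3 (κ : ℝ) (m : ℝ → ℝ) (x : ℝ) : ℝ :=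
  iteratedDeriv 4 m x / m x ^ 7 - 14 * deriv m x * iteratedDeriv 3 m x / m x ^ 8
    - 21 * deriv (deriv m) x ^ 2 / (2 * m x ^ 8)
    + 98 * deriv m x ^ 2 * deriv (deriv m) x / m x ^ 9
    - 189 * deriv m x ^ 4 / (2 * m x ^ 10) - 5 * deriv (deriv m) x / (2 * m x ^ 7)
    + 35 * deriv m x ^ 2 / (4 * m x ^ 8) - 5 / (16 * m x ^ 6) + 5 / (16 * κ ^ 6)

/-- `g` is the (`L²`) gradient at `m ∈ X_κ` of a functional `Φ` on `X_κ`: the Fréchet derivative of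
`v ↦ Φ (κ + v)`, `v ∈ H²(ℝ)`, at `m - κ` is `w ↦ ∫ g w dx`. -/
def IsGradient (κ : ℝ) (Φ : (ℝ → ℝ) → ℝ) (m g : ℝ → ℝ) : Prop :=
  MemLp g 2 volume ∧ ∃ hm : m ∈ XSpace κ, ∃ L : H2 →L[ℝ] ℝ, (∀ w : H2, L w = ∫ x, g x * w x) ∧
    HasFDerivAt (fun v : H2 => Φ (fun x => κ + v x)) L (H2.mk (fun x => m x - κ) hm.1)

/-- `m` is a critical point of a functional `Φ` on `X_κ`: `m ∈ X_κ`, and the Fréchet derivative of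
`v ↦ Φ (κ + v)`, `v ∈ H²(ℝ)`, at `m - κ` exists and vanishes. -/
def IsCriticalPoint (κ : ℝ) (Φ : (ℝ → ℝ) → ℝ) (m : ℝ → ℝ) : Prop :=
  ∃ hm : m ∈ XSpace κ, HasFDerivAt (fun v : H2 => Φ (fun x => κ + v x)) (0 : H2 →L[ℝ] ℝ)
    (H2.mk (fun x => m x - κ) hm.1)

/-! ### Solitons in parametric form

The tau functions `f`, `g` are functions of `τ` and `y`, in this order. -/

/-- `x(y, τ) = y/κ + κ²τ + 2 ln(g/f) + d`. -/
def xParam (κ d : ℝ) (f g : ℝ → ℝ → ℝ) (τ y : ℝ) : ℝ :=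
  y / κ + κ ^ 2 * τ + 2 * Real.log (g τ y / f τ y) + d

/-- `u(y, τ) = κ - (ln(f g))_{τy}`. -/
def uParam (κ : ℝ) (f g : ℝ → ℝ → ℝ) (τ y : ℝ) : ℝ :=
  κ - deriv (fun y' => deriv (fun τ' => Real.log (f τ' y' * g τ' y')) τ) y

/-- The function `U(t, ·)` given by the parametrization `x = x(y, t)`, `U = u(y, t)`, `y ∈ ℝ`
(meaningful when `y ↦ x(y, t)` is a bijection of `ℝ`). -/
def waveOfTau (κ d : ℝ) (f g : ℝ → ℝ → ℝ) (t x : ℝ) : ℝ :=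
  uParam κ f g t (Function.invFun (xParam κ d f g t) x)

/-- The momentum density `U - U_xx` of a function `U` of `x`. -/
def momentum (U : ℝ → ℝ) (x : ℝ) : ℝ := U x - deriv (deriv U) x

/-- The wave number `k > 0` of the soliton of speed `c`, that is, the positive solution of
`c = κ² (3 - (κk)²) / (1 - (κk)²)`. -/
def waveNumber (κ c : ℝ) : ℝ := Real.sqrt ((c - 3 * κ ^ 2) / (c - κ ^ 2)) / κ

/-- The phase variable `ξ = k (y - c̃ τ + y₀)`, `c̃ = 2κ³ / (1 - (κk)²)`. -/
def phase (κ k y₀ τ y : ℝ) : ℝ := k * (y - 2 * κ ^ 3 / (1 - (κ * k) ^ 2) * τ + y₀)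

/-- `e^{-ψ} = (1 - κk) / (1 + κk)`. -/
def shiftFactor (κ k : ℝ) : ℝ := (1 - κ * k) / (1 + κ * k)

/-- `f = 1 + e^ξ`. -/
def tauF1 (κ k y₀ τ y : ℝ) : ℝ := 1 + Real.exp (phase κ k y₀ τ y)

/-- `g = 1 + e^{ξ - ψ}`. -/
def tauG1 (κ k y₀ τ y : ℝ) : ℝ := 1 + shiftFactor κ k * Real.exp (phase κ k y₀ τ y)

/-- `f = 1 + e^{ξ₁} + e^{ξ₂} + ((k₁ - k₂)/(k₁ + k₂))² e^{ξ₁ + ξ₂}`. -/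
def tauF2 (κ k₁ k₂ y₁ y₂ τ y : ℝ) : ℝ :=
  1 + Real.exp (phase κ k₁ y₁ τ y) + Real.exp (phase κ k₂ y₂ τ y)
    + ((k₁ - k₂) / (k₁ + k₂)) ^ 2 * Real.exp (phase κ k₁ y₁ τ y + phase κ k₂ y₂ τ y)

/-- `g = 1 + e^{ξ₁ - ψ₁} + e^{ξ₂ - ψ₂} + ((k₁ - k₂)/(k₁ + k₂))² e^{ξ₁ + ξ₂ - ψ₁ - ψ₂}`. -/
def tauG2 (κ k₁ k₂ y₁ y₂ τ y : ℝ) : ℝ :=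
  1 + shiftFactor κ k₁ * Real.exp (phase κ k₁ y₁ τ y)
    + shiftFactor κ k₂ * Real.exp (phase κ k₂ y₂ τ y)
    + ((k₁ - k₂) / (k₁ + k₂)) ^ 2 * (shiftFactor κ k₁ * shiftFactor κ k₂) *
      Real.exp (phase κ k₁ y₁ τ y + phase κ k₂ y₂ τ y)

/-- `y ↦ x(y, t)` for the 1-soliton of speed `c` and phase `y₀`. -/
def oneSolitonX (κ c y₀ d t : ℝ) : ℝ → ℝ :=
  xParam κ d (tauF1 κ (waveNumber κ c) y₀) (tauG1 κ (waveNumber κ c) y₀) t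

/-- The 1-soliton `U⁽¹⁾(t, ·)` of speed `c` and phase `y₀`. -/
def oneSoliton (κ c y₀ d t : ℝ) : ℝ → ℝ :=
  waveOfTau κ d (tauF1 κ (waveNumber κ c) y₀) (tauG1 κ (waveNumber κ c) y₀) t

/-- `y ↦ x(y, t)` for the 2-soliton of speeds `c₁`, `c₂` and phases `y₁`, `y₂`. -/
def twoSolitonX (κ c₁ c₂ y₁ y₂ d t : ℝ) : ℝ → ℝ :=
  xParam κ d (tauF2 κ (waveNumber κ c₁) (waveNumber κ c₂) y₁ y₂)
    (tauG2 κ (waveNumber κ c₁) (waveNumber κ c₂) y₁ y₂) t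

/-- The 2-soliton `U⁽²⁾(t, ·)` of speeds `c₁`, `c₂` and phases `y₁`, `y₂`. -/
def twoSoliton (κ c₁ c₂ y₁ y₂ d t : ℝ) : ℝ → ℝ :=
  waveOfTau κ d (tauF2 κ (waveNumber κ c₁) (waveNumber κ c₂) y₁ y₂)
    (tauG2 κ (waveNumber κ c₁) (waveNumber κ c₂) y₁ y₂) t

end MCH

end

noncomputable section

namespace MCH

open Filter Topology

/-! ### Analysis in `H²(ℝ)` -/

/-! In the reciprocal variable `y` the momentum is `m = 1/(2w)` and `x_y = 2w`, where `w` is the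
logarithmic derivative of `e^{y/(2κ)} g/f`. The tau functions make `w` a finite-mode potential: `w'
= Σ kᵢ(Bᵢ - Aᵢ)`, where `Aᵢ`, `Bᵢ`, `Cᵢ` are squares and products of solutions of a Dirac system
with spectral parameter `Nᵢ = (1/κ² - kᵢ²)/4 = 1/(2(cᵢ - κ²))`. This structure,
`SolitonData.modeSystem`, rests on two polynomial identities, `eigenNum_darboux` and
`tauPoly_mixed`.

The moments `Uⱼ = Σ kᵢNᵢʲ(Aᵢ + Bᵢ)` obey first integrals whose constants are fixed at `-∞`
(`U_zero_eq`, `U_one_eq`, `U_two_eq`). Substituted into the variational derivatives they give `G₁ =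
4U₀`, `G₂ = 16U₁ + (2/κ²)U₀` and `G₃ = 32U₂ + (4/κ²)U₁ + 3/(4κ⁴)U₀`. For one mode `Uⱼ₊₁ = N₁Uⱼ`, so
`G₂` and `G₃` are multiples of `G₁`, and `G₁` is not identically zero. For two modes `U₂ = (N₁ +
N₂)U₁ - N₁N₂U₀`, so the gradient of the Lagrangian is `αU₀ + βU₁` with `α`, `β` affine in the
multipliers. As `N₁ ≠ N₂`, the modes are linearly independent (`mode_eq_zero`), and the gradient
vanishes exactly when `α = β = 0`.

The analytic input is twofold. The bound `c < 9κ²` keeps `w` above a positive constant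
(`exists_pos_le_w`), so that `y ↦ x` is a bijection and `m - κ` and the first four derivatives of
`m` decay exponentially in `x`. At such profiles the formal variational derivatives are Fréchet
gradients (`isGradient_of_expansion`): `H²` controls `v` and `v'` uniformly, and `v''` enters the
densities at most quadratically, so the Taylor remainder is `O(‖v‖²)`. -/

lemma H2.norm_sq (v : H2) :
    ‖v‖ ^ 2 = (∫ x, v x ^ 2) + (∫ x, deriv v x ^ 2) + ∫ x, deriv (deriv v) x ^ 2 := by
  have key : ∀ {f : ℝ → ℝ} (hf : MemLp f 2 volume), ‖hf.toLp f‖ ^ 2 = ∫ x, f x ^ 2 := by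
    intro f hf
    rw [← real_inner_self_eq_norm_sq, L2.inner_def]
    refine integral_congr_ae ?_
    filter_upwards [hf.coeFn_toLp] with x hx
    rw [hx, real_inner_self_eq_norm_sq, Real.norm_eq_abs, sq_abs]
  have h1 : ‖v‖ ^ 2 = ‖H2.toL2 v‖ ^ 2 := rfl
  rw [h1, PiLp.norm_sq_eq_of_L2, Fin.sum_univ_three]
  exact congrArg₂ _ (congrArg₂ _ (key v.isH2.2.2.1) (key v.isH2.2.2.2.1)) (key v.isH2.2.2.2.2)

lemma integrable_mul_of_memLp {f g : ℝ → ℝ} (hf : MemLp f 2 volume) (hg : MemLp g 2 volume) :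
    Integrable (fun x => f x * g x) volume :=
  MemLp.integrable_mul hf hg

lemma integral_add_add {a b c : ℝ → ℝ} (ha : Integrable a) (hb : Integrable b)
    (hc : Integrable c) : ∫ x, (a x + b x + c x) = (∫ x, a x) + (∫ x, b x) + ∫ x, c x := by
  rw [← integral_add ha hb]
  exact integral_add (ha.add hb) hc

lemma integral_sub_add {a b c : ℝ → ℝ} (ha : Integrable a) (hb : Integrable b)
    (hc : Integrable c) : ∫ x, (a x - b x + c x) = (∫ x, a x) - (∫ x, b x) + ∫ x, c x := by
  rw [← integral_sub ha hb]
  exact integral_add (ha.sub hb) hc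

lemma integral_sub_sub {a b c : ℝ → ℝ} (ha : Integrable a) (hb : Integrable b)
    (hc : Integrable c) : (∫ x, a x) - (∫ x, b x) - ∫ x, c x = ∫ x, (a x - b x - c x) := by
  rw [← integral_sub ha hb]
  exact (integral_sub (ha.sub hb) hc).symm

lemma continuous_of_ac {h : ℝ → ℝ} (hac : ∀ a b : ℝ, AbsolutelyContinuousOnInterval h a b) :
    Continuous h := by
  rw [continuous_iff_continuousAt]
  intro x
  refine ((hac (x - 1) (x + 1)).continuousOn).continuousAt ?_
  rw [Set.uIcc_of_le (by linarith)]
  exact Icc_mem_nhds (by linarith) (by linarith)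

lemma ac_of_continuous_deriv {p p' : ℝ → ℝ} (hp : ∀ x, HasDerivAt p (p' x) x)
    (hc : Continuous p') (a b : ℝ) : AbsolutelyContinuousOnInterval p a b := by
  have h : ContDiff ℝ 1 p := by
    rw [contDiff_one_iff_deriv]
    refine ⟨fun x => (hp x).differentiableAt, ?_⟩
    rwa [show deriv p = p' from funext fun x => (hp x).deriv]
  exact h.contDiffOn.absolutelyContinuousOnInterval

/-- The one-dimensional Sobolev inequality. -/
lemma sq_le_of_ac {h : ℝ → ℝ} (hac : ∀ a b : ℝ, AbsolutelyContinuousOnInterval h a b)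
    (h0 : MemLp h 2 volume) (h1 : MemLp (deriv h) 2 volume) (x : ℝ) :
    h x ^ 2 ≤ 2 * (∫ y, h y ^ 2) + ∫ y, deriv h y ^ 2 := by
  have i0 := h0.integrable_sq
  have i1 := h1.integrable_sq
  -- The difference of `h²` at two points is the integral of `2hh'`, and `2|hh'| ≤ h² + h'²`.
  have step : ∀ y, h x ^ 2 - ((∫ y, h y ^ 2) + ∫ y, deriv h y ^ 2) ≤ h y ^ 2 := by
    intro y
    have e := (hac y x).integral_deriv_mul_eq_sub (hac y x)
    have hle : ‖∫ z in y..x, deriv h z * h z + h z * deriv h z‖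
        ≤ ∫ z, (h z ^ 2 + deriv h z ^ 2) := by
      refine (intervalIntegral.norm_integral_le_integral_norm_uIoc).trans ?_
      have im := integrable_mul_of_memLp h1 h0
      have im' := integrable_mul_of_memLp h0 h1
      calc ∫ z in Set.uIoc y x, ‖deriv h z * h z + h z * deriv h z‖
          ≤ ∫ z in Set.uIoc y x, (h z ^ 2 + deriv h z ^ 2) := by
            refine setIntegral_mono (im.add im').norm.integrableOn (i0.add i1).integrableOn ?_
            intro z
            simp only [Real.norm_eq_abs]
            rw [abs_le]
            constructor <;> nlinarith [sq_nonneg (h z + deriv h z), sq_nonneg (h z - deriv h z)]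
        _ ≤ _ := setIntegral_le_integral (i0.add i1) (ae_of_all _ fun z => by
            simp only [Pi.zero_apply]; positivity)
    rw [integral_add i0 i1, e, Real.norm_eq_abs] at hle
    have := (abs_le.1 hle).2
    nlinarith
  have hc := continuous_of_ac hac
  -- Averaging over an interval of length one replaces `h y ^ 2` by at most the full `L²` integral,
  -- whence the factor 2 there.
  have hint : ∫ y in x..(x + 1), (h x ^ 2 - ((∫ y, h y ^ 2) + ∫ y, deriv h y ^ 2))
      ≤ ∫ y in x..(x + 1), h y ^ 2 :=
    intervalIntegral.integral_mono (by linarith) (by simp)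
      ((hc.pow 2).intervalIntegrable _ _) step
  have hle : ∫ y in x..(x + 1), h y ^ 2 ≤ ∫ y, h y ^ 2 := by
    rw [intervalIntegral.integral_of_le (by linarith)]
    exact setIntegral_le_integral i0 (ae_of_all _ fun z => by simp only [Pi.zero_apply]; positivity)
  rw [intervalIntegral.integral_const] at hint
  simp only [add_sub_cancel_left, one_smul] at hint
  linarith

lemma IsH2.ac {h : ℝ → ℝ} (hh : IsH2 h) (a b : ℝ) : AbsolutelyContinuousOnInterval h a b :=
  ac_of_continuous_deriv (fun x => (hh.1 x).hasDerivAt) (continuous_of_ac hh.2.1) a b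

lemma H2.abs_le (v : H2) (x : ℝ) : |v x| ≤ 2 * ‖v‖ := by
  have h := sq_le_of_ac v.isH2.ac v.isH2.2.2.1 v.isH2.2.2.2.1 x
  have hn := v.norm_sq
  have h1 : 0 ≤ ∫ y, deriv v y ^ 2 := integral_nonneg fun y => sq_nonneg _
  have h2 : 0 ≤ ∫ y, deriv (deriv v) y ^ 2 := integral_nonneg fun y => sq_nonneg _
  have h0 : 0 ≤ ∫ y, v y ^ 2 := integral_nonneg fun y => sq_nonneg _
  refine abs_le_of_sq_le_sq ?_ (by positivity)
  nlinarith

lemma H2.abs_deriv_le (v : H2) (x : ℝ) : |deriv v x| ≤ 2 * ‖v‖ := by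
  have h := sq_le_of_ac v.isH2.2.1 v.isH2.2.2.2.1 v.isH2.2.2.2.2 x
  have hn := v.norm_sq
  have h1 : 0 ≤ ∫ y, deriv v y ^ 2 := integral_nonneg fun y => sq_nonneg _
  have h2 : 0 ≤ ∫ y, deriv (deriv v) y ^ 2 := integral_nonneg fun y => sq_nonneg _
  have h0 : 0 ≤ ∫ y, v y ^ 2 := integral_nonneg fun y => sq_nonneg _
  refine abs_le_of_sq_le_sq ?_ (by positivity)
  nlinarith

/-- Integration by parts on the line against an absolutely continuous function. -/
lemma integral_mul_deriv_of_ac {p p' h : ℝ → ℝ} (hp : ∀ x, HasDerivAt p (p' x) x)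
    (hc : Continuous p') (hbot : Tendsto p atBot (𝓝 0)) (htop : Tendsto p atTop (𝓝 0))
    (hac : ∀ a b : ℝ, AbsolutelyContinuousOnInterval h a b) {M : ℝ} (hM : ∀ x, |h x| ≤ M)
    (i1 : Integrable (fun x => p x * deriv h x)) (i2 : Integrable (fun x => p' x * h x)) :
    ∫ x, p x * deriv h x = -∫ x, p' x * h x := by
  have hn : Tendsto (fun n : ℕ => -(n : ℝ)) atTop atBot :=
    tendsto_neg_atTop_atBot.comp tendsto_natCast_atTop_atTop
  have hn' : Tendsto (fun n : ℕ => (n : ℝ)) atTop atTop := tendsto_natCast_atTop_atTop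
  have l1 := intervalIntegral_tendsto_integral i1 hn hn'
  have l2 := intervalIntegral_tendsto_integral i2 hn hn'
  have hdp : deriv p = p' := funext fun x => (hp x).deriv
  -- Boundary terms vanish because `p` tends to zero; of `h` only boundedness is needed.
  have small : ∀ {u : ℕ → ℝ}, Tendsto (fun n => p (u n)) atTop (𝓝 0) →
      Tendsto (fun n => p (u n) * h (u n)) atTop (𝓝 0) := by
    intro u hu
    have : Tendsto (fun n => |p (u n)| * M) atTop (𝓝 0) := by
      simpa using (hu.abs.mul_const M)
    refine squeeze_zero_norm (fun n => ?_) this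
    rw [Real.norm_eq_abs, abs_mul]
    exact mul_le_mul_of_nonneg_left (hM _) (abs_nonneg _)
  have b1 := small (htop.comp hn')
  have b2 := small (hbot.comp hn)
  have e : ∀ n : ℕ, ∫ x in (-(n : ℝ))..n, p x * deriv h x
      = p n * h n - p (-(n : ℝ)) * h (-(n : ℝ)) - ∫ x in (-(n : ℝ))..n, p' x * h x := by
    intro n
    rw [(ac_of_continuous_deriv hp hc _ _).integral_mul_deriv_eq_deriv_mul (hac _ _), hdp]
  have l3 := (b1.sub b2).sub l2
  have := tendsto_nhds_unique l1 (l3.congr fun n => (e n).symm)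
  simpa using this

/-! ### First variation of integral functionals on `H²(ℝ)`. -/

lemma exists_clm_integral_mul {g : ℝ → ℝ} (hg : MemLp g 2 volume) :
    ∃ L : H2 →L[ℝ] ℝ, ∀ w : H2, L w = ∫ x, g x * w x := by
  let T : H2 →L[ℝ] PiLp 2 (fun _ : Fin 3 => Lp ℝ 2 (volume : Measure ℝ)) :=
    H2.toL2.mkContinuous 1 (fun v => by rw [one_mul]; exact le_refl ‖H2.toL2 v‖)
  refine ⟨(innerSL ℝ (hg.toLp g)).comp
    ((PiLp.proj 2 (fun _ : Fin 3 => Lp ℝ 2 (volume : Measure ℝ)) 0).comp T), fun w => ?_⟩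
  have h : inner ℝ (hg.toLp g) (w.isH2.2.2.1.toLp w) = ∫ x, g x * w x := by
    rw [L2.inner_def]
    refine integral_congr_ae ?_
    filter_upwards [hg.coeFn_toLp, w.isH2.2.2.1.coeFn_toLp] with x h1 h2
    rw [h1, h2]
    simp [mul_comm]
  exact h

/-- A functional whose density has a quadratic Taylor expansion along `m` has an `L²` gradient,
given by the Euler-Lagrange expression. -/
theorem isGradient_of_expansion {κ : ℝ} {m : ℝ → ℝ} (hm : m ∈ XSpace κ) {h : ℝ → ℝ → ℝ → ℝ}
    (hmeas : Measurable fun z : ℝ × ℝ × ℝ => h z.1 z.2.1 z.2.2)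
    {p₀ p₁ p₂ p₁' p₂' p₂'' : ℝ → ℝ}
    (m0 : MemLp p₀ 2 volume) (m1 : MemLp p₁ 2 volume) (m2 : MemLp p₂ 2 volume)
    (m1' : MemLp p₁' 2 volume) (m2' : MemLp p₂' 2 volume) (m2'' : MemLp p₂'' 2 volume)
    (d1 : ∀ x, HasDerivAt p₁ (p₁' x) x) (d2 : ∀ x, HasDerivAt p₂ (p₂' x) x)
    (d2' : ∀ x, HasDerivAt p₂' (p₂'' x) x)
    (c1 : Continuous p₁') (c2 : Continuous p₂'')
    (lb1 : Tendsto p₁ atBot (𝓝 0)) (lt1 : Tendsto p₁ atTop (𝓝 0))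
    (lb2 : Tendsto p₂ atBot (𝓝 0)) (lt2 : Tendsto p₂ atTop (𝓝 0))
    (lb2' : Tendsto p₂' atBot (𝓝 0)) (lt2' : Tendsto p₂' atTop (𝓝 0))
    (hint : Integrable fun x => h (m x) (deriv m x) (deriv (deriv m) x))
    {ε C : ℝ} (hε : 0 < ε)
    (hexp : ∀ x α β γ, |α| ≤ ε → |β| ≤ ε →
      |h (m x + α) (deriv m x + β) (deriv (deriv m) x + γ)
        - h (m x) (deriv m x) (deriv (deriv m) x) - (p₀ x * α + p₁ x * β + p₂ x * γ)|
        ≤ C * (α ^ 2 + β ^ 2 + γ ^ 2)) :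
    IsGradient κ (fun m => ∫ x, h (m x) (deriv m x) (deriv (deriv m) x)) m
      (fun x => p₀ x - p₁' x + p₂'' x) := by
  have hg : MemLp (fun x => p₀ x - p₁' x + p₂'' x) 2 volume := (m0.sub m1').add m2''
  obtain ⟨L, hL⟩ := exists_clm_integral_mul hg
  refine ⟨hg, hm, L, hL, ?_⟩
  rw [hasFDerivAt_iff_isLittleO_nhds_zero]
  have hC : 0 ≤ C := by
    have := (abs_nonneg _).trans (hexp 0 ε ε ε (abs_of_pos hε).le (abs_of_pos hε).le)
    have h3 : 0 < ε ^ 2 + ε ^ 2 + ε ^ 2 := by positivity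
    exact nonneg_of_mul_nonneg_left this h3
  -- The radius `ε / 2` compensates the constant 2 in the Sobolev bounds: `w` and `w'` then stay
  -- within `ε` everywhere.
  suffices hb : ∀ w : H2, ‖w‖ ≤ ε / 2 →
      ‖(∫ x, h ((fun x => κ + (H2.mk (fun x => m x - κ) hm.1 + w : H2) x) x)
          (deriv (fun x => κ + (H2.mk (fun x => m x - κ) hm.1 + w : H2) x) x)
          (deriv (deriv (fun x => κ + (H2.mk (fun x => m x - κ) hm.1 + w : H2) x)) x))
        - (∫ x, h ((fun x => κ + (H2.mk (fun x => m x - κ) hm.1 : H2) x) x)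
          (deriv (fun x => κ + (H2.mk (fun x => m x - κ) hm.1 : H2) x) x)
          (deriv (deriv (fun x => κ + (H2.mk (fun x => m x - κ) hm.1 : H2) x)) x)) - L w‖
      ≤ C * ‖‖w‖ ^ 2‖ by
    refine Asymptotics.IsBigO.trans_isLittleO (g := fun w : H2 => ‖w‖ ^ 2)
      (Asymptotics.IsBigO.of_bound C ?_) (Asymptotics.isLittleO_norm_pow_id one_lt_two)
    filter_upwards [Metric.closedBall_mem_nhds (0 : H2) (half_pos hε)] with w hw
    exact hb w (by simpa using hw)
  intro w hw
  have hbase : (fun x => κ + (H2.mk (fun x => m x - κ) hm.1 : H2) x) = m := by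
    funext x
    show κ + (m x - κ) = m x
    ring
  have hsum : (fun x => κ + (H2.mk (fun x => m x - κ) hm.1 + w : H2) x) = fun x => m x + w x := by
    funext x
    show κ + ((m x - κ) + w x) = m x + w x
    ring
  have hmd : ∀ x, deriv (fun x => m x - κ) x = deriv m x := fun x => deriv_sub_const κ
  have hdm : Differentiable ℝ m := by
    have := hm.1.1.add_const κ
    simpa using this
  have hw1 : ∀ x, |w x| ≤ ε := fun x => (w.abs_le x).trans (by linarith)
  have hw2 : ∀ x, |deriv w x| ≤ ε := fun x => (w.abs_deriv_le x).trans (by linarith)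
  have hds : deriv (fun x => m x + w x) = fun x => deriv m x + deriv w x := by
    funext x
    exact deriv_add (hdm x) (w.isH2.1 x)
  -- First derivatives in `H²` are only absolutely continuous, so second derivatives add only almost
  -- everywhere.
  have hdds : ∀ᵐ x, deriv (deriv (fun x => m x + w x)) x
      = deriv (deriv m) x + deriv (deriv w) x := by
    rw [hds]
    have hac : ∀ a b : ℝ, AbsolutelyContinuousOnInterval (deriv m) a b := by
      have := hm.1.2.1
      rwa [show deriv (fun x => m x - κ) = deriv m from funext hmd] at this
    filter_upwards [ae_differentiableAt_of_ac hac, ae_differentiableAt_of_ac w.isH2.2.1]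
      with x h1 h2
    exact deriv_add h1 h2
  rw [hbase, hsum]
  set R : ℝ → ℝ := fun x => h (m x + w x) (deriv (fun x => m x + w x) x)
      (deriv (deriv (fun x => m x + w x)) x)
    - h (m x) (deriv m x) (deriv (deriv m) x)
    - (p₀ x * w x + p₁ x * deriv w x + p₂ x * deriv (deriv w) x) with hR
  have w0 := w.isH2.2.2.1
  have w1 := w.isH2.2.2.2.1
  have w2 := w.isH2.2.2.2.2
  have hRle : ∀ᵐ x, ‖R x‖ ≤ C * (w x ^ 2 + deriv w x ^ 2 + deriv (deriv w) x ^ 2) := by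
    filter_upwards [hdds] with x hx
    have := hexp x (w x) (deriv w x) (deriv (deriv w) x) (hw1 x) (hw2 x)
    simp only [hR, hx, Real.norm_eq_abs]
    rw [show deriv (fun x => m x + w x) x = deriv m x + deriv w x from congrFun hds x]
    exact this
  have hdom : Integrable fun x => C * (w x ^ 2 + deriv w x ^ 2 + deriv (deriv w) x ^ 2) :=
    ((w0.integrable_sq.add w1.integrable_sq).add w2.integrable_sq).const_mul C
  have j0 := integrable_mul_of_memLp m0 w0
  have j1 := integrable_mul_of_memLp m1 w1
  have j2 := integrable_mul_of_memLp m2 w2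
  have jlin : Integrable fun x => p₀ x * w x + p₁ x * deriv w x + p₂ x * deriv (deriv w) x :=
    (j0.add j1).add j2
  have hmeasR : AEStronglyMeasurable R volume := by
    have hmw : Measurable fun x => m x + w x :=
      (hdm.continuous.add w.isH2.1.continuous).measurable
    have e1 : Measurable fun x => h (m x + w x) (deriv (fun x => m x + w x) x)
        (deriv (deriv (fun x => m x + w x)) x) :=
      hmeas.comp (hmw.prodMk ((measurable_deriv _).prodMk (measurable_deriv _)))
    exact (e1.aestronglyMeasurable.sub hint.1).sub jlin.1
  -- Integrability of the perturbed density is not assumed: it is the sum of the remainder, the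
  -- density at `m` and the linear term.
  have jR : Integrable R := hdom.mono' hmeasR hRle
  have jtot : Integrable fun x => h (m x + w x) (deriv (fun x => m x + w x) x)
      (deriv (deriv (fun x => m x + w x)) x) := by
    refine ((jR.add hint).add jlin).congr (ae_of_all _ fun x => ?_)
    simp only [hR, Pi.add_apply]
    ring
  -- Integration by parts, once for `p₁` and twice for `p₂`, turns the first variation into the
  -- Euler-Lagrange expression.
  have hLw : L w = ∫ x, (p₀ x * w x + p₁ x * deriv w x + p₂ x * deriv (deriv w) x) := by
    have b1 : ∫ x, p₁ x * deriv w x = -∫ x, p₁' x * w x :=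
      integral_mul_deriv_of_ac d1 c1 lb1 lt1 w.isH2.ac w.abs_le j1
        (integrable_mul_of_memLp m1' w0)
    have c2' : Continuous p₂' := continuous_iff_continuousAt.2 fun x => (d2' x).continuousAt
    have b2 : ∫ x, p₂ x * deriv (deriv w) x = -∫ x, p₂' x * deriv w x :=
      integral_mul_deriv_of_ac d2 c2' lb2 lt2 w.isH2.2.1 w.abs_deriv_le j2
        (integrable_mul_of_memLp m2' w1)
    have b3 : ∫ x, p₂' x * deriv w x = -∫ x, p₂'' x * w x :=
      integral_mul_deriv_of_ac d2' c2 lb2' lt2' w.isH2.ac w.abs_le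
        (integrable_mul_of_memLp m2' w1) (integrable_mul_of_memLp m2'' w0)
    rw [hL]
    refine Eq.trans ?_ (integral_add_add j0 j1 j2).symm
    rw [b1, b2, b3]
    have e : ∀ x, (p₀ x - p₁' x + p₂'' x) * w x = p₀ x * w x - p₁' x * w x + p₂'' x * w x :=
      fun x => by ring
    refine (integral_congr_ae (ae_of_all _ e)).trans ((integral_sub_add j0
      (integrable_mul_of_memLp m1' w0) (integrable_mul_of_memLp m2'' w0)).trans ?_)
    ring
  have hfin : (∫ x, h (m x + w x) (deriv (fun x => m x + w x) x)
      (deriv (deriv (fun x => m x + w x)) x)) - (∫ x, h (m x) (deriv m x) (deriv (deriv m) x))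
      - L w = ∫ x, R x := by
    rw [hLw]
    exact integral_sub_sub jtot hint jlin
  rw [hfin]
  refine (norm_integral_le_of_norm_le hdom hRle).trans ?_
  rw [integral_const_mul, norm_pow, norm_norm, w.norm_sq]
  exact (congrArg (C * ·)
    (integral_add_add w0.integrable_sq w1.integrable_sq w2.integrable_sq)).le

lemma IsGradient.lagrangian {κ l₁ l₂ : ℝ} {m g₁ g₂ g₃ : ℝ → ℝ} (h1 : IsGradient κ (F1 κ) m g₁)
    (h2 : IsGradient κ (F2 κ) m g₂) (h3 : IsGradient κ (F3 κ) m g₃) :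
    IsGradient κ (lagrangian κ l₁ l₂) m (fun x => g₃ x + l₁ * g₁ x + l₂ * g₂ x) := by
  obtain ⟨a1, hm, L1, e1, d1⟩ := h1
  obtain ⟨a2, _, L2, e2, d2⟩ := h2
  obtain ⟨a3, _, L3, e3, d3⟩ := h3
  refine ⟨(a3.add (a1.const_mul l₁)).add (a2.const_mul l₂), hm, L3 + l₁ • L1 + l₂ • L2, ?_, ?_⟩
  · intro w
    have i1 := integrable_mul_of_memLp a1 w.isH2.2.2.1
    have i2 := integrable_mul_of_memLp a2 w.isH2.2.2.1
    have i3 := integrable_mul_of_memLp a3 w.isH2.2.2.1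
    have e : ∀ x, (g₃ x + l₁ * g₁ x + l₂ * g₂ x) * w x
        = g₃ x * w x + l₁ * (g₁ x * w x) + l₂ * (g₂ x * w x) := fun x => by ring
    refine Eq.trans ?_ ((integral_congr_ae (ae_of_all _ e)).trans
      (integral_add_add i3 (i1.const_mul l₁) (i2.const_mul l₂))).symm
    rw [integral_const_mul, integral_const_mul, ← e1, ← e2, ← e3]
    simp
  · exact (d3.add (d1.const_mul l₁)).add (d2.const_mul l₂)

lemma isH2_of_contDiff_hasCompactSupport {φ : ℝ → ℝ} (hφ : ContDiff ℝ 2 φ)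
    (hs : HasCompactSupport φ) : IsH2 φ := by
  have h1 : ContDiff ℝ 1 (deriv φ) := by
    have : ContDiff ℝ (1 + 1) φ := by simpa [one_add_one_eq_two] using hφ
    exact (contDiff_succ_iff_deriv.1 this).2.2
  have h2 : Continuous (deriv (deriv φ)) := h1.continuous_deriv le_rfl
  exact ⟨hφ.differentiable (by norm_num), fun a b => h1.contDiffOn.absolutelyContinuousOnInterval,
    hφ.continuous.memLp_of_hasCompactSupport hs, h1.continuous.memLp_of_hasCompactSupport hs.deriv,
    h2.memLp_of_hasCompactSupport hs.deriv.deriv⟩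

/-- At a point with a continuous `L²` gradient, criticality means that the gradient vanishes. -/
lemma IsGradient.isCriticalPoint_iff {κ : ℝ} {Φ : (ℝ → ℝ) → ℝ} {m g : ℝ → ℝ}
    (h : IsGradient κ Φ m g) (hg : Continuous g) : IsCriticalPoint κ Φ m ↔ ∀ x, g x = 0 := by
  obtain ⟨_, hm, L, e, d⟩ := h
  constructor
  · rintro ⟨_, hcrit⟩ x
    -- Both derivatives are taken at the same point, so they agree. Smooth compactly supported test
    -- functions lie in `H²` and force the gradient to vanish almost everywhere; continuity then
    -- gives every point.
    have hL : L = 0 := d.unique hcrit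
    have hae : ∀ᵐ x, g x = 0 := by
      refine ae_eq_zero_of_integral_contDiff_smul_eq_zero hg.locallyIntegrable ?_
      intro φ hφ hs
      have hw := isH2_of_contDiff_hasCompactSupport (contDiff_infty.1 hφ 2) hs
      have h1 := e (H2.mk φ hw)
      rw [hL] at h1
      calc ∫ x, φ x • g x = ∫ x, g x * φ x := by simp_rw [smul_eq_mul, mul_comm]
        _ = 0 := h1.symm
    exact congrFun ((Continuous.ae_eq_iff_eq volume hg continuous_const).1 hae) x
  · intro h0
    have hL : L = 0 := by
      ext w
      rw [e]
      simp [h0]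
    rw [hL] at d
    exact ⟨hm, d⟩

/-! ### Exponentially decaying functions -/

/-- Continuous functions bounded by `K e^{-δ|x|}` for some `δ > 0`. -/
def ExpDecay (f : ℝ → ℝ) : Prop :=
  Continuous f ∧ ∃ K δ : ℝ, 0 < δ ∧ ∀ x, |f x| ≤ K * Real.exp (-(δ * |x|))

/-- Bounded continuous functions. -/
def BddCont (f : ℝ → ℝ) : Prop := Continuous f ∧ ∃ K : ℝ, ∀ x, |f x| ≤ K

lemma BddCont.const (c : ℝ) : BddCont fun _ => c := ⟨continuous_const, |c|, fun _ => le_rfl⟩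

lemma BddCont.add {f g : ℝ → ℝ} (hf : BddCont f) (hg : BddCont g) :
    BddCont fun x => f x + g x := by
  obtain ⟨cf, K, hK⟩ := hf
  obtain ⟨cg, L, hL⟩ := hg
  exact ⟨cf.add cg, K + L, fun x => (abs_add_le _ _).trans (add_le_add (hK x) (hL x))⟩

lemma BddCont.mul {f g : ℝ → ℝ} (hf : BddCont f) (hg : BddCont g) :
    BddCont fun x => f x * g x := by
  obtain ⟨cf, K, hK⟩ := hf
  obtain ⟨cg, L, hL⟩ := hg
  refine ⟨cf.mul cg, K * L, fun x => ?_⟩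
  rw [abs_mul]
  exact mul_le_mul (hK x) (hL x) (abs_nonneg _) ((abs_nonneg _).trans (hK x))

lemma BddCont.pow {f : ℝ → ℝ} (hf : BddCont f) (n : ℕ) : BddCont fun x => f x ^ n := by
  induction n with
  | zero => simpa using BddCont.const 1
  | succ n ih => simpa [pow_succ] using ih.mul hf

lemma BddCont.inv {f : ℝ → ℝ} (hf : Continuous f) {δ : ℝ} (hδ : 0 < δ) (h : ∀ x, δ ≤ f x) :
    BddCont fun x => (f x)⁻¹ := by
  refine ⟨hf.inv₀ fun x => (hδ.trans_le (h x)).ne', δ⁻¹, fun x => ?_⟩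
  rw [abs_of_pos (inv_pos.2 (hδ.trans_le (h x)))]
  exact inv_anti₀ hδ (h x)

lemma ExpDecay.bddCont {f : ℝ → ℝ} (hf : ExpDecay f) : BddCont f := by
  obtain ⟨cf, K, δ, hδ, hK⟩ := hf
  have hK0 : 0 ≤ K := by simpa using (abs_nonneg _).trans (hK 0)
  refine ⟨cf, K, fun x => (hK x).trans (mul_le_of_le_one_right hK0 ?_)⟩
  rw [Real.exp_le_one_iff]
  have := abs_nonneg x
  nlinarith

lemma ExpDecay.zero : ExpDecay fun _ => 0 :=
  ⟨continuous_const, 0, 1, one_pos, fun x => by simp⟩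

lemma ExpDecay.mul_bdd {f g : ℝ → ℝ} (hf : ExpDecay f) (hg : BddCont g) :
    ExpDecay fun x => f x * g x := by
  obtain ⟨cf, K, δ, hδ, hK⟩ := hf
  obtain ⟨cg, L, hL⟩ := hg
  refine ⟨cf.mul cg, K * L, δ, hδ, fun x => ?_⟩
  rw [abs_mul]
  calc |f x| * |g x| ≤ (K * Real.exp (-(δ * |x|))) * L :=
        mul_le_mul (hK x) (hL x) (abs_nonneg _) ((abs_nonneg _).trans (hK x))
    _ = _ := by ring

lemma ExpDecay.add {f g : ℝ → ℝ} (hf : ExpDecay f) (hg : ExpDecay g) :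
    ExpDecay fun x => f x + g x := by
  obtain ⟨cf, K, δ, hδ, hK⟩ := hf
  obtain ⟨cg, L, η, hη, hL⟩ := hg
  have hK0 : 0 ≤ K := by simpa using (abs_nonneg _).trans (hK 0)
  have hL0 : 0 ≤ L := by simpa using (abs_nonneg _).trans (hL 0)
  refine ⟨cf.add cg, K + L, min δ η, lt_min hδ hη, fun x => ?_⟩
  have e1 : Real.exp (-(δ * |x|)) ≤ Real.exp (-(min δ η * |x|)) := by
    gcongr
    exact min_le_left _ _
  have e2 : Real.exp (-(η * |x|)) ≤ Real.exp (-(min δ η * |x|)) := by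
    gcongr
    exact min_le_right _ _
  calc |f x + g x| ≤ |f x| + |g x| := abs_add_le _ _
    _ ≤ K * Real.exp (-(min δ η * |x|)) + L * Real.exp (-(min δ η * |x|)) :=
        add_le_add ((hK x).trans (by gcongr)) ((hL x).trans (by gcongr))
    _ = _ := by ring

lemma ExpDecay.sub {f g : ℝ → ℝ} (hf : ExpDecay f) (hg : ExpDecay g) :
    ExpDecay fun x => f x - g x := by
  have := hf.add (hg.mul_bdd (BddCont.const (-1)))
  simpa [sub_eq_add_neg] using this

/-- By induction on `fⁿ⁺¹ - cⁿ⁺¹ = (fⁿ - cⁿ)f + (f - c)cⁿ`. -/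
lemma ExpDecay.pow_sub_pow {f : ℝ → ℝ} {c : ℝ} (hf : ExpDecay fun x => f x - c) (n : ℕ) :
    ExpDecay fun x => f x ^ n - c ^ n := by
  have hb : BddCont f := by simpa using hf.bddCont.add (BddCont.const c)
  induction n with
  | zero => simpa using ExpDecay.zero
  | succ n ih =>
    have := (ih.mul_bdd hb).add (hf.mul_bdd (BddCont.const (c ^ n)))
    refine cast (congrArg ExpDecay (funext fun x => ?_)) this
    ring

lemma ExpDecay.of_abs_le {f g : ℝ → ℝ} (hg : ExpDecay g) (hf : Continuous f)
    (h : ∀ x, |f x| ≤ g x) : ExpDecay f := by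
  obtain ⟨_, K, δ, hδ, hK⟩ := hg
  exact ⟨hf, K, δ, hδ, fun x => (h x).trans ((le_abs_self _).trans (hK x))⟩

lemma integrable_exp_neg_mul_abs {δ : ℝ} (hδ : 0 < δ) :
    Integrable fun x : ℝ => Real.exp (-(δ * |x|)) := by
  rw [← integrableOn_univ, ← Set.Iic_union_Ioi (a := (0 : ℝ))]
  refine IntegrableOn.union ?_ ?_
  · refine (integrableOn_exp_mul_Iic hδ 0).congr_fun (fun x hx => ?_) measurableSet_Iic
    simp only
    rw [abs_of_nonpos hx, mul_neg, neg_neg]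
  · refine (integrableOn_exp_mul_Ioi (neg_lt_zero.2 hδ) 0).congr_fun (fun x hx => ?_)
      measurableSet_Ioi
    simp only
    rw [abs_of_pos hx, neg_mul]

lemma ExpDecay.integrable {f : ℝ → ℝ} (hf : ExpDecay f) : Integrable f := by
  obtain ⟨cf, K, δ, hδ, hK⟩ := hf
  exact ((integrable_exp_neg_mul_abs hδ).const_mul K).mono' cf.aestronglyMeasurable
    (ae_of_all _ hK)

lemma ExpDecay.memLp {f : ℝ → ℝ} (hf : ExpDecay f) : MemLp f 2 volume := by
  rw [memLp_two_iff_integrable_sq hf.1.aestronglyMeasurable]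
  have := (hf.mul_bdd hf.bddCont).integrable
  simpa [sq] using this

lemma ExpDecay.tendsto_cocompact {f : ℝ → ℝ} (hf : ExpDecay f) :
    Tendsto f (cocompact ℝ) (𝓝 0) := by
  obtain ⟨cf, K, δ, hδ, hK⟩ := hf
  refine squeeze_zero_norm hK ?_
  have h1 : Tendsto (fun x : ℝ => δ * |x|) (cocompact ℝ) atTop :=
    (tendsto_norm_cocompact_atTop (E := ℝ)).const_mul_atTop hδ
  have h2 := (Real.tendsto_exp_neg_atTop_nhds_zero.comp h1).const_mul K
  simpa using h2

lemma ExpDecay.tendsto_atBot {f : ℝ → ℝ} (hf : ExpDecay f) : Tendsto f atBot (𝓝 0) :=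
  hf.tendsto_cocompact.mono_left atBot_le_cocompact

lemma ExpDecay.tendsto_atTop {f : ℝ → ℝ} (hf : ExpDecay f) : Tendsto f atTop (𝓝 0) :=
  hf.tendsto_cocompact.mono_left atTop_le_cocompact

/-! ### First order expansions with quadratic remainder -/

/-- `N = N₀ + N₁ + O((|α| + |β|)²)` with `N₀ = O(1)` and `N₁ = O(|α| + |β|)`, uniformly in `x` and
in `|α|, |β| ≤ ε`. -/
def QuadExp (ε : ℝ) (N N₀ N₁ : ℝ → ℝ → ℝ → ℝ) : Prop :=
  ∃ C : ℝ, ∀ x α β, |α| ≤ ε → |β| ≤ ε →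
    |N₀ x α β| ≤ C ∧ |N₁ x α β| ≤ C * (|α| + |β|) ∧
      |N x α β - N₀ x α β - N₁ x α β| ≤ C * (|α| + |β|) ^ 2

lemma QuadExp.const (ε c : ℝ) :
    QuadExp ε (fun _ _ _ => c) (fun _ _ _ => c) (fun _ _ _ => 0) :=
  ⟨|c|, fun x α β _ _ => ⟨le_rfl, by simp; positivity, by simp; positivity⟩⟩

lemma QuadExp.fst (ε : ℝ) {m : ℝ → ℝ} (hm : BddCont m) :
    QuadExp ε (fun x α _ => m x + α) (fun x _ _ => m x) (fun _ α _ => α) := by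
  obtain ⟨_, K, hK⟩ := hm
  have hK0 : 0 ≤ K := (abs_nonneg _).trans (hK 0)
  refine ⟨K + 1, fun x α β _ _ => ⟨(hK x).trans (by linarith), ?_, ?_⟩⟩
  · nlinarith [abs_nonneg α, abs_nonneg β, mul_nonneg hK0 (abs_nonneg α),
      mul_nonneg hK0 (abs_nonneg β)]
  · rw [add_sub_cancel_left, sub_self, abs_zero]
    positivity

lemma QuadExp.snd (ε : ℝ) {m : ℝ → ℝ} (hm : BddCont m) :
    QuadExp ε (fun x _ β => m x + β) (fun x _ _ => m x) (fun _ _ β => β) := by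
  obtain ⟨_, K, hK⟩ := hm
  have hK0 : 0 ≤ K := (abs_nonneg _).trans (hK 0)
  refine ⟨K + 1, fun x α β _ _ => ⟨(hK x).trans (by linarith), ?_, ?_⟩⟩
  · nlinarith [abs_nonneg α, abs_nonneg β, mul_nonneg hK0 (abs_nonneg α),
      mul_nonneg hK0 (abs_nonneg β)]
  · rw [add_sub_cancel_left, sub_self, abs_zero]
    positivity

/-- The remainder is exactly `α² m⁻² (m + α)⁻¹`, and `ε ≤ δ / 2` keeps `m + α` above `δ / 2`. -/
lemma QuadExp.inv {ε δ : ℝ} {m : ℝ → ℝ} (hδ : 0 < δ) (hε : ε ≤ δ / 2) (hm : ∀ x, δ ≤ m x) :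
    QuadExp ε (fun x α _ => (m x + α)⁻¹) (fun x _ _ => (m x)⁻¹)
      (fun x α _ => -α * (m x)⁻¹ ^ 2) := by
  have hd : 0 < δ⁻¹ := inv_pos.2 hδ
  refine ⟨δ⁻¹ + δ⁻¹ ^ 2 + 2 * δ⁻¹ ^ 3, fun x α β hα _ => ?_⟩
  have hi0 : 0 < m x := hδ.trans_le (hm x)
  have hI0 : δ / 2 ≤ m x + α := by linarith [(abs_le.1 hα).1, hm x]
  have hIp : 0 < m x + α := (half_pos hδ).trans_le hI0
  have hi : (m x)⁻¹ ≤ δ⁻¹ := inv_anti₀ hδ (hm x)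
  have hI : (m x + α)⁻¹ ≤ 2 * δ⁻¹ := by
    have := inv_anti₀ (half_pos hδ) hI0
    rwa [inv_div, div_eq_mul_inv] at this
  have hip : 0 < (m x)⁻¹ := inv_pos.2 hi0
  have hIp' : 0 < (m x + α)⁻¹ := inv_pos.2 hIp
  have hJ : |α| ≤ |α| + |β| := by linarith [abs_nonneg β]
  have hi2 : (m x)⁻¹ ^ 2 ≤ δ⁻¹ ^ 2 := by gcongr
  refine ⟨?_, ?_, ?_⟩
  · rw [abs_of_pos hip]
    have : 0 < δ⁻¹ ^ 2 + 2 * δ⁻¹ ^ 3 := by positivity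
    linarith
  · rw [abs_mul, abs_neg, abs_of_pos (pow_pos hip 2)]
    calc |α| * (m x)⁻¹ ^ 2 ≤ (|α| + |β|) * δ⁻¹ ^ 2 := by gcongr
      _ ≤ (|α| + |β|) * (δ⁻¹ + δ⁻¹ ^ 2 + 2 * δ⁻¹ ^ 3) := by
        gcongr
        have : 0 < δ⁻¹ + 2 * δ⁻¹ ^ 3 := by positivity
        linarith
      _ = _ := mul_comm _ _
  · have e : (m x + α)⁻¹ - (m x)⁻¹ - -α * (m x)⁻¹ ^ 2 = α ^ 2 * ((m x)⁻¹ ^ 2 * (m x + α)⁻¹) := by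
      field_simp
      ring
    rw [e, abs_mul, abs_of_pos (mul_pos (pow_pos hip 2) hIp'), abs_pow]
    calc |α| ^ 2 * ((m x)⁻¹ ^ 2 * (m x + α)⁻¹)
        ≤ (|α| + |β|) ^ 2 * (δ⁻¹ ^ 2 * (2 * δ⁻¹)) := by gcongr
      _ = 2 * δ⁻¹ ^ 3 * (|α| + |β|) ^ 2 := by ring
      _ ≤ (δ⁻¹ + δ⁻¹ ^ 2 + 2 * δ⁻¹ ^ 3) * (|α| + |β|) ^ 2 := by
        gcongr
        have : 0 < δ⁻¹ + δ⁻¹ ^ 2 := by positivity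
        linarith

lemma QuadExp.add {ε : ℝ} {N N₀ N₁ M M₀ M₁ : ℝ → ℝ → ℝ → ℝ} (hN : QuadExp ε N N₀ N₁)
    (hM : QuadExp ε M M₀ M₁) :
    QuadExp ε (fun x α β => N x α β + M x α β) (fun x α β => N₀ x α β + M₀ x α β)
      (fun x α β => N₁ x α β + M₁ x α β) := by
  obtain ⟨C, hC⟩ := hN
  obtain ⟨D, hD⟩ := hM
  refine ⟨C + D, fun x α β hα hβ => ?_⟩
  obtain ⟨a1, a2, a3⟩ := hC x α β hα hβ
  obtain ⟨b1, b2, b3⟩ := hD x α β hα hβ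
  refine ⟨(abs_add_le _ _).trans (by linarith), (abs_add_le _ _).trans (by linarith), ?_⟩
  have e : N x α β + M x α β - (N₀ x α β + M₀ x α β) - (N₁ x α β + M₁ x α β)
      = (N x α β - N₀ x α β - N₁ x α β) + (M x α β - M₀ x α β - M₁ x α β) := by ring
  rw [e]
  exact (abs_add_le _ _).trans (by linarith)

lemma QuadExp.mul {ε : ℝ} (hε : ε ≤ 1 / 2) {N N₀ N₁ M M₀ M₁ : ℝ → ℝ → ℝ → ℝ}
    (hN : QuadExp ε N N₀ N₁) (hM : QuadExp ε M M₀ M₁) :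
    QuadExp ε (fun x α β => N x α β * M x α β) (fun x α β => N₀ x α β * M₀ x α β)
      (fun x α β => N₀ x α β * M₁ x α β + N₁ x α β * M₀ x α β) := by
  obtain ⟨C, hC⟩ := hN
  obtain ⟨D, hD⟩ := hM
  -- The four pieces of the remainder below contribute 1 + 1 + 1 + 3. Since `ε ≤ 1/2`, `J = |α| +
  -- |β| ≤ 1`, and higher powers of `J` are absorbed.
  refine ⟨6 * (|C| * |D|), fun x α β hα hβ => ?_⟩
  obtain ⟨a1, a2, a3⟩ := hC x α β hα hβ
  obtain ⟨b1, b2, b3⟩ := hD x α β hα hβ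
  set J := |α| + |β| with hJ
  have hJ0 : 0 ≤ J := by positivity
  have hJ1 : J ≤ 1 := by linarith
  have hC0 : C ≤ |C| := le_abs_self C
  have hD0 : D ≤ |D| := le_abs_self D
  have a1' : |N₀ x α β| ≤ |C| := a1.trans hC0
  have a2' : |N₁ x α β| ≤ |C| * J := a2.trans (by gcongr)
  have a3' : |N x α β - N₀ x α β - N₁ x α β| ≤ |C| * J ^ 2 := a3.trans (by gcongr)
  have b1' : |M₀ x α β| ≤ |D| := b1.trans hD0
  have b2' : |M₁ x α β| ≤ |D| * J := b2.trans (by gcongr)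
  have b3' : |M x α β - M₀ x α β - M₁ x α β| ≤ |D| * J ^ 2 := b3.trans (by gcongr)
  have hCD : 0 ≤ |C| * |D| := by positivity
  refine ⟨?_, ?_, ?_⟩
  · rw [abs_mul]
    calc |N₀ x α β| * |M₀ x α β| ≤ |C| * |D| := by gcongr
      _ ≤ _ := by linarith
  · refine (abs_add_le _ _).trans ?_
    rw [abs_mul, abs_mul]
    calc |N₀ x α β| * |M₁ x α β| + |N₁ x α β| * |M₀ x α β|
        ≤ |C| * (|D| * J) + (|C| * J) * |D| := by gcongr
      _ = 2 * (|C| * |D|) * J := by ring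
      _ ≤ _ := by gcongr; linarith
  · set R := N x α β - N₀ x α β - N₁ x α β with hR
    set S := M x α β - M₀ x α β - M₁ x α β with hS
    have e : N x α β * M x α β - N₀ x α β * M₀ x α β
        - (N₀ x α β * M₁ x α β + N₁ x α β * M₀ x α β)
        = N₁ x α β * M₁ x α β + N₀ x α β * S + N₁ x α β * S + R * (M₀ x α β + M₁ x α β + S) := by
      rw [hR, hS]; ring
    rw [e]
    have hJ2 : J ^ 2 ≤ 1 := pow_le_one₀ hJ0 hJ1
    have hM' : |M₀ x α β + M₁ x α β + S| ≤ |D| * 3 := by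
      refine (abs_add_three _ _ _).trans ?_
      have h1 : |D| * J ≤ |D| * 1 := by gcongr
      have h2 : |D| * J ^ 2 ≤ |D| * 1 := by gcongr
      linarith
    have t1 : |N₁ x α β * M₁ x α β| ≤ |C| * |D| * J ^ 2 := by
      rw [abs_mul]
      calc _ ≤ (|C| * J) * (|D| * J) := by gcongr
        _ = _ := by ring
    have t2 : |N₀ x α β * S| ≤ |C| * |D| * J ^ 2 := by
      rw [abs_mul]
      calc _ ≤ |C| * (|D| * J ^ 2) := by gcongr
        _ = _ := by ring
    have t3 : |N₁ x α β * S| ≤ |C| * |D| * J ^ 2 := by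
      rw [abs_mul]
      calc _ ≤ (|C| * J) * (|D| * J ^ 2) := by gcongr
        _ = |C| * |D| * J ^ 2 * J := by ring
        _ ≤ |C| * |D| * J ^ 2 * 1 := by gcongr
        _ = _ := by ring
    have t4 : |R * (M₀ x α β + M₁ x α β + S)| ≤ |C| * |D| * J ^ 2 * 3 := by
      rw [abs_mul]
      calc _ ≤ (|C| * J ^ 2) * (|D| * 3) := by gcongr
        _ = _ := by ring
    refine (abs_add_le _ _).trans ?_
    refine (add_le_add_left (abs_add_three _ _ _) _).trans ?_
    linarith

lemma QuadExp.pow {ε : ℝ} (hε : ε ≤ 1 / 2) {N N₀ N₁ : ℝ → ℝ → ℝ → ℝ} (hN : QuadExp ε N N₀ N₁)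
    (n : ℕ) :
    QuadExp ε (fun x α β => N x α β ^ (n + 1)) (fun x α β => N₀ x α β ^ (n + 1))
      (fun x α β => (n + 1) * N₀ x α β ^ n * N₁ x α β) := by
  induction n with
  | zero => simpa using hN
  | succ n ih =>
    have h := QuadExp.mul hε ih hN
    have e : (fun x α β => N₀ x α β ^ (n + 1) * N₁ x α β
        + (n + 1) * N₀ x α β ^ n * N₁ x α β * N₀ x α β)
        = fun x α β => ((n + 1 : ℕ) + 1) * N₀ x α β ^ (n + 1) * N₁ x α β := by
      funext x α β
      push_cast
      ring
    rw [e] at h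
    simpa only [← pow_succ] using h

lemma QuadExp.const_mul {ε : ℝ} (c : ℝ) {N N₀ N₁ : ℝ → ℝ → ℝ → ℝ} (hN : QuadExp ε N N₀ N₁) :
    QuadExp ε (fun x α β => c * N x α β) (fun x α β => c * N₀ x α β)
      (fun x α β => c * N₁ x α β) := by
  obtain ⟨C, hC⟩ := hN
  refine ⟨|c| * C, fun x α β hα hβ => ?_⟩
  obtain ⟨a1, a2, a3⟩ := hC x α β hα hβ
  rw [abs_mul, abs_mul, ← mul_sub, ← mul_sub, abs_mul, mul_assoc, mul_assoc]
  exact ⟨by gcongr, by gcongr, by gcongr⟩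

lemma QuadExp.bound {ε : ℝ} {N N₀ N₁ : ℝ → ℝ → ℝ → ℝ} (hN : QuadExp ε N N₀ N₁) :
    ∃ C : ℝ, 0 ≤ C ∧ ∀ x α β, |α| ≤ ε → |β| ≤ ε →
      |N x α β - N₀ x α β - N₁ x α β| ≤ C * (α ^ 2 + β ^ 2) := by
  obtain ⟨C, hC⟩ := hN
  refine ⟨2 * |C|, by positivity, fun x α β hα hβ => (hC x α β hα hβ).2.2.trans ?_⟩
  calc C * (|α| + |β|) ^ 2 ≤ |C| * (|α| + |β|) ^ 2 := by gcongr; exact le_abs_self C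
    _ ≤ |C| * (2 * (α ^ 2 + β ^ 2)) := by
      gcongr
      nlinarith [sq_nonneg (|α| - |β|), sq_abs α, sq_abs β]
    _ = _ := by ring

/-- The expansion of `(c + γ)² N`, quadratic in the unbounded increment `γ`. -/
lemma QuadExp.sq_mul_bound {ε : ℝ} (hε : ε ≤ 1 / 2) {N N₀ N₁ : ℝ → ℝ → ℝ → ℝ}
    (hN : QuadExp ε N N₀ N₁) {c : ℝ → ℝ} (hc : BddCont c) :
    ∃ C : ℝ, 0 ≤ C ∧ ∀ x α β γ, |α| ≤ ε → |β| ≤ ε →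
      |(c x + γ) ^ 2 * N x α β - c x ^ 2 * N₀ x α β
        - (2 * c x * γ * N₀ x α β + c x ^ 2 * N₁ x α β)| ≤ C * (α ^ 2 + β ^ 2 + γ ^ 2) := by
  obtain ⟨C, hC⟩ := hN
  obtain ⟨_, M, hM⟩ := hc
  -- The bounds `t1`, `t2`, `t3` give `3M²|C|J² + 5|C|γ²` in total, and `J² ≤ 2(α² + β²)`.
  refine ⟨2 * (M ^ 2 * |C|) + 4 * (M ^ 2 * |C|) + 5 * |C|, by positivity, fun x α β γ hα hβ => ?_⟩
  obtain ⟨a1, a2, a3⟩ := hC x α β hα hβ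
  set J := |α| + |β| with hJ
  have hJ0 : 0 ≤ J := by positivity
  have hJ1 : J ≤ 1 := by linarith
  have hJ2 : J ^ 2 ≤ 1 := pow_le_one₀ hJ0 hJ1
  have hJs : J ^ 2 ≤ 2 * (α ^ 2 + β ^ 2) := by
    nlinarith [sq_nonneg (|α| - |β|), sq_abs α, sq_abs β]
  have hC0 : C ≤ |C| := le_abs_self C
  have hCn := abs_nonneg C
  have a1' : |N₀ x α β| ≤ |C| := a1.trans hC0
  have a2' : |N₁ x α β| ≤ |C| * J := a2.trans (by gcongr)
  set R := N x α β - N₀ x α β - N₁ x α β with hR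
  have a3' : |R| ≤ |C| * J ^ 2 := a3.trans (by gcongr)
  have hcx := hM x
  have hM0 : 0 ≤ M := (abs_nonneg _).trans hcx
  have e : (c x + γ) ^ 2 * N x α β - c x ^ 2 * N₀ x α β
        - (2 * c x * γ * N₀ x α β + c x ^ 2 * N₁ x α β)
      = c x ^ 2 * R + 2 * (c x * γ * (N₁ x α β + R)) + γ ^ 2 * (N₀ x α β + N₁ x α β + R) := by
    rw [hR]; ring
  rw [e]
  have hCJ : |C| * J ≤ |C| * 1 := by gcongr
  have hCJ2 : |C| * J ^ 2 ≤ |C| * 1 := by gcongr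
  have hCJJ : |C| * J ^ 2 ≤ |C| * J := by
    have : J ^ 2 ≤ J := by nlinarith
    gcongr
  have t1 : |c x ^ 2 * R| ≤ M ^ 2 * |C| * J ^ 2 := by
    rw [abs_mul, abs_pow]
    calc _ ≤ M ^ 2 * (|C| * J ^ 2) := by gcongr
      _ = _ := by ring
  have hs : |N₁ x α β + R| ≤ 2 * |C| * J := (abs_add_le _ _).trans (by linarith)
  have t2 : |2 * (c x * γ * (N₁ x α β + R))| ≤ 2 * (M ^ 2 * |C|) * J ^ 2 + 2 * |C| * γ ^ 2 := by
    rw [abs_mul, abs_mul, abs_mul, abs_two]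
    calc 2 * (|c x| * |γ| * |N₁ x α β + R|) ≤ 2 * (M * |γ| * (2 * |C| * J)) := by gcongr
      _ = 2 * |C| * (2 * (M * J) * |γ|) := by ring
      _ ≤ 2 * |C| * ((M * J) ^ 2 + |γ| ^ 2) := by
        gcongr
        exact two_mul_le_add_sq _ _
      _ = _ := by rw [sq_abs]; ring
  have t3 : |γ ^ 2 * (N₀ x α β + N₁ x α β + R)| ≤ 3 * |C| * γ ^ 2 := by
    rw [abs_mul, abs_of_nonneg (sq_nonneg γ)]
    have : |N₀ x α β + N₁ x α β + R| ≤ 3 * |C| := (abs_add_three _ _ _).trans (by linarith)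
    calc γ ^ 2 * |N₀ x α β + N₁ x α β + R| ≤ γ ^ 2 * (3 * |C|) := by gcongr
      _ = _ := by ring
  refine (abs_add_three _ _ _).trans ?_
  have hMC : 0 ≤ M ^ 2 * |C| := by positivity
  have h1 : M ^ 2 * |C| * J ^ 2 ≤ M ^ 2 * |C| * (2 * (α ^ 2 + β ^ 2)) := by gcongr
  have h2 : 0 ≤ M ^ 2 * |C| * γ ^ 2 := by positivity
  have h3 : 0 ≤ |C| * (α ^ 2 + β ^ 2) := by positivity
  linarith

/-! ### Gradients at smooth, exponentially localized profiles -/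

/-- A positive four times differentiable function `m` which tends to `κ` exponentially fast, together
with its derivatives `m₁, …, m₄`. -/
structure IsProfile (κ : ℝ) (m m₁ m₂ m₃ m₄ : ℝ → ℝ) : Prop where
  d0 : ∀ x, HasDerivAt m (m₁ x) x
  d1 : ∀ x, HasDerivAt m₁ (m₂ x) x
  d2 : ∀ x, HasDerivAt m₂ (m₃ x) x
  d3 : ∀ x, HasDerivAt m₃ (m₄ x) x
  lower : ∃ δ > 0, ∀ x, δ ≤ m x
  e0 : ExpDecay fun x => m x - κ
  e1 : ExpDecay m₁
  e2 : ExpDecay m₂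
  e3 : ExpDecay m₃
  e4 : ExpDecay m₄

namespace IsProfile

variable {κ : ℝ} {m m₁ m₂ m₃ m₄ : ℝ → ℝ}

lemma deriv_eq (h : IsProfile κ m m₁ m₂ m₃ m₄) : deriv m = m₁ := funext fun x => (h.d0 x).deriv

lemma deriv_deriv_eq (h : IsProfile κ m m₁ m₂ m₃ m₄) : deriv (deriv m) = m₂ := by
  rw [h.deriv_eq]
  exact funext fun x => (h.d1 x).deriv

lemma iteratedDeriv_three (h : IsProfile κ m m₁ m₂ m₃ m₄) : iteratedDeriv 3 m = m₃ := by
  rw [iteratedDeriv_succ, iteratedDeriv_succ, iteratedDeriv_one, h.deriv_deriv_eq]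
  exact funext fun x => (h.d2 x).deriv

lemma iteratedDeriv_four (h : IsProfile κ m m₁ m₂ m₃ m₄) : iteratedDeriv 4 m = m₄ := by
  rw [iteratedDeriv_succ, h.iteratedDeriv_three]
  exact funext fun x => (h.d3 x).deriv

lemma pos (h : IsProfile κ m m₁ m₂ m₃ m₄) (x : ℝ) : 0 < m x := by
  obtain ⟨δ, hδ, hm⟩ := h.lower
  exact hδ.trans_le (hm x)

lemma bdd (h : IsProfile κ m m₁ m₂ m₃ m₄) : BddCont m := by
  simpa using h.e0.bddCont.add (BddCont.const κ)

lemma inv_bdd (h : IsProfile κ m m₁ m₂ m₃ m₄) : BddCont fun x => (m x)⁻¹ := by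
  obtain ⟨δ, hδ, hm⟩ := h.lower
  exact BddCont.inv h.bdd.1 hδ hm

lemma inv_sub (h : IsProfile κ m m₁ m₂ m₃ m₄) (hκ : κ ≠ 0) :
    ExpDecay fun x => (m x)⁻¹ - κ⁻¹ := by
  have := h.e0.mul_bdd (h.inv_bdd.mul (BddCont.const (-κ⁻¹)))
  refine cast (congrArg ExpDecay (funext fun x => ?_)) this
  have := (h.pos x).ne'
  field_simp
  ring

lemma hasDerivAt_inv (h : IsProfile κ m m₁ m₂ m₃ m₄) (x : ℝ) :
    HasDerivAt (fun x => (m x)⁻¹) (-(m₁ x) * (m x)⁻¹ ^ 2) x := by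
  refine ((h.d0 x).inv (h.pos x).ne').congr_deriv ?_
  rw [div_eq_mul_inv, inv_pow]

lemma hasDerivAt_inv_pow (h : IsProfile κ m m₁ m₂ m₃ m₄) (n : ℕ) (x : ℝ) :
    HasDerivAt (fun x => (m x)⁻¹ ^ n) (-(n * m₁ x * (m x)⁻¹ ^ (n + 1))) x := by
  refine ((h.hasDerivAt_inv x).pow n).congr_deriv ?_
  rcases n with _ | n
  · simp
  · simp only [Nat.add_sub_cancel]
    ring

lemma mem_XSpace (h : IsProfile κ m m₁ m₂ m₃ m₄) : m ∈ XSpace κ := by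
  have d : deriv (fun x => m x - κ) = m₁ := funext fun x => ((h.d0 x).sub_const κ).deriv
  refine ⟨⟨fun x => ((h.d0 x).sub_const κ).differentiableAt, ?_, h.e0.memLp, ?_, ?_⟩, h.pos⟩
  · rw [d]
    exact ac_of_continuous_deriv h.d1 h.e2.1
  · rw [d]
    exact h.e1.memLp
  · rw [d, show deriv m₁ = m₂ from funext fun x => (h.d1 x).deriv]
    exact h.e2.memLp

/-- The constants in the density make it equal to `(1/m - 1/κ) + (m - κ)/κ²`, which decays; the
density contains no derivatives, so `p₁ = p₂ = 0`. -/
theorem isGradient_F1 (hκ : 0 < κ) (h : IsProfile κ m m₁ m₂ m₃ m₄) :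
    IsGradient κ (F1 κ) m (G1 κ m) := by
  obtain ⟨δ, hδ, hm⟩ := h.lower
  have hεpos : 0 < min (δ / 2) (1 / 2) := by positivity
  have hε1 : min (δ / 2) (1 / 2) ≤ δ / 2 := min_le_left _ _
  have q := ((QuadExp.inv hδ hε1 hm).add ((QuadExp.fst _ h.bdd).const_mul (1 / κ ^ 2))).add
    (QuadExp.const _ (-(2 / κ)))
  obtain ⟨C, hC0, hC⟩ := q.bound
  have p0 : ExpDecay fun x => ((m x)⁻¹ ^ 2 - κ⁻¹ ^ 2) * (-1) :=
    ((h.inv_sub hκ.ne').pow_sub_pow 2).mul_bdd (BddCont.const _)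
  have hi : ExpDecay fun x => ((m x)⁻¹ - κ⁻¹) + (m x - κ) * (1 / κ ^ 2) :=
    (h.inv_sub hκ.ne').add (h.e0.mul_bdd (BddCont.const _))
  have z := ExpDecay.zero
  have dz : ∀ x : ℝ, HasDerivAt (fun _ : ℝ => (0 : ℝ)) 0 x := fun x => hasDerivAt_const x 0
  have key := isGradient_of_expansion (h := fun a _ _ => 1 / a + 1 / κ ^ 2 * a - 2 / κ)
    h.mem_XSpace (by fun_prop) p0.memLp z.memLp z.memLp z.memLp z.memLp z.memLp dz dz dz
    continuous_const continuous_const z.tendsto_atBot z.tendsto_atTop z.tendsto_atBot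
    z.tendsto_atTop z.tendsto_atBot z.tendsto_atTop
    (hi.integrable.congr (ae_of_all _ fun x => by
      have := (h.pos x).ne'
      field_simp
      ring)) hεpos (C := C) (fun x α β γ hα hβ => by
      refine le_trans (le_of_eq ?_) ((hC x α β hα hβ).trans
        (mul_le_mul_of_nonneg_left (le_add_of_nonneg_right (sq_nonneg γ)) hC0))
      congr 1
      simp only [one_div, inv_pow]
      ring)
  refine cast (congrArg (IsGradient κ (F1 κ) m) (funext fun x => ?_)) key
  simp only [G1, one_div, inv_pow]
  ring

theorem isGradient_F2 (hκ : 0 < κ) (h : IsProfile κ m m₁ m₂ m₃ m₄) :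
    IsGradient κ (F2 κ) m (G2 κ m) := by
  obtain ⟨δ, hδ, hm⟩ := h.lower
  have hεpos : 0 < min (δ / 2) (1 / 2) := by positivity
  have hε1 : min (δ / 2) (1 / 2) ≤ δ / 2 := min_le_left _ _
  have hε2 : min (δ / 2) (1 / 2) ≤ 1 / 2 := min_le_right _ _
  have qi := QuadExp.inv hδ hε1 hm
  have qb := QuadExp.snd (min (δ / 2) (1 / 2)) h.e1.bddCont
  -- `QuadExp.pow` with argument `n` yields the power `n + 1`, so every exponent here is one less
  -- than in the density.
  have q := ((((qb.pow hε2 1).mul hε2 (qi.pow hε2 4)).add ((qi.pow hε2 2).const_mul (1 / 4))).add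
    ((QuadExp.fst _ h.bdd).const_mul (3 / (4 * κ ^ 4)))).add (QuadExp.const _ (-(1 / κ ^ 3)))
  obtain ⟨C, hC0, hC⟩ := q.bound
  have bi := h.inv_bdd
  have b1 := h.e1.bddCont
  have di := h.inv_sub hκ.ne'
  have p0 : ExpDecay fun x => m₁ x * (-5 * m₁ x * (m x)⁻¹ ^ 6)
      + ((m x)⁻¹ ^ 4 - κ⁻¹ ^ 4) * (-3 / 4) :=
    (h.e1.mul_bdd (((BddCont.const _).mul b1).mul (bi.pow 6))).add
      ((di.pow_sub_pow 4).mul_bdd (BddCont.const _))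
  have p1 : ExpDecay fun x => m₁ x * (2 * (m x)⁻¹ ^ 5) :=
    h.e1.mul_bdd ((BddCont.const _).mul (bi.pow 5))
  have p1' : ExpDecay fun x => m₂ x * (2 * (m x)⁻¹ ^ 5) + m₁ x * (-10 * m₁ x * (m x)⁻¹ ^ 6) :=
    (h.e2.mul_bdd ((BddCont.const _).mul (bi.pow 5))).add
      (h.e1.mul_bdd (((BddCont.const _).mul b1).mul (bi.pow 6)))
  have d1 : ∀ x, HasDerivAt (fun x => m₁ x * (2 * (m x)⁻¹ ^ 5))
      (m₂ x * (2 * (m x)⁻¹ ^ 5) + m₁ x * (-10 * m₁ x * (m x)⁻¹ ^ 6)) x := fun x =>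
    ((h.d1 x).mul ((h.hasDerivAt_inv_pow 5 x).const_mul 2)).congr_deriv (by push_cast; ring)
  have hi : ExpDecay fun x => m₁ x * (m₁ x * (m x)⁻¹ ^ 5) + ((m x)⁻¹ ^ 3 - κ⁻¹ ^ 3) * (1 / 4)
      + (m x - κ) * (3 / (4 * κ ^ 4)) :=
    ((h.e1.mul_bdd (b1.mul (bi.pow 5))).add ((di.pow_sub_pow 3).mul_bdd (BddCont.const _))).add
      (h.e0.mul_bdd (BddCont.const _))
  have z := ExpDecay.zero
  have dz : ∀ x : ℝ, HasDerivAt (fun _ : ℝ => (0 : ℝ)) 0 x := fun x => hasDerivAt_const x 0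
  have key := isGradient_of_expansion
    (h := fun a b _ => b ^ 2 / a ^ 5 + 1 / (4 * a ^ 3) + 3 / (4 * κ ^ 4) * a - 1 / κ ^ 3)
    h.mem_XSpace (by fun_prop) p0.memLp p1.memLp z.memLp p1'.memLp z.memLp z.memLp d1 dz dz
    p1'.1 continuous_const p1.tendsto_atBot p1.tendsto_atTop z.tendsto_atBot
    z.tendsto_atTop z.tendsto_atBot z.tendsto_atTop
    (hi.integrable.congr (ae_of_all _ fun x => by
      have := (h.pos x).ne'
      simp only [h.deriv_eq]
      field_simp
      ring)) hεpos (C := C) (fun x α β γ hα hβ => by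
      refine le_trans (le_of_eq ?_) ((hC x α β hα hβ).trans
        (mul_le_mul_of_nonneg_left (le_add_of_nonneg_right (sq_nonneg γ)) hC0))
      congr 1
      simp only [h.deriv_eq, div_eq_mul_inv, mul_inv, inv_pow]
      push_cast
      ring)
  refine cast (congrArg (IsGradient κ (F2 κ) m) (funext fun x => ?_)) key
  simp only [G2, h.deriv_eq, show deriv m₁ x = m₂ x from (h.d1 x).deriv, div_eq_mul_inv, mul_inv,
    inv_pow]
  ring

/-- The term `m_xx²/(2m⁷)` is expanded separately by `QuadExp.sq_mul_bound`, because the increment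
of `m_xx` is only square integrable and not small; all other terms involve `m` and `m_x` alone. -/
theorem isGradient_F3 (hκ : 0 < κ) (h : IsProfile κ m m₁ m₂ m₃ m₄) :
    IsGradient κ (F3 κ) m (G3 κ m) := by
  obtain ⟨δ, hδ, hm⟩ := h.lower
  have hεpos : 0 < min (δ / 2) (1 / 2) := by positivity
  have hε1 : min (δ / 2) (1 / 2) ≤ δ / 2 := min_le_left _ _
  have hε2 : min (δ / 2) (1 / 2) ≤ 1 / 2 := min_le_right _ _
  have qi := QuadExp.inv hδ hε1 hm
  have qb := QuadExp.snd (min (δ / 2) (1 / 2)) h.e1.bddCont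
  -- The additive constant of the density is left out, as it cancels in the difference.
  have q := (((((qb.pow hε2 1).mul hε2 (qi.pow hε2 6)).const_mul (5 / 4)).add
    (((qb.pow hε2 3).mul hε2 (qi.pow hε2 8)).const_mul (-7 / 2))).add
    ((qi.pow hε2 4).const_mul (1 / 16))).add
    ((QuadExp.fst _ h.bdd).const_mul (5 / (16 * κ ^ 6)))
  obtain ⟨C, hC0, hC⟩ := q.bound
  obtain ⟨D, hD0, hD⟩ := ((qi.pow hε2 6).const_mul (1 / 2)).sq_mul_bound hε2 h.e2.bddCont
  have bi := h.inv_bdd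
  have b1 := h.e1.bddCont
  have b2 := h.e2.bddCont
  have b3 := h.e3.bddCont
  have di := h.inv_sub hκ.ne'
  have p0 : ExpDecay fun x => m₂ x * (-7 / 2 * m₂ x * (m x)⁻¹ ^ 8)
      + m₁ x * (-35 / 4 * m₁ x * (m x)⁻¹ ^ 8) + m₁ x * (63 / 2 * m₁ x ^ 3 * (m x)⁻¹ ^ 10)
      + ((m x)⁻¹ ^ 6 - κ⁻¹ ^ 6) * (-5 / 16) :=
    (((h.e2.mul_bdd (((BddCont.const _).mul b2).mul (bi.pow 8))).add
      (h.e1.mul_bdd (((BddCont.const _).mul b1).mul (bi.pow 8)))).add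
      (h.e1.mul_bdd (((BddCont.const _).mul (b1.pow 3)).mul (bi.pow 10)))).add
      ((di.pow_sub_pow 6).mul_bdd (BddCont.const _))
  have p1 : ExpDecay fun x => m₁ x * (5 / 2 * (m x)⁻¹ ^ 7)
      + m₁ x ^ 3 * (-14 * (m x)⁻¹ ^ 9) := by
    refine (h.e1.mul_bdd ((BddCont.const _).mul (bi.pow 7))).add (ExpDecay.mul_bdd ?_
      ((BddCont.const _).mul (bi.pow 9)))
    refine cast (congrArg ExpDecay (funext fun x => ?_)) (h.e1.mul_bdd (b1.pow 2))
    ring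
  have p1' : ExpDecay fun x => m₂ x * (5 / 2 * (m x)⁻¹ ^ 7)
      + m₁ x * (-35 / 2 * m₁ x * (m x)⁻¹ ^ 8) + m₂ x * (-42 * m₁ x ^ 2 * (m x)⁻¹ ^ 9)
      + m₁ x * (126 * m₁ x ^ 3 * (m x)⁻¹ ^ 10) :=
    (((h.e2.mul_bdd ((BddCont.const _).mul (bi.pow 7))).add
      (h.e1.mul_bdd (((BddCont.const _).mul b1).mul (bi.pow 8)))).add
      (h.e2.mul_bdd (((BddCont.const _).mul (b1.pow 2)).mul (bi.pow 9)))).add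
      (h.e1.mul_bdd (((BddCont.const _).mul (b1.pow 3)).mul (bi.pow 10)))
  have d1 : ∀ x, HasDerivAt (fun x => m₁ x * (5 / 2 * (m x)⁻¹ ^ 7)
      + m₁ x ^ 3 * (-14 * (m x)⁻¹ ^ 9)) (m₂ x * (5 / 2 * (m x)⁻¹ ^ 7)
      + m₁ x * (-35 / 2 * m₁ x * (m x)⁻¹ ^ 8) + m₂ x * (-42 * m₁ x ^ 2 * (m x)⁻¹ ^ 9)
      + m₁ x * (126 * m₁ x ^ 3 * (m x)⁻¹ ^ 10)) x := fun x =>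
    (((h.d1 x).mul ((h.hasDerivAt_inv_pow 7 x).const_mul (5 / 2))).add
      (((h.d1 x).pow 3).mul ((h.hasDerivAt_inv_pow 9 x).const_mul (-14)))).congr_deriv
      (by simp only [Pi.pow_apply]; push_cast; ring)
  have p2 : ExpDecay fun x => m₂ x * (m x)⁻¹ ^ 7 := h.e2.mul_bdd (bi.pow 7)
  have p2' : ExpDecay fun x => m₃ x * (m x)⁻¹ ^ 7 + m₁ x * m₂ x * (-7 * (m x)⁻¹ ^ 8) :=
    (h.e3.mul_bdd (bi.pow 7)).add ((h.e1.mul_bdd b2).mul_bdd ((BddCont.const _).mul (bi.pow 8)))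
  have d2 : ∀ x, HasDerivAt (fun x => m₂ x * (m x)⁻¹ ^ 7)
      (m₃ x * (m x)⁻¹ ^ 7 + m₁ x * m₂ x * (-7 * (m x)⁻¹ ^ 8)) x := fun x =>
    ((h.d2 x).mul (h.hasDerivAt_inv_pow 7 x)).congr_deriv (by push_cast; ring)
  have p2'' : ExpDecay fun x => m₄ x * (m x)⁻¹ ^ 7 + m₁ x * (-14 * m₃ x * (m x)⁻¹ ^ 8)
      + m₂ x * (-7 * m₂ x * (m x)⁻¹ ^ 8) + m₁ x * (56 * (m₁ x * m₂ x) * (m x)⁻¹ ^ 9) :=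
    (((h.e4.mul_bdd (bi.pow 7)).add
      (h.e1.mul_bdd (((BddCont.const _).mul b3).mul (bi.pow 8)))).add
      (h.e2.mul_bdd (((BddCont.const _).mul b2).mul (bi.pow 8)))).add
      (h.e1.mul_bdd (((BddCont.const _).mul (b1.mul b2)).mul (bi.pow 9)))
  have d2' : ∀ x, HasDerivAt (fun x => m₃ x * (m x)⁻¹ ^ 7 + m₁ x * m₂ x * (-7 * (m x)⁻¹ ^ 8))
      (m₄ x * (m x)⁻¹ ^ 7 + m₁ x * (-14 * m₃ x * (m x)⁻¹ ^ 8)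
      + m₂ x * (-7 * m₂ x * (m x)⁻¹ ^ 8) + m₁ x * (56 * (m₁ x * m₂ x) * (m x)⁻¹ ^ 9)) x := fun x =>
    (((h.d3 x).mul (h.hasDerivAt_inv_pow 7 x)).add (((h.d1 x).mul (h.d2 x)).mul
      ((h.hasDerivAt_inv_pow 8 x).const_mul (-7)))).congr_deriv
      (by simp only [Pi.mul_apply]; push_cast; ring)
  have hi : ExpDecay fun x => m₂ x * (1 / 2 * m₂ x * (m x)⁻¹ ^ 7)
      + m₁ x * (5 / 4 * m₁ x * (m x)⁻¹ ^ 7) + m₁ x * (-7 / 2 * m₁ x ^ 3 * (m x)⁻¹ ^ 9)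
      + ((m x)⁻¹ ^ 5 - κ⁻¹ ^ 5) * (1 / 16) + (m x - κ) * (5 / (16 * κ ^ 6)) :=
    ((((h.e2.mul_bdd (((BddCont.const _).mul b2).mul (bi.pow 7))).add
      (h.e1.mul_bdd (((BddCont.const _).mul b1).mul (bi.pow 7)))).add
      (h.e1.mul_bdd (((BddCont.const _).mul (b1.pow 3)).mul (bi.pow 9)))).add
      ((di.pow_sub_pow 5).mul_bdd (BddCont.const _))).add (h.e0.mul_bdd (BddCont.const _))
  have dd : deriv m₁ = m₂ := funext fun x => (h.d1 x).deriv
  have key := isGradient_of_expansion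
    (h := fun a b c => c ^ 2 / (2 * a ^ 7) + 5 * b ^ 2 / (4 * a ^ 7) - 7 * b ^ 4 / (2 * a ^ 9)
      + 1 / (16 * a ^ 5) + 5 / (16 * κ ^ 6) * a - 3 / (8 * κ ^ 5))
    h.mem_XSpace (by fun_prop) p0.memLp p1.memLp p2.memLp p1'.memLp p2'.memLp p2''.memLp d1 d2 d2'
    p1'.1 p2''.1 p1.tendsto_atBot p1.tendsto_atTop p2.tendsto_atBot
    p2.tendsto_atTop p2'.tendsto_atBot p2'.tendsto_atTop
    (hi.integrable.congr (ae_of_all _ fun x => by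
      have := (h.pos x).ne'
      simp only [h.deriv_eq, dd]
      field_simp
      ring)) hεpos (C := C + D) (fun x α β γ hα hβ => by
      have t1 := (hC x α β hα hβ).trans
        (mul_le_mul_of_nonneg_left (le_add_of_nonneg_right (sq_nonneg γ)) hC0)
      have t2 := hD x α β γ hα hβ
      rw [add_mul C D]
      refine le_trans (le_trans (le_of_eq ?_) (abs_add_le _ _)) (add_le_add t1 t2)
      congr 1
      simp only [h.deriv_eq, dd, div_eq_mul_inv, mul_inv, inv_pow]
      push_cast
      ring)
  refine cast (congrArg (IsGradient κ (F3 κ) m) (funext fun x => ?_)) key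
  simp only [G3, h.deriv_eq, dd, h.iteratedDeriv_three, h.iteratedDeriv_four, div_eq_mul_inv,
    mul_inv, inv_pow]
  ring

end IsProfile

/-! ### Squared eigenfunctions of two modes, as functions of the reciprocal variable -/

/-- A logarithmic derivative `w` on the background `1/(2κ)`, together with the squared eigenfunctions
`Aᵢ = ψᵢ²`, `Bᵢ = χᵢ²/Nᵢ` and products `Cᵢ = ψᵢχᵢ` of the two modes of a Dirac system
`ψᵢ' = wψᵢ + χᵢ`, `χᵢ' = -wχᵢ - Nᵢψᵢ` which generate it. A mode is allowed to vanish. -/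
structure ModeSystem (κ : ℝ) where
  (k₁ k₂ N₁ N₂ : ℝ)
  (w A₁ B₁ C₁ A₂ B₂ C₂ : ℝ → ℝ)
  κ_pos : 0 < κ
  k₁_pos : 0 < k₁
  k₂_pos : 0 < k₂
  N₁_lower : 1 < 16 * κ ^ 2 * N₁
  N₂_lower : 1 < 16 * κ ^ 2 * N₂
  dw : ∀ y, HasDerivAt w (k₁ * (B₁ y - A₁ y) + k₂ * (B₂ y - A₂ y)) y
  dA₁ : ∀ y, HasDerivAt A₁ (2 * w y * A₁ y + 2 * C₁ y) y
  dB₁ : ∀ y, HasDerivAt B₁ (-2 * w y * B₁ y - 2 * C₁ y) y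
  dC₁ : ∀ y, HasDerivAt C₁ (N₁ * (B₁ y - A₁ y)) y
  dA₂ : ∀ y, HasDerivAt A₂ (2 * w y * A₂ y + 2 * C₂ y) y
  dB₂ : ∀ y, HasDerivAt B₂ (-2 * w y * B₂ y - 2 * C₂ y) y
  dC₂ : ∀ y, HasDerivAt C₂ (N₂ * (B₂ y - A₂ y)) y
  A₁_nonneg : ∀ y, 0 ≤ A₁ y
  B₁_nonneg : ∀ y, 0 ≤ B₁ y
  A₂_nonneg : ∀ y, 0 ≤ A₂ y
  B₂_nonneg : ∀ y, 0 ≤ B₂ y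
  C₁_sq : ∀ y, C₁ y ^ 2 = N₁ * A₁ y * B₁ y
  C₂_sq : ∀ y, C₂ y ^ 2 = N₂ * A₂ y * B₂ y
  A₁_decay : ExpDecay A₁
  B₁_decay : ExpDecay B₁
  A₂_decay : ExpDecay A₂
  B₂_decay : ExpDecay B₂
  w_tendsto : Tendsto w atBot (𝓝 (1 / (2 * κ)))

/-- This fixes the constants of all first integrals: at `-∞` the modes vanish and `w` tends to
`1/(2κ)`. -/
lemma eq_zero_of_hasDerivAt_zero {f : ℝ → ℝ} (hf : ∀ y, HasDerivAt f 0 y)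
    (hlim : Tendsto f atBot (𝓝 0)) (y : ℝ) : f y = 0 := by
  have hc : ∀ x, f x = f y := fun x =>
    is_const_of_deriv_eq_zero (fun z => (hf z).differentiableAt) (fun z => (hf z).deriv) x y
  have : Tendsto f atBot (𝓝 (f y)) := tendsto_const_nhds.congr fun x => (hc x).symm
  exact tendsto_nhds_unique this hlim

lemma abs_le_of_sq_eq {N A B C : ℝ} (hN : 0 < N) (hA : 0 ≤ A) (hB : 0 ≤ B)
    (h : C ^ 2 = N * A * B) : |C| ≤ A * (N / 2) + B * (1 / 2) := by
  refine abs_le_of_sq_le_sq ?_ (by positivity)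
  nlinarith [sq_nonneg (N * A - B)]

lemma two_mul_abs_le_of_sq_eq {n N A B C : ℝ} (hnN : n ^ 2 ≤ N) (hA : 0 ≤ A)
    (hB : 0 ≤ B) (h : C ^ 2 = N * A * B) : 2 * n * |C| ≤ N * (A + B) := by
  have hN : 0 ≤ N := (sq_nonneg n).trans hnN
  refine le_of_sq_le_sq ?_ (by positivity)
  have h1 : n ^ 2 * (N * A * B) ≤ N * (N * A * B) := by gcongr
  have h2 : 0 ≤ N ^ 2 * (A - B) ^ 2 := by positivity
  calc (2 * n * |C|) ^ 2 = 4 * (n ^ 2 * (N * A * B)) := by rw [mul_pow, sq_abs, h]; ring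
    _ ≤ 4 * (N * (N * A * B)) := by linarith
    _ ≤ (N * (A + B)) ^ 2 := by linarith

namespace ModeSystem

variable {κ : ℝ} (M : ModeSystem κ)

lemma N₁_pos : 0 < M.N₁ := by
  have := M.N₁_lower
  have h : 0 < 16 * κ ^ 2 := by have := M.κ_pos; positivity
  exact pos_of_mul_pos_right (one_pos.trans this) h.le

lemma N₂_pos : 0 < M.N₂ := by
  have := M.N₂_lower
  have h : 0 < 16 * κ ^ 2 := by have := M.κ_pos; positivity
  exact pos_of_mul_pos_right (one_pos.trans this) h.le

lemma C₁_decay : ExpDecay M.C₁ :=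
  ((M.A₁_decay.mul_bdd (BddCont.const _)).add (M.B₁_decay.mul_bdd (BddCont.const _))).of_abs_le
    (continuous_iff_continuousAt.2 fun y => (M.dC₁ y).continuousAt) fun y =>
    abs_le_of_sq_eq M.N₁_pos (M.A₁_nonneg y) (M.B₁_nonneg y) (M.C₁_sq y)

lemma C₂_decay : ExpDecay M.C₂ :=
  ((M.A₂_decay.mul_bdd (BddCont.const _)).add (M.B₂_decay.mul_bdd (BddCont.const _))).of_abs_le
    (continuous_iff_continuousAt.2 fun y => (M.dC₂ y).continuousAt) fun y =>
    abs_le_of_sq_eq M.N₂_pos (M.A₂_nonneg y) (M.B₂_nonneg y) (M.C₂_sq y)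

/-! ### Moments of the modes, their first integrals, and positivity of `w`. -/

/-- The moments of `Aᵢ + Bᵢ`. -/
def U (j : ℕ) (y : ℝ) : ℝ :=
  (M.A₁ y + M.B₁ y) * (M.k₁ * M.N₁ ^ j) + (M.A₂ y + M.B₂ y) * (M.k₂ * M.N₂ ^ j)

/-- The moments of `Bᵢ - Aᵢ`. -/
def T (j : ℕ) (y : ℝ) : ℝ :=
  (M.B₁ y - M.A₁ y) * (M.k₁ * M.N₁ ^ j) + (M.B₂ y - M.A₂ y) * (M.k₂ * M.N₂ ^ j)

/-- The moments of `Cᵢ`. -/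
def W (j : ℕ) (y : ℝ) : ℝ :=
  M.C₁ y * (M.k₁ * M.N₁ ^ j) + M.C₂ y * (M.k₂ * M.N₂ ^ j)

lemma U_decay (j : ℕ) : ExpDecay (M.U j) :=
  ((M.A₁_decay.add M.B₁_decay).mul_bdd (BddCont.const _)).add
    ((M.A₂_decay.add M.B₂_decay).mul_bdd (BddCont.const _))

lemma T_decay (j : ℕ) : ExpDecay (M.T j) :=
  ((M.B₁_decay.sub M.A₁_decay).mul_bdd (BddCont.const _)).add
    ((M.B₂_decay.sub M.A₂_decay).mul_bdd (BddCont.const _))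

lemma W_decay (j : ℕ) : ExpDecay (M.W j) :=
  (M.C₁_decay.mul_bdd (BddCont.const _)).add (M.C₂_decay.mul_bdd (BddCont.const _))

lemma dw' (y : ℝ) : HasDerivAt M.w (M.T 0 y) y :=
  (M.dw y).congr_deriv (by simp only [T]; ring)

lemma dU (j : ℕ) (y : ℝ) : HasDerivAt (M.U j) (-2 * M.w y * M.T j y) y :=
  ((((M.dA₁ y).add (M.dB₁ y)).mul_const _).add (((M.dA₂ y).add (M.dB₂ y)).mul_const _)).congr_deriv
    (by simp only [T]; ring)

lemma dT (j : ℕ) (y : ℝ) : HasDerivAt (M.T j) (-2 * M.w y * M.U j y - 4 * M.W j y) y :=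
  ((((M.dB₁ y).sub (M.dA₁ y)).mul_const _).add (((M.dB₂ y).sub (M.dA₂ y)).mul_const _)).congr_deriv
    (by simp only [U, W]; ring)

lemma dW (j : ℕ) (y : ℝ) : HasDerivAt (M.W j) (M.T (j + 1) y) y :=
  (((M.dC₁ y).mul_const _).add ((M.dC₂ y).mul_const _)).congr_deriv (by simp only [T]; ring)

/-- `U₀' = -2wT₀` and `T₀ = w'`, so `U₀ + w²` is conserved. -/
lemma U_zero_eq (y : ℝ) : M.U 0 y = 1 / (4 * κ ^ 2) - M.w y ^ 2 := by
  have h : ∀ y, HasDerivAt (fun y => M.U 0 y + M.w y ^ 2 - 1 / (4 * κ ^ 2)) 0 y := fun y =>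
    (((M.dU 0 y).add ((M.dw' y).pow 2)).sub_const _).congr_deriv (by push_cast; ring)
  have hκ := M.κ_pos.ne'
  have l : Tendsto (fun y => M.U 0 y + M.w y ^ 2 - 1 / (4 * κ ^ 2)) atBot (𝓝 0) := by
    have := ((M.U_decay 0).tendsto_atBot.add (M.w_tendsto.pow 2)).sub_const (1 / (4 * κ ^ 2))
    convert this using 2
    field_simp
    ring
  linarith [eq_zero_of_hasDerivAt_zero h l y]

/-- The first moment of `Cᵢ / Nᵢ²`. -/
lemma w_sub_eq (y : ℝ) :
    M.w y - 1 / (2 * κ) = M.C₁ y * (M.k₁ / M.N₁) + M.C₂ y * (M.k₂ / M.N₂) := by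
  have h1 := M.N₁_pos.ne'
  have h2 := M.N₂_pos.ne'
  have h : ∀ y, HasDerivAt (fun y => M.w y - 1 / (2 * κ)
      - (M.C₁ y * (M.k₁ / M.N₁) + M.C₂ y * (M.k₂ / M.N₂))) 0 y := fun y =>
    (((M.dw y).sub_const _).sub (((M.dC₁ y).mul_const _).add ((M.dC₂ y).mul_const _))).congr_deriv
      (by field_simp; ring)
  have l := (M.w_tendsto.sub_const (1 / (2 * κ))).sub
    (((M.C₁_decay.mul_bdd (BddCont.const (M.k₁ / M.N₁))).add
      (M.C₂_decay.mul_bdd (BddCont.const (M.k₂ / M.N₂)))).tendsto_atBot)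
  rw [sub_self, sub_zero] at l
  linarith [eq_zero_of_hasDerivAt_zero h l y]

/-- In the derivative of the right side everything cancels except `-8wT₁`, which is four times the
derivative of `U₁`. -/
lemma U_one_eq (y : ℝ) :
    4 * M.U 1 y = M.U 0 y ^ 2 - M.T 0 y ^ 2 - 8 * M.w y * M.W 0 y := by
  have h : ∀ y, HasDerivAt (fun y => M.U 0 y * M.U 0 y - M.T 0 y * M.T 0 y
      - M.W 0 y * M.w y * 8 - M.U 1 y * 4) 0 y := fun y =>
    (((((M.dU 0 y).mul (M.dU 0 y)).sub ((M.dT 0 y).mul (M.dT 0 y))).sub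
      (((M.dW 0 y).mul (M.dw' y)).mul_const 8)).sub ((M.dU 1 y).mul_const 4)).congr_deriv (by ring)
  have bw : Tendsto (fun y => M.W 0 y * M.w y * 8) atBot (𝓝 0) := by
    simpa using ((M.W_decay 0).tendsto_atBot.mul M.w_tendsto).mul_const 8
  have l := ((((M.U_decay 0).tendsto_atBot.mul (M.U_decay 0).tendsto_atBot).sub
    ((M.T_decay 0).tendsto_atBot.mul (M.T_decay 0).tendsto_atBot)).sub bw).sub
    ((M.U_decay 1).tendsto_atBot.mul_const 4)
  simp only [mul_zero, zero_mul, sub_self] at l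
  linarith [eq_zero_of_hasDerivAt_zero h l y]

/-- One level higher in the same hierarchy: the derivative of the right side collapses to `-8wT₂`.
-/
lemma U_two_eq (y : ℝ) : 4 * M.U 2 y = 2 * M.U 0 y * M.U 1 y - 2 * M.T 0 y * M.T 1 y
    - 4 * M.W 0 y ^ 2 - 8 * M.w y * M.W 1 y := by
  have h : ∀ y, HasDerivAt (fun y => M.U 0 y * M.U 1 y * 2 - M.T 0 y * M.T 1 y * 2
      - M.W 0 y * M.W 0 y * 4 - M.W 1 y * M.w y * 8 - M.U 2 y * 4) 0 y := fun y =>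
    ((((((M.dU 0 y).mul (M.dU 1 y)).mul_const 2).sub
      (((M.dT 0 y).mul (M.dT 1 y)).mul_const 2)).sub
      (((M.dW 0 y).mul (M.dW 0 y)).mul_const 4)).sub
      (((M.dW 1 y).mul (M.dw' y)).mul_const 8)).sub ((M.dU 2 y).mul_const 4) |>.congr_deriv (by ring)
  have bw : Tendsto (fun y => M.W 1 y * M.w y * 8) atBot (𝓝 0) := by
    simpa using ((M.W_decay 1).tendsto_atBot.mul M.w_tendsto).mul_const 8
  have l := (((((M.U_decay 0).tendsto_atBot.mul (M.U_decay 1).tendsto_atBot).mul_const 2).sub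
    (((M.T_decay 0).tendsto_atBot.mul (M.T_decay 1).tendsto_atBot).mul_const 2)).sub
    (((M.W_decay 0).tendsto_atBot.mul (M.W_decay 0).tendsto_atBot).mul_const 4)).sub bw |>.sub
    ((M.U_decay 2).tendsto_atBot.mul_const 4)
  simp only [mul_zero, zero_mul, sub_self] at l
  linarith [eq_zero_of_hasDerivAt_zero h l y]

/-- Both `Nᵢ` are roots of `λ² = (N₁ + N₂)λ - N₁N₂`. This closes the hierarchy for two modes and is
the source of the multipliers. -/
lemma U_two_recurrence (y : ℝ) :
    M.U 2 y = (M.N₁ + M.N₂) * M.U 1 y - M.N₁ * M.N₂ * M.U 0 y := by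
  simp only [U]
  ring

lemma U_nonneg (y : ℝ) : 0 ≤ M.U 0 y := by
  have := M.A₁_nonneg y
  have := M.B₁_nonneg y
  have := M.A₂_nonneg y
  have := M.B₂_nonneg y
  have := M.k₁_pos
  have := M.k₂_pos
  simp only [U, pow_zero, mul_one]
  positivity

lemma abs_w_le (y : ℝ) : |M.w y| ≤ 1 / (2 * κ) := by
  have hκ := M.κ_pos
  refine abs_le_of_sq_le_sq ?_ (by positivity)
  have h1 := M.U_zero_eq y
  have h2 := M.U_nonneg y
  have e : (1 / (2 * κ)) ^ 2 = 1 / (4 * κ ^ 2) := by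
    field_simp
    ring
  linarith

/-- By `w_sub_eq` the deviation of `w` from `1/(2κ)` is `Σ kᵢCᵢ/Nᵢ`. With `n² = min N₁ N₂`, AM-GM on
`Cᵢ² = NᵢAᵢBᵢ` bounds it by `U₀/(2n) ≤ 1/(8κ²n)`, which is less than `1/(2κ)` exactly when `4κn >
1`. -/
lemma exists_pos_le_w : ∃ δ > 0, ∀ y, δ ≤ M.w y := by
  have hκ := M.κ_pos
  set n := Real.sqrt (min M.N₁ M.N₂) with hn
  have hmin : 0 < min M.N₁ M.N₂ := lt_min M.N₁_pos M.N₂_pos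
  have hnp : 0 < n := Real.sqrt_pos.2 hmin
  have hsq : n ^ 2 = min M.N₁ M.N₂ := Real.sq_sqrt hmin.le
  have hκn : 1 < 4 * κ * n := by
    refine lt_of_pow_lt_pow_left₀ 2 (by positivity) ?_
    have e : (4 * κ * n) ^ 2 = 16 * κ ^ 2 * min M.N₁ M.N₂ := by rw [mul_pow, hsq]; ring
    rw [e, one_pow]
    rcases min_choice M.N₁ M.N₂ with h | h <;> rw [h]
    exacts [M.N₁_lower, M.N₂_lower]
  have hlt : 1 / (4 * κ ^ 2) / (2 * n) < 1 / (2 * κ) := by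
    rw [div_div, div_lt_div_iff₀ (by positivity) (by positivity)]
    nlinarith
  refine ⟨1 / (2 * κ) - 1 / (4 * κ ^ 2) / (2 * n), sub_pos.2 hlt, fun y => ?_⟩
  have mode : ∀ {N A B C k : ℝ}, 0 < N → n ^ 2 ≤ N → 0 ≤ A → 0 ≤ B → 0 < k →
      C ^ 2 = N * A * B → -((A + B) * k / (2 * n)) ≤ C * (k / N) := by
    intro N A B C k hN hnN hA hB hk h
    have h1 := two_mul_abs_le_of_sq_eq hnN hA hB h
    have h2 : -C ≤ |C| := neg_le_abs C
    have h3 : -C / N ≤ (A + B) / (2 * n) := by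
      rw [div_le_div_iff₀ hN (by positivity)]
      nlinarith
    have h4 : k * (-C / N) ≤ k * ((A + B) / (2 * n)) := by gcongr
    have e1 : C * (k / N) = -(k * (-C / N)) := by ring
    have e2 : (A + B) * k / (2 * n) = k * ((A + B) / (2 * n)) := by ring
    rw [e1, e2]
    linarith
  have m1 := mode M.N₁_pos (hsq ▸ min_le_left _ _) (M.A₁_nonneg y) (M.B₁_nonneg y) M.k₁_pos
    (M.C₁_sq y)
  have m2 := mode M.N₂_pos (hsq ▸ min_le_right _ _) (M.A₂_nonneg y) (M.B₂_nonneg y) M.k₂_pos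
    (M.C₂_sq y)
  have hU : (M.A₁ y + M.B₁ y) * M.k₁ / (2 * n) + (M.A₂ y + M.B₂ y) * M.k₂ / (2 * n)
      ≤ 1 / (4 * κ ^ 2) / (2 * n) := by
    rw [← add_div]
    have h0 := M.U_zero_eq y
    simp only [U, pow_zero, mul_one] at h0
    have := sq_nonneg (M.w y)
    gcongr
    linarith
  linarith [M.w_sub_eq y]

lemma w_continuous : Continuous M.w := continuous_iff_continuousAt.2 fun y => (M.dw y).continuousAt

lemma w_bdd : BddCont M.w := ⟨M.w_continuous, _, M.abs_w_le⟩

lemma w_pos (y : ℝ) : 0 < M.w y := by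
  obtain ⟨δ, hδ, h⟩ := M.exists_pos_le_w
  exact hδ.trans_le (h y)

lemma w_sub_decay : ExpDecay fun y => M.w y - 1 / (2 * κ) := by
  simp_rw [M.w_sub_eq]
  exact (M.C₁_decay.mul_bdd (BddCont.const _)).add (M.C₂_decay.mul_bdd (BddCont.const _))

/-! The derivatives of `w`. -/

/-- `w''`. -/
def w₂ (y : ℝ) : ℝ := M.U 0 y * (-2 * M.w y) + M.W 0 y * (-4)

/-- `w'''`. -/
def w₃ (y : ℝ) : ℝ := M.T 0 y * (-2 * M.U 0 y + 4 * M.w y ^ 2) + M.T 1 y * (-4)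

/-- `w''''`. -/
def w₄ (y : ℝ) : ℝ :=
  M.w₂ y * (-2 * M.U 0 y + 4 * M.w y ^ 2) + M.T 0 y * (12 * M.w y * M.T 0 y)
    + M.U 1 y * (8 * M.w y) + M.W 1 y * 16

lemma dw₁ (y : ℝ) : HasDerivAt (M.T 0) (M.w₂ y) y :=
  (M.dT 0 y).congr_deriv (by simp only [w₂]; ring)

lemma dw₂ (y : ℝ) : HasDerivAt M.w₂ (M.w₃ y) y :=
  (((M.dU 0 y).mul ((M.dw' y).const_mul (-2))).add ((M.dW 0 y).mul_const (-4))).congr_deriv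
    (by simp only [w₃]; ring)

lemma dw₃ (y : ℝ) : HasDerivAt M.w₃ (M.w₄ y) y :=
  (((M.dw₁ y).mul (((M.dU 0 y).const_mul (-2)).add (((M.dw' y).pow 2).const_mul 4))).add
    ((M.dT 1 y).mul_const (-4))).congr_deriv (by
      simp only [w₄, Pi.add_apply, Pi.pow_apply]
      push_cast
      ring)

lemma w₂_decay : ExpDecay M.w₂ :=
  ((M.U_decay 0).mul_bdd ((BddCont.const _).mul M.w_bdd)).add
    ((M.W_decay 0).mul_bdd (BddCont.const _))

lemma w₃_decay : ExpDecay M.w₃ :=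
  ((M.T_decay 0).mul_bdd (((BddCont.const _).mul (M.U_decay 0).bddCont).add
    ((BddCont.const _).mul (M.w_bdd.pow 2)))).add ((M.T_decay 1).mul_bdd (BddCont.const _))

lemma w₄_decay : ExpDecay M.w₄ :=
  (((M.w₂_decay.mul_bdd (((BddCont.const _).mul (M.U_decay 0).bddCont).add
    ((BddCont.const _).mul (M.w_bdd.pow 2)))).add
    ((M.T_decay 0).mul_bdd (((BddCont.const _).mul M.w_bdd).mul (M.T_decay 0).bddCont))).add
    ((M.U_decay 1).mul_bdd ((BddCont.const _).mul M.w_bdd))).add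
    ((M.W_decay 1).mul_bdd (BddCont.const _))

lemma hasDerivAt_inv_w_pow (n : ℕ) (y : ℝ) :
    HasDerivAt (fun y => (M.w y)⁻¹ ^ n) (-(n * M.T 0 y * (M.w y)⁻¹ ^ (n + 1))) y := by
  refine (((M.dw' y).inv (M.w_pos y).ne').pow n).congr_deriv ?_
  rcases n with _ | n
  · simp
  · simp only [Nat.add_sub_cancel, Pi.inv_apply, div_eq_mul_inv, inv_pow]
    ring

/-! ### The physical variable -/

section

variable {X : ℝ → ℝ} (hX : ∀ y, HasDerivAt X (2 * M.w y) y)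

include hX

lemma X_strictMono : StrictMono X :=
  strictMono_of_deriv_pos fun y => by
    rw [(hX y).deriv]
    have := M.w_pos y
    positivity

lemma X_continuous : Continuous X := continuous_iff_continuousAt.2 fun y => (hX y).continuousAt

/-- The slope of `X` is at least `2δ > 0`, so `X` is strictly monotone and dominated by lines at
both ends. -/
lemma X_bijective : Function.Bijective X := by
  refine ⟨(M.X_strictMono hX).injective, ?_⟩
  obtain ⟨δ, hδ, hw⟩ := M.exists_pos_le_w
  have hmono : Monotone fun y => X y - 2 * δ * y := by
    have hd : ∀ y, HasDerivAt (fun y => X y - 2 * δ * y) (2 * M.w y - 2 * δ * 1) y := fun y =>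
      (hX y).sub ((hasDerivAt_id y).const_mul (2 * δ))
    refine monotone_of_deriv_nonneg (fun y => (hd y).differentiableAt) fun y => ?_
    rw [(hd y).deriv]
    linarith [hw y]
  have hlin : Tendsto (fun y : ℝ => 2 * δ * y + X 0) atTop atTop :=
    tendsto_atTop_add_const_right _ _ (tendsto_id.const_mul_atTop (by positivity))
  have hlin' : Tendsto (fun y : ℝ => 2 * δ * y + X 0) atBot atBot :=
    tendsto_atBot_add_const_right _ _ (tendsto_id.const_mul_atBot (by positivity))
  refine (M.X_continuous hX).surjective ?_ ?_
  · refine tendsto_atTop_mono' _ ?_ hlin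
    filter_upwards [eventually_ge_atTop 0] with y hy
    have := hmono hy
    simp only at this
    linarith
  · refine tendsto_atBot_mono' _ ?_ hlin'
    filter_upwards [eventually_le_atBot 0] with y hy
    have := hmono hy
    simp only at this
    linarith

lemma X_invFun (x : ℝ) : X (Function.invFun X x) = x :=
  Function.rightInverse_invFun (M.X_bijective hX).2 x

lemma invFun_X (y : ℝ) : Function.invFun X (X y) = y :=
  Function.leftInverse_invFun (M.X_bijective hX).1 y

lemma invFun_continuous : Continuous (Function.invFun X) := by
  have hm : StrictMono (Function.invFun X) := fun a b hab => by
    refine (M.X_strictMono hX).lt_iff_lt.1 ?_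
    rwa [M.X_invFun hX, M.X_invFun hX]
  exact hm.monotone.continuous_of_surjective fun y => ⟨X y, M.invFun_X hX y⟩

lemma hasDerivAt_invFun (x : ℝ) :
    HasDerivAt (Function.invFun X) (2 * M.w (Function.invFun X x))⁻¹ x :=
  HasDerivAt.of_local_left_inverse (M.invFun_continuous hX).continuousAt (hX _)
    (by have := M.w_pos (Function.invFun X x); positivity)
    (Eventually.of_forall fun z => M.X_invFun hX z)

/-- The chain rule for functions of the physical variable. -/
lemma hasDerivAt_comp_invFun {f : ℝ → ℝ} {f' : ℝ} {x : ℝ}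
    (hf : HasDerivAt f f' (Function.invFun X x)) :
    HasDerivAt (fun x => f (Function.invFun X x)) (f' * (2 * M.w (Function.invFun X x))⁻¹) x :=
  HasDerivAt.comp x hf (M.hasDerivAt_invFun hX x)

/-- `X` is `1/κ`-Lipschitz because `|w| ≤ 1/(2κ)`; hence exponential decay in `y` becomes
exponential decay in `x`. -/
lemma abs_sub_le_abs_invFun (x : ℝ) : |x| - |X 0| ≤ 1 / κ * |Function.invFun X x| := by
  have h := Convex.norm_image_sub_le_of_norm_hasDerivWithin_le (f := X) (s := Set.univ)
    (C := 1 / κ) (fun y _ => (hX y).hasDerivWithinAt) (fun y _ => by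
      rw [norm_mul, Real.norm_eq_abs, Real.norm_eq_abs, abs_two]
      have := M.abs_w_le y
      have e : 1 / κ = 2 * (1 / (2 * κ)) := by
        have := M.κ_pos.ne'
        field_simp
      rw [e]
      gcongr) convex_univ (Set.mem_univ 0) (Set.mem_univ (Function.invFun X x))
  rw [M.X_invFun hX, sub_zero, Real.norm_eq_abs, Real.norm_eq_abs] at h
  exact (abs_sub_abs_le_abs_sub _ _).trans h

lemma decay_comp {f : ℝ → ℝ} (hf : ExpDecay f) : ExpDecay fun x => f (Function.invFun X x) := by
  obtain ⟨cf, K, δ, hδ, hK⟩ := hf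
  have hκ := M.κ_pos
  have hK0 : 0 ≤ K := by simpa using (abs_nonneg _).trans (hK 0)
  refine ⟨cf.comp (M.invFun_continuous hX), K * Real.exp (δ * κ * |X 0|), δ * κ, by positivity,
    fun x => (hK _).trans ?_⟩
  rw [mul_assoc, ← Real.exp_add]
  gcongr
  have h := M.abs_sub_le_abs_invFun hX x
  have h2 : κ * (|x| - |X 0|) ≤ |Function.invFun X x| := by
    calc κ * (|x| - |X 0|) ≤ κ * (1 / κ * |Function.invFun X x|) := by gcongr
      _ = _ := by field_simp
  nlinarith

/-- The momentum density `m = 1 / (2w)` of a mode system is a smooth localized profile. -/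
theorem isProfile :
    IsProfile κ (fun x => (fun y => 1 / 2 * (M.w y)⁻¹ ^ 1) (Function.invFun X x))
      (fun x => (fun y => M.T 0 y * (-1 / 4 * (M.w y)⁻¹ ^ 3)) (Function.invFun X x))
      (fun x => (fun y => M.w₂ y * (-1 / 8 * (M.w y)⁻¹ ^ 4)
        + M.T 0 y * M.T 0 y * (3 / 8 * (M.w y)⁻¹ ^ 5)) (Function.invFun X x))
      (fun x => (fun y => M.w₃ y * (-1 / 16 * (M.w y)⁻¹ ^ 5)
        + M.T 0 y * M.w₂ y * (5 / 8 * (M.w y)⁻¹ ^ 6)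
        + M.T 0 y * M.T 0 y * M.T 0 y * (-15 / 16 * (M.w y)⁻¹ ^ 7)) (Function.invFun X x))
      (fun x => (fun y => M.w₄ y * (-1 / 32 * (M.w y)⁻¹ ^ 6)
        + M.T 0 y * M.w₃ y * (15 / 32 * (M.w y)⁻¹ ^ 7)
        + M.w₂ y * M.w₂ y * (10 / 32 * (M.w y)⁻¹ ^ 7)
        + M.T 0 y * M.T 0 y * M.w₂ y * (-105 / 32 * (M.w y)⁻¹ ^ 8)
        + M.T 0 y * M.T 0 y * M.T 0 y * M.T 0 y * (105 / 32 * (M.w y)⁻¹ ^ 9))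
        (Function.invFun X x)) := by
  obtain ⟨δ, hδ, hw⟩ := M.exists_pos_le_w
  have hκ := M.κ_pos
  have bi : BddCont fun y => (M.w y)⁻¹ := BddCont.inv M.w_continuous hδ hw
  have t0 := M.T_decay 0
  have w2 := M.w₂_decay
  have w3 := M.w₃_decay
  have w4 := M.w₄_decay
  have bc : ∀ (c : ℝ) (n : ℕ), BddCont fun y => c * (M.w y)⁻¹ ^ n := fun c n =>
    (BddCont.const c).mul (bi.pow n)
  have di := M.hasDerivAt_inv_w_pow
  -- The derivatives iterate `d/dx = (2w)⁻¹ d/dy`. The lower bound for `m` is `κ` itself, since `w ≤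
  -- 1/(2κ)`.
  refine ⟨fun x => ?_, fun x => ?_, fun x => ?_, fun x => ?_, ⟨κ, hκ, fun x => ?_⟩, ?_, ?_, ?_, ?_,
    ?_⟩
  · refine (M.hasDerivAt_comp_invFun hX ((di 1 _).const_mul (1 / 2))).congr_deriv ?_
    rw [mul_inv]
    push_cast
    ring
  · refine (M.hasDerivAt_comp_invFun hX
      ((M.dw₁ _).mul ((di 3 _).const_mul (-1 / 4)))).congr_deriv ?_
    rw [mul_inv]
    push_cast
    ring
  · refine (M.hasDerivAt_comp_invFun hX
      (((M.dw₂ _).mul ((di 4 _).const_mul (-1 / 8))).add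
        (((M.dw₁ _).mul (M.dw₁ _)).mul ((di 5 _).const_mul (3 / 8))))).congr_deriv ?_
    simp only [mul_inv, Pi.mul_apply]
    push_cast
    ring
  · refine (M.hasDerivAt_comp_invFun hX
      ((((M.dw₃ _).mul ((di 5 _).const_mul (-1 / 16))).add
        (((M.dw₁ _).mul (M.dw₂ _)).mul ((di 6 _).const_mul (5 / 8)))).add
        ((((M.dw₁ _).mul (M.dw₁ _)).mul (M.dw₁ _)).mul
          ((di 7 _).const_mul (-15 / 16))))).congr_deriv ?_
    simp only [mul_inv, Pi.mul_apply]
    push_cast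
    ring
  · have h1 := M.w_pos (Function.invFun X x)
    have h2 := (le_abs_self _).trans (M.abs_w_le (Function.invFun X x))
    have h3 := inv_anti₀ h1 h2
    rw [one_div, inv_inv] at h3
    simp only [pow_one]
    linarith
  · have h := M.decay_comp hX (M.w_sub_decay.mul_bdd (bc (-κ) 1))
    refine cast (congrArg ExpDecay (funext fun x => ?_)) h
    have := (M.w_pos (Function.invFun X x)).ne'
    field_simp
    ring
  · exact M.decay_comp hX (t0.mul_bdd (bc _ _))
  · exact M.decay_comp hX ((w2.mul_bdd (bc _ _)).add ((t0.mul_bdd t0.bddCont).mul_bdd (bc _ _)))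
  · exact M.decay_comp hX (((w3.mul_bdd (bc _ _)).add
      ((t0.mul_bdd w2.bddCont).mul_bdd (bc _ _))).add
      (((t0.mul_bdd t0.bddCont).mul_bdd t0.bddCont).mul_bdd (bc _ _)))
  · exact M.decay_comp hX (((((w4.mul_bdd (bc _ _)).add
      ((t0.mul_bdd w3.bddCont).mul_bdd (bc _ _))).add
      ((w2.mul_bdd w2.bddCont).mul_bdd (bc _ _))).add
      (((t0.mul_bdd t0.bddCont).mul_bdd w2.bddCont).mul_bdd (bc _ _))).add
      ((((t0.mul_bdd t0.bddCont).mul_bdd t0.bddCont).mul_bdd t0.bddCont).mul_bdd (bc _ _)))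

end

end ModeSystem

/-! ### The wave, the variational derivatives as moments, and criticality. -/

namespace ModeSystem

variable {κ : ℝ} (M : ModeSystem κ)

/-- The wave `u`, as a function of the reciprocal variable. -/
def wave (y : ℝ) : ℝ :=
  κ + κ / 2 * (M.k₁ / M.N₁ * (M.A₁ y + M.B₁ y) + M.k₂ / M.N₂ * (M.A₂ y + M.B₂ y))

/-- The slope `u_x`, as a function of the reciprocal variable. -/
def slope (y : ℝ) : ℝ :=
  κ / 2 * (M.k₁ / M.N₁ * (M.A₁ y - M.B₁ y) + M.k₂ / M.N₂ * (M.A₂ y - M.B₂ y))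

lemma hasDerivAt_wave (y : ℝ) : HasDerivAt M.wave (M.slope y * (2 * M.w y)) y :=
  (((((M.dA₁ y).add (M.dB₁ y)).const_mul _).add
    (((M.dA₂ y).add (M.dB₂ y)).const_mul _)).const_mul _).const_add _ |>.congr_deriv
    (by simp only [slope]; ring)

/-- The `C`-terms of the derivative are eliminated by `w_sub_eq`. After division by `x_y = 2w` this
reads `u_xx = u - 1/(2w)`, that is, `m = 1/(2w)`. -/
lemma hasDerivAt_slope (y : ℝ) : HasDerivAt M.slope (2 * M.w y * M.wave y - 1) y := by
  refine (((((M.dA₁ y).sub (M.dB₁ y)).const_mul _).add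
    (((M.dA₂ y).sub (M.dB₂ y)).const_mul _)).const_mul _).congr_deriv ?_
  have h := M.w_sub_eq y
  have hκ := M.κ_pos.ne'
  have h' : 2 * κ * M.w y - 1 = 2 * κ * (M.C₁ y * (M.k₁ / M.N₁) + M.C₂ y * (M.k₂ / M.N₂)) := by
    rw [← h]
    field_simp
  simp only [wave]
  linear_combination -h'

/-- The profile `m = 1 / (2w)` in the physical variable. -/
def profile (X : ℝ → ℝ) (x : ℝ) : ℝ := 1 / 2 * (M.w (Function.invFun X x))⁻¹ ^ 1

lemma momentum_wave {X : ℝ → ℝ} (hX : ∀ y, HasDerivAt X (2 * M.w y) y) :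
    momentum (fun x => M.wave (Function.invFun X x)) = M.profile X := by
  have d1 : deriv (fun x => M.wave (Function.invFun X x))
      = fun x => M.slope (Function.invFun X x) := by
    funext x
    refine ((M.hasDerivAt_comp_invFun hX (M.hasDerivAt_wave _)).congr_deriv ?_).deriv
    have := (M.w_pos (Function.invFun X x)).ne'
    field_simp
  funext x
  have := (M.w_pos (Function.invFun X x)).ne'
  simp only [momentum, d1, profile]
  rw [(M.hasDerivAt_comp_invFun hX (M.hasDerivAt_slope _)).deriv]
  field_simp
  ring

lemma G1_profile (X : ℝ → ℝ) (x : ℝ) :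
    G1 κ (M.profile X) x = 4 * M.U 0 (Function.invFun X x) := by
  have := M.κ_pos.ne'
  have := (M.w_pos (Function.invFun X x)).ne'
  rw [M.U_zero_eq]
  simp only [G1, profile]
  field_simp
  ring

lemma G2_profile {X : ℝ → ℝ} (hX : ∀ y, HasDerivAt X (2 * M.w y) y) (x : ℝ) :
    G2 κ (M.profile X) x = 16 * M.U 1 (Function.invFun X x)
      + 2 / κ ^ 2 * M.U 0 (Function.invFun X x) := by
  have hp := M.isProfile hX
  have e1 : deriv (M.profile X) = _ := hp.deriv_eq
  have e2 : deriv (deriv (M.profile X)) = _ := hp.deriv_deriv_eq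
  have hκ := M.κ_pos.ne'
  unfold G2
  rw [e2, e1]
  simp only [profile]
  set y := Function.invFun X x
  have hw := (M.w_pos y).ne'
  have h0 := M.U_zero_eq y
  have h1 := M.U_one_eq y
  -- Once `1/κ²` and `U₁` are eliminated by the first integrals, the claim is a rational identity in
  -- the independent quantities `w`, `U₀`, `T₀`, `W₀`.
  have hq : 1 / κ ^ 2 = 4 * (M.U 0 y + M.w y ^ 2) := by
    rw [h0]
    field_simp
    ring
  have e : ∀ a : ℝ, a / κ ^ 2 = a * (1 / κ ^ 2) := fun a => by ring
  have e' : 3 / (4 * κ ^ 4) = 3 / 4 * (1 / κ ^ 2) ^ 2 := by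
    field_simp
  rw [e 2, e', hq]
  have h1' : M.U 1 y = (M.U 0 y ^ 2 - M.T 0 y ^ 2 - 8 * M.w y * M.W 0 y) / 4 := by linarith
  rw [h1']
  simp only [w₂]
  generalize M.U 0 y = a at *
  generalize M.T 0 y = b at *
  generalize M.W 0 y = c at *
  field_simp
  ring

lemma G3_profile {X : ℝ → ℝ} (hX : ∀ y, HasDerivAt X (2 * M.w y) y) (x : ℝ) :
    G3 κ (M.profile X) x = 32 * M.U 2 (Function.invFun X x)
      + 4 / κ ^ 2 * M.U 1 (Function.invFun X x)
      + 3 / (4 * κ ^ 4) * M.U 0 (Function.invFun X x) := by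
  have hp := M.isProfile hX
  have e1 : deriv (M.profile X) = _ := hp.deriv_eq
  have e2 : deriv (deriv (M.profile X)) = _ := hp.deriv_deriv_eq
  have e3 : iteratedDeriv 3 (M.profile X) = _ := hp.iteratedDeriv_three
  have e4 : iteratedDeriv 4 (M.profile X) = _ := hp.iteratedDeriv_four
  have hκ := M.κ_pos.ne'
  unfold G3
  rw [e4, e3, e2, e1]
  simp only [profile]
  set y := Function.invFun X x
  have hw := (M.w_pos y).ne'
  have h0 := M.U_zero_eq y
  have h1 := M.U_one_eq y
  have h2 := M.U_two_eq y
  have hq : 1 / κ ^ 2 = 4 * (M.U 0 y + M.w y ^ 2) := by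
    rw [h0]
    field_simp
    ring
  have f1 : 4 / κ ^ 2 = 4 * (1 / κ ^ 2) := by ring
  have f2 : 3 / (4 * κ ^ 4) = 3 / 4 * (1 / κ ^ 2) ^ 2 := by
    field_simp
  have f3 : 5 / (16 * κ ^ 6) = 5 / 16 * (1 / κ ^ 2) ^ 3 := by
    field_simp
  rw [f1, f2, f3, hq]
  -- With `U₂` and `U₁` eliminated too, a rational identity in `w`, `U₀`, `T₀`, `W₀`, `T₁`, `W₁`
  -- remains.
  have h2' : M.U 2 y = (2 * M.U 0 y * M.U 1 y - 2 * M.T 0 y * M.T 1 y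
    - 4 * M.W 0 y ^ 2 - 8 * M.w y * M.W 1 y) / 4 := by linarith
  have h1' : M.U 1 y = (M.U 0 y ^ 2 - M.T 0 y ^ 2 - 8 * M.w y * M.W 0 y) / 4 := by linarith
  simp only [w₄, w₃, w₂]
  rw [h2', h1']
  generalize M.U 0 y = a at *
  generalize M.T 0 y = b at *
  generalize M.W 0 y = c at *
  generalize M.T 1 y = b' at *
  generalize M.W 1 y = c' at *
  generalize M.w y = w at *
  field_simp
  ring

/-- The two modes are linearly independent if their spectral parameters differ. -/
lemma mode_eq_zero (hN : M.N₁ ≠ M.N₂) {a b : ℝ}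
    (h : ∀ y, a * (M.A₁ y + M.B₁ y) + b * (M.A₂ y + M.B₂ y) = 0) (y : ℝ) :
    a * (M.A₁ y + M.B₁ y) = 0 ∧ b * (M.A₂ y + M.B₂ y) = 0 := by
  have der : ∀ {f : ℝ → ℝ} {y f' : ℝ}, (∀ y, f y = 0) → HasDerivAt f f' y → f' = 0 := by
    intro f y f' h0 hf
    exact hf.unique ((hasDerivAt_const y (0 : ℝ)).congr_of_eventuallyEq (Eventually.of_forall h0))
  have hD : ∀ y, a * (M.B₁ y - M.A₁ y) + b * (M.B₂ y - M.A₂ y) = 0 := by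
    intro y
    have := der h ((((M.dA₁ y).add (M.dB₁ y)).const_mul a).add
      (((M.dA₂ y).add (M.dB₂ y)).const_mul b))
    have hw := M.w_pos y
    have e : 2 * M.w y * (a * (M.B₁ y - M.A₁ y) + b * (M.B₂ y - M.A₂ y)) = 0 := by
      linear_combination -this
    rcases mul_eq_zero.1 e with h' | h'
    · linarith
    · exact h'
  have hC : ∀ y, a * M.C₁ y + b * M.C₂ y = 0 := by
    intro y
    have := der hD ((((M.dB₁ y).sub (M.dA₁ y)).const_mul a).add
      (((M.dB₂ y).sub (M.dA₂ y)).const_mul b))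
    linear_combination -1 / 4 * this - 1 / 2 * M.w y * h y
  -- Three differentiations of the relation bring back the differences `Bᵢ - Aᵢ` with weights `Nᵢ`;
  -- as `N₁ ≠ N₂`, the relation splits into its two modes.
  have hND : ∀ y, a * (M.N₁ * (M.B₁ y - M.A₁ y)) + b * (M.N₂ * (M.B₂ y - M.A₂ y)) = 0 := fun y =>
    der hC (((M.dC₁ y).const_mul a).add ((M.dC₂ y).const_mul b))
  have hD1 : ∀ y, a * (M.B₁ y - M.A₁ y) = 0 := by
    intro y
    have : (M.N₁ - M.N₂) * (a * (M.B₁ y - M.A₁ y)) = 0 := by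
      linear_combination hND y - M.N₂ * hD y
    exact (mul_eq_zero.1 this).resolve_left (sub_ne_zero.2 hN)
  -- Now `a(A₁ + B₁)` has zero derivative and vanishes at `-∞`.
  have hz : ∀ y, (M.A₁ y + M.B₁ y) * a = 0 := by
    refine eq_zero_of_hasDerivAt_zero (fun y => (((M.dA₁ y).add (M.dB₁ y)).mul_const a).congr_deriv
      ?_) ((M.A₁_decay.add M.B₁_decay).mul_bdd (BddCont.const a)).tendsto_atBot
    linear_combination -2 * M.w y * hD1 y
  have h1 : a * (M.A₁ y + M.B₁ y) = 0 := by rw [mul_comm]; exact hz y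
  exact ⟨h1, by linear_combination h y - h1⟩

/-- The profile of two active modes is a critical point of `F₃ + l₁F₁ + l₂F₂` for precisely one pair
of multipliers. -/
theorem isCriticalPoint_iff {X : ℝ → ℝ} (hX : ∀ y, HasDerivAt X (2 * M.w y) y)
    (hN : M.N₁ ≠ M.N₂) (h1 : ∃ y, M.A₁ y + M.B₁ y ≠ 0) (h2 : ∃ y, M.A₂ y + M.B₂ y ≠ 0)
    (l₁ l₂ : ℝ) :
    IsCriticalPoint κ (lagrangian κ l₁ l₂) (M.profile X) ↔
      l₁ = -1 / (16 * κ ^ 4) + 1 / κ ^ 2 * (M.N₁ + M.N₂) + 8 * (M.N₁ * M.N₂) ∧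
      l₂ = -(1 / (4 * κ ^ 2) + 2 * M.N₁ + 2 * M.N₂) := by
  have hκ := M.κ_pos
  have hp := M.isProfile hX
  have hg := (hp.isGradient_F1 hκ).lagrangian (l₁ := l₁) (l₂ := l₂) (hp.isGradient_F2 hκ)
    (hp.isGradient_F3 hκ)
  -- `α` and `β` are the coefficients of `U₀` and `U₁` in the gradient after the recurrence has
  -- removed `U₂`.
  set α := 4 * l₁ + 2 / κ ^ 2 * l₂ + 3 / (4 * κ ^ 4) - 32 * (M.N₁ * M.N₂) with hα
  set β := 16 * l₂ + 4 / κ ^ 2 + 32 * (M.N₁ + M.N₂) with hβ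
  have hgrad : (fun x => G3 κ (M.profile X) x + l₁ * G1 κ (M.profile X) x
      + l₂ * G2 κ (M.profile X) x)
      = fun x => M.U 0 (Function.invFun X x) * α + M.U 1 (Function.invFun X x) * β := by
    funext x
    rw [M.G1_profile, M.G2_profile hX, M.G3_profile hX, M.U_two_recurrence]
    ring
  have hcont : Continuous fun x => M.U 0 (Function.invFun X x) * α
      + M.U 1 (Function.invFun X x) * β :=
    ((M.decay_comp hX (M.U_decay 0)).1.mul continuous_const).add
      ((M.decay_comp hX (M.U_decay 1)).1.mul continuous_const)
  have hg' : IsGradient κ (lagrangian κ l₁ l₂) (M.profile X)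
      (fun x => M.U 0 (Function.invFun X x) * α + M.U 1 (Function.invFun X x) * β) := by
    rw [← hgrad]
    exact hg
  rw [hg'.isCriticalPoint_iff hcont]
  have hαβ : (α = 0 ∧ β = 0) ↔
      (l₁ = -1 / (16 * κ ^ 4) + 1 / κ ^ 2 * (M.N₁ + M.N₂) + 8 * (M.N₁ * M.N₂) ∧
      l₂ = -(1 / (4 * κ ^ 2) + 2 * M.N₁ + 2 * M.N₂)) := by
    have e1 : 4 / κ ^ 2 = 16 * (1 / (4 * κ ^ 2)) := by field_simp; ring
    have key : ∀ l₂, l₂ = -(1 / (4 * κ ^ 2) + 2 * M.N₁ + 2 * M.N₂) →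
        2 / κ ^ 2 * l₂ + 3 / (4 * κ ^ 4)
          = -4 * (-1 / (16 * κ ^ 4) + 1 / κ ^ 2 * (M.N₁ + M.N₂)) := by
      intro l₂ h
      rw [h]
      field_simp
      ring
    constructor
    · rintro ⟨ha, hb⟩
      have hl : l₂ = -(1 / (4 * κ ^ 2) + 2 * M.N₁ + 2 * M.N₂) := by linarith
      exact ⟨by linarith [key l₂ hl], hl⟩
    · rintro ⟨ha, hb⟩
      exact ⟨by linarith [key l₂ hb], by linarith⟩
  rw [← hαβ]
  constructor
  · intro h
    have hall : ∀ y, (M.k₁ * (α + β * M.N₁)) * (M.A₁ y + M.B₁ y)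
        + (M.k₂ * (α + β * M.N₂)) * (M.A₂ y + M.B₂ y) = 0 := by
      intro y
      have := h (X y)
      rw [M.invFun_X hX] at this
      simp only [U] at this
      linear_combination this
    obtain ⟨y₁, hy₁⟩ := h1
    obtain ⟨y₂, hy₂⟩ := h2
    have z1 := (mul_eq_zero.1 (M.mode_eq_zero hN hall y₁).1).resolve_right hy₁
    have z2 := (mul_eq_zero.1 (M.mode_eq_zero hN hall y₂).2).resolve_right hy₂
    have z1' := (mul_eq_zero.1 z1).resolve_left M.k₁_pos.ne'
    have z2' := (mul_eq_zero.1 z2).resolve_left M.k₂_pos.ne'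
    -- The affine function `α + βN` vanishes at the distinct points `N₁` and `N₂`.
    have hb : β = 0 := by
      have : β * (M.N₁ - M.N₂) = 0 := by linear_combination z1' - z2'
      exact (mul_eq_zero.1 this).resolve_right (sub_ne_zero.2 hN)
    refine ⟨?_, hb⟩
    rw [hb] at z1'
    linarith
  · rintro ⟨ha, hb⟩ x
    rw [ha, hb]
    ring

section SingleMode

variable (hA : ∀ y, M.A₂ y = 0) (hB : ∀ y, M.B₂ y = 0)

include hA hB

lemma U_succ_of_single (j : ℕ) (y : ℝ) : M.U (j + 1) y = M.N₁ * M.U j y := by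
  simp only [U, hA, hB]
  ring

lemma G2_profile_of_single {X : ℝ → ℝ} (hX : ∀ y, HasDerivAt X (2 * M.w y) y) (x : ℝ) :
    G2 κ (M.profile X) x = (4 * M.N₁ + 1 / (2 * κ ^ 2)) * G1 κ (M.profile X) x := by
  have hκ := M.κ_pos.ne'
  rw [M.G2_profile hX, M.G1_profile, M.U_succ_of_single hA hB 0]
  field_simp
  ring

lemma G3_profile_of_single {X : ℝ → ℝ} (hX : ∀ y, HasDerivAt X (2 * M.w y) y) (x : ℝ) :
    G3 κ (M.profile X) x
      = (8 * M.N₁ ^ 2 + M.N₁ / κ ^ 2 + 3 / (16 * κ ^ 4)) * G1 κ (M.profile X) x := by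
  have hκ := M.κ_pos.ne'
  rw [M.G3_profile hX, M.G1_profile, M.U_succ_of_single hA hB 1, M.U_succ_of_single hA hB 0]
  field_simp
  ring

end SingleMode

lemma exists_G1_profile_ne_zero {X : ℝ → ℝ} (hX : ∀ y, HasDerivAt X (2 * M.w y) y)
    (h1 : ∃ y, M.A₁ y + M.B₁ y ≠ 0) : ∃ x, G1 κ (M.profile X) x ≠ 0 := by
  obtain ⟨y, hy⟩ := h1
  refine ⟨X y, ?_⟩
  rw [M.G1_profile, M.invFun_X hX]
  have p1 : 0 < M.A₁ y + M.B₁ y :=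
    lt_of_le_of_ne (add_nonneg (M.A₁_nonneg y) (M.B₁_nonneg y)) hy.symm
  have p2 : 0 ≤ M.A₂ y + M.B₂ y := add_nonneg (M.A₂_nonneg y) (M.B₂_nonneg y)
  have hk1 := M.k₁_pos
  have hk2 := M.k₂_pos
  simp only [U, pow_zero, mul_one]
  positivity

end ModeSystem

/-! ### Tau functions of two modes

In the variables `xᵢ = e^{ξᵢ} / (1 + κkᵢ)` the tau function `g` arises from `f` by `κ ↦ -κ`. -/

/-- The tau function `f`. -/
def tauPoly (κ k₁ k₂ r x₁ x₂ : ℝ) : ℝ :=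
  1 + (1 + κ * k₁) * x₁ + (1 + κ * k₂) * x₂
    + r ^ 2 * ((1 + κ * k₁) * (1 + κ * k₂)) * (x₁ * x₂)

/-- The derivative of `tauPoly` along `xᵢ' = cᵢxᵢ`. -/
def tauPolyDeriv (κ k₁ k₂ r c₁ c₂ x₁ x₂ : ℝ) : ℝ :=
  (1 + κ * k₁) * (c₁ * x₁) + (1 + κ * k₂) * (c₂ * x₂)
    + r ^ 2 * ((1 + κ * k₁) * (1 + κ * k₂)) * ((c₁ + c₂) * (x₁ * x₂))

/-- The numerator of an eigenfunction. -/
def eigenNum (κ k r x : ℝ) : ℝ := 1 + r * ((1 + κ * k) * x)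

lemma tauPoly_swap (κ k₁ k₂ r x₁ x₂ : ℝ) :
    tauPoly κ k₂ k₁ (-r) x₂ x₁ = tauPoly κ k₁ k₂ r x₁ x₂ := by
  simp only [tauPoly]
  ring

lemma tauPolyDeriv_swap (κ k₁ k₂ r c₁ c₂ x₁ x₂ : ℝ) :
    tauPolyDeriv κ k₂ k₁ (-r) c₂ c₁ x₂ x₁ = tauPolyDeriv κ k₁ k₂ r c₁ c₂ x₁ x₂ := by
  simp only [tauPolyDeriv]
  ring

lemma tauPoly_pos {κ k₁ k₂ r x₁ x₂ : ℝ} (h₁ : 0 < 1 + κ * k₁) (h₂ : 0 < 1 + κ * k₂)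
    (hx₁ : 0 ≤ x₁) (hx₂ : 0 ≤ x₂) : 0 < tauPoly κ k₁ k₂ r x₁ x₂ := by
  simp only [tauPoly]
  positivity

lemma hasDerivAt_tauPoly {κ k₁ k₂ r c₁ c₂ y : ℝ} {e₁ e₂ : ℝ → ℝ}
    (h₁ : HasDerivAt e₁ (c₁ * e₁ y) y) (h₂ : HasDerivAt e₂ (c₂ * e₂ y) y) :
    HasDerivAt (fun y => tauPoly κ k₁ k₂ r (e₁ y) (e₂ y))
      (tauPolyDeriv κ k₁ k₂ r c₁ c₂ (e₁ y) (e₂ y)) y :=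
  ((((h₁.const_mul _).const_add _).add (h₂.const_mul _)).add ((h₁.mul h₂).const_mul _)).congr_deriv
    (by simp only [tauPolyDeriv]; ring)

lemma hasDerivAt_eigenNum {κ k r c y : ℝ} {e : ℝ → ℝ} (h : HasDerivAt e (c * e y) y) :
    HasDerivAt (fun y => eigenNum κ k r (e y)) (c * (eigenNum κ k r (e y) - 1)) y :=
  (((h.const_mul _).const_mul _).const_add _).congr_deriv (by simp only [eigenNum]; ring)

section Identities

variable {κ k₁ k₂ r : ℝ} (hr : r * (k₁ + k₂) = k₁ - k₂)

include hr

/-- A rational parametrization of the constraint on `r`, after which the bilinear identities hold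
identically in `σ` and `r`. -/
lemma exists_eq_mul_one_add : ∃ σ, k₁ = σ * (1 + r) ∧ k₂ = σ * (1 - r) :=
  ⟨(k₁ + k₂) / 2, by linear_combination -hr / 2, by linear_combination hr / 2⟩

/-- The bilinear form of the Darboux transformation of an eigenfunction. -/
lemma eigenNum_darboux (x₁ x₂ : ℝ) :
    κ * (k₁ * eigenNum κ k₂ r x₂ + 2 * (k₂ * (eigenNum κ k₂ r x₂ - 1)))
        * tauPoly (-κ) k₁ k₂ r x₁ x₂
      - eigenNum κ k₂ r x₂ * tauPoly (-κ) k₁ k₂ r x₁ x₂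
      - 2 * κ * (eigenNum κ k₂ r x₂ * tauPolyDeriv (-κ) k₁ k₂ r k₁ k₂ x₁ x₂)
      + (1 - κ * k₁) * (eigenNum (-κ) k₂ r x₂ * tauPoly κ k₁ k₂ r x₁ x₂) = 0 := by
  obtain ⟨σ, rfl, rfl⟩ := exists_eq_mul_one_add hr
  simp only [eigenNum, tauPoly, tauPolyDeriv]
  ring

/-- The mixed logarithmic derivatives of the tau function are squared eigenfunctions. -/
lemma tauPoly_mixed (x₁ x₂ : ℝ) :
    ((1 + κ * k₁) * (k₁ * x₁) + r ^ 2 * ((1 + κ * k₁) * (1 + κ * k₂)) * ((k₁ + k₂) * (x₁ * x₂)))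
        * tauPoly κ k₁ k₂ r x₁ x₂
      - ((1 + κ * k₁) * x₁ + r ^ 2 * ((1 + κ * k₁) * (1 + κ * k₂)) * (x₁ * x₂))
        * tauPolyDeriv κ k₁ k₂ r k₁ k₂ x₁ x₂
      = k₁ * ((1 + κ * k₁) * x₁) * eigenNum κ k₂ r x₂ ^ 2 := by
  obtain ⟨σ, rfl, rfl⟩ := exists_eq_mul_one_add hr
  simp only [eigenNum, tauPoly, tauPolyDeriv]
  ring

end Identities

/-! ### Localization and differential equations of the modes. -/

/-- Localization of a squared eigenfunction. -/
lemma expDecay_of_mode {c k L : ℝ} (hc : 0 ≤ c) (hk : 0 < k) {F : ℝ → ℝ} (hF : Continuous F)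
    (h0 : ∀ y, 0 ≤ F y) (h1 : ∀ y, F y ≤ L * (c * Real.exp (k * y)))
    (h2 : ∀ y, F y * (c * Real.exp (k * y)) ≤ L) : ExpDecay F := by
  rcases hc.eq_or_lt with rfl | hc
  · have hz : F = fun _ => 0 := funext fun y => le_antisymm (by simpa using h1 y) (h0 y)
    rw [hz]
    exact ExpDecay.zero
  · have hL : 0 ≤ L := by
      refine le_trans ?_ (h2 0)
      have := h0 0
      positivity
    refine ⟨hF, L * (c + c⁻¹), k, hk, fun y => ?_⟩
    rw [abs_of_nonneg (h0 y)]
    have hci := inv_pos.2 hc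
    rcases le_total y 0 with hy | hy
    · rw [abs_of_nonpos hy, mul_neg, neg_neg]
      refine (h1 y).trans ?_
      rw [mul_assoc]
      gcongr
      linarith
    · rw [abs_of_nonneg hy, Real.exp_neg]
      have h3 : F y ≤ L * (c⁻¹ * (Real.exp (k * y))⁻¹) := by
        rw [← mul_inv, ← div_eq_mul_inv, le_div_iff₀ (by positivity)]
        exact h2 y
      refine h3.trans ?_
      rw [mul_assoc]
      gcongr
      linarith

/-- The bounds behind the localization of a squared eigenfunction. -/
lemma mode_bound {r E z : ℝ} (hr0 : r ≠ 0) (hr1 : r ^ 2 ≤ 1) (hE : 0 ≤ E) (hz : 0 ≤ z) :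
    E * (1 + r * z) ^ 2 / (1 + E + z + r ^ 2 * (E * z)) ^ 2 ≤ E ∧
      E * (1 + r * z) ^ 2 / (1 + E + z + r ^ 2 * (E * z)) ^ 2 * E ≤ 1 / r ^ 2 := by
  have hr2 : 0 < r ^ 2 := by positivity
  have hD : 0 < 1 + E + z + r ^ 2 * (E * z) := by positivity
  -- Cauchy-Schwarz; the difference is `z(1 - r)²`, so the sign of `r` is immaterial, as the second
  -- mode requires.
  have hn : (1 + r * z) ^ 2 ≤ (1 + z) * (1 + r ^ 2 * z) := by
    nlinarith [mul_nonneg hz (sq_nonneg (1 - r))]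
  have hXD : 1 + z ≤ 1 + E + z + r ^ 2 * (E * z) := by
    have : 0 ≤ E + r ^ 2 * (E * z) := by positivity
    linarith
  have hYX : 1 + r ^ 2 * z ≤ 1 + z := by nlinarith
  have hXY : r ^ 2 * (1 + z) ≤ 1 + r ^ 2 * z := by nlinarith
  have hYD : E * (1 + r ^ 2 * z) ≤ 1 + E + z + r ^ 2 * (E * z) := by nlinarith
  constructor
  · rw [div_le_iff₀ (by positivity)]
    have : (1 + r * z) ^ 2 ≤ (1 + E + z + r ^ 2 * (E * z)) ^ 2 := by
      calc (1 + r * z) ^ 2 ≤ (1 + z) * (1 + r ^ 2 * z) := hn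
        _ ≤ (1 + z) * (1 + z) := by gcongr
        _ ≤ (1 + E + z + r ^ 2 * (E * z)) * (1 + E + z + r ^ 2 * (E * z)) := by gcongr
        _ = _ := by ring
    gcongr
  · rw [div_mul_eq_mul_div, div_le_div_iff₀ (by positivity) hr2]
    calc E * (1 + r * z) ^ 2 * E * r ^ 2
        ≤ E * ((1 + z) * (1 + r ^ 2 * z)) * E * r ^ 2 := by gcongr
      _ = (E * (1 + r ^ 2 * z)) * (E * (r ^ 2 * (1 + z))) := by ring
      _ ≤ (E * (1 + r ^ 2 * z)) * (E * (1 + r ^ 2 * z)) := by gcongr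
      _ ≤ (1 + E + z + r ^ 2 * (E * z)) * (1 + E + z + r ^ 2 * (E * z)) := by gcongr
      _ = _ := by ring

/-! ### Soliton data, modes and the mode system of a soliton. -/

/-- The parameters of a 2-soliton, or of a 1-soliton if `b₂ = 0`. -/
structure SolitonData (κ : ℝ) where
  (k₁ k₂ r b₁ b₂ : ℝ)
  κ_pos : 0 < κ
  k₁_pos : 0 < k₁
  k₂_pos : 0 < k₂
  k₁_lt : 4 * (κ * k₁) ^ 2 < 3
  k₂_lt : 4 * (κ * k₂) ^ 2 < 3
  r_pos : 0 < r
  r_eq : r * (k₁ + k₂) = k₁ - k₂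
  b₁_pos : 0 < b₁
  b₂_nonneg : 0 ≤ b₂

/-- The squared eigenfunction `ψ²` of a mode. -/
def modeSq (κ k k' r x x' : ℝ) : ℝ :=
  k * ((1 + κ * k) * x) * eigenNum κ k' r x' ^ 2 / tauPoly κ k k' r x x' ^ 2

/-- The product `ψχ` of a mode. -/
def modeProd (κ k k' r x x' : ℝ) : ℝ :=
  -(k * ((1 + κ * k) * (1 - κ * k)) / (2 * κ)) * x * (eigenNum κ k' r x' * eigenNum (-κ) k' r x')
    / (tauPoly κ k k' r x x' * tauPoly (-κ) k k' r x x')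

/-- The logarithmic derivative of `e^{y/(2κ)} g / f`. -/
def logDeriv (κ k k' r x x' : ℝ) : ℝ :=
  1 / (2 * κ) + tauPolyDeriv (-κ) k k' r k k' x x' / tauPoly (-κ) k k' r x x'
    - tauPolyDeriv κ k k' r k k' x x' / tauPoly κ k k' r x x'

lemma logDeriv_swap (κ k k' r x x' : ℝ) : logDeriv κ k' k (-r) x' x = logDeriv κ k k' r x x' := by
  simp only [logDeriv, tauPoly_swap, tauPolyDeriv_swap]

section ModeEquations

variable {κ k k' r y : ℝ} {e e' : ℝ → ℝ} (hκ : κ ≠ 0)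
  (hr : r * (k + k') = k - k') (hf : tauPoly κ k k' r (e y) (e' y) ≠ 0)
  (hg : tauPoly (-κ) k k' r (e y) (e' y) ≠ 0)
  (he : HasDerivAt e (k * e y) y) (he' : HasDerivAt e' (k' * e' y) y)

include hκ hr hf hg he he'

/-- With denominators cleared, the discrepancy is a multiple of the Darboux form `eigenNum_darboux`.
-/
lemma hasDerivAt_modeSq : HasDerivAt (fun y => modeSq κ k k' r (e y) (e' y))
    (2 * logDeriv κ k k' r (e y) (e' y) * modeSq κ k k' r (e y) (e' y)
      + 2 * modeProd κ k k' r (e y) (e' y)) y := by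
  have I := eigenNum_darboux (κ := κ) hr (e y) (e' y)
  refine ((((he.const_mul (1 + κ * k)).const_mul k).mul ((hasDerivAt_eigenNum he').pow 2)).div
    ((hasDerivAt_tauPoly he he').pow 2) (pow_ne_zero 2 hf)).congr_deriv ?_
  simp only [modeSq, modeProd, logDeriv, Pi.pow_apply, Pi.mul_apply]
  generalize eigenNum κ k' r (e' y) = n at *
  generalize eigenNum (-κ) k' r (e' y) = n' at *
  generalize tauPoly κ k k' r (e y) (e' y) = f at *
  generalize tauPoly (-κ) k k' r (e y) (e' y) = g at *
  generalize tauPolyDeriv κ k k' r k k' (e y) (e' y) = f' at *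
  generalize tauPolyDeriv (-κ) k k' r k k' (e y) (e' y) = g' at *
  push_cast
  field_simp
  linear_combination k * (1 + κ * k) * e y * n * f * I

/-- Here the Darboux form is used at both `κ` and `-κ`, since the product involves both tau
functions. -/
lemma hasDerivAt_modeProd : HasDerivAt (fun y => modeProd κ k k' r (e y) (e' y))
    ((1 / κ ^ 2 - k ^ 2) / 4 * (modeSq (-κ) k k' r (e y) (e' y) - modeSq κ k k' r (e y) (e' y)))
    y := by
  have I := eigenNum_darboux (κ := κ) hr (e y) (e' y)
  have I' := eigenNum_darboux (κ := -κ) hr (e y) (e' y)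
  rw [neg_neg] at I'
  refine (((he.const_mul (-(k * ((1 + κ * k) * (1 - κ * k)) / (2 * κ)))).mul
    ((hasDerivAt_eigenNum he').mul (hasDerivAt_eigenNum he'))).div
    ((hasDerivAt_tauPoly he he').mul (hasDerivAt_tauPoly he he')) (mul_ne_zero hf hg)).congr_deriv
    ?_
  simp only [modeSq, Pi.mul_apply]
  generalize eigenNum κ k' r (e' y) = n at *
  generalize eigenNum (-κ) k' r (e' y) = n' at *
  generalize tauPoly κ k k' r (e y) (e' y) = f at *
  generalize tauPoly (-κ) k k' r (e y) (e' y) = g at *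
  generalize tauPolyDeriv κ k k' r k k' (e y) (e' y) = f' at *
  generalize tauPolyDeriv (-κ) k k' r k k' (e y) (e' y) = g' at *
  field_simp
  linear_combination -2 * k * e y * (1 - κ ^ 2 * k ^ 2) * (n' * f * I - n * g * I')

end ModeEquations

/-- The part of the logarithmic derivative of the tau function along one exponential. -/
def tauPart (κ k k' r x x' : ℝ) : ℝ :=
  ((1 + κ * k) * x + r ^ 2 * ((1 + κ * k) * (1 + κ * k')) * (x * x')) / tauPoly κ k k' r x x'

/-- The rates `c`, `c'` are arbitrary, so the same splitting serves the `y`-derivative in `w` and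
the time derivative in `u`. -/
lemma tauPolyDeriv_div (κ k k' r c c' x x' : ℝ) :
    tauPolyDeriv κ k k' r c c' x x' / tauPoly κ k k' r x x'
      = c * tauPart κ k k' r x x' + c' * tauPart κ k' k (-r) x' x := by
  simp only [tauPart, tauPoly_swap]
  rw [← mul_div_assoc, ← mul_div_assoc, ← add_div]
  congr 1
  simp only [tauPolyDeriv]
  ring

lemma hasDerivAt_tauPart {κ k k' r y : ℝ} {e e' : ℝ → ℝ} (hr : r * (k + k') = k - k')
    (hf : tauPoly κ k k' r (e y) (e' y) ≠ 0) (he : HasDerivAt e (k * e y) y)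
    (he' : HasDerivAt e' (k' * e' y) y) :
    HasDerivAt (fun y => tauPart κ k k' r (e y) (e' y)) (modeSq κ k k' r (e y) (e' y)) y := by
  refine (((he.const_mul _).add ((he.mul he').const_mul _)).div (hasDerivAt_tauPoly he he')
    hf).congr_deriv ?_
  have h := tauPoly_mixed (κ := κ) hr (e y) (e' y)
  simp only [modeSq, Pi.mul_apply]
  rw [← h]
  congr 1
  simp only [Pi.add_apply]
  ring

/-- The reflection `κ ↦ -κ` exchanges `f` and `g`, and hence `A` and `B`; with the sign changes of
`w` and `C` it turns the equation for `A` into the one for `B`. -/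
lemma logDeriv_neg (κ k k' r x x' : ℝ) :
    logDeriv (-κ) k k' r x x' = -logDeriv κ k k' r x x' := by
  simp only [logDeriv, neg_neg, mul_neg, div_neg]
  ring

lemma modeProd_neg (κ k k' r x x' : ℝ) :
    modeProd (-κ) k k' r x x' = -modeProd κ k k' r x x' := by
  simp only [modeProd, neg_neg, mul_neg, div_neg, neg_mul, neg_div]
  ring

lemma modeSq_nonneg {κ k k' r x x' : ℝ} (hk : 0 ≤ k) (h : 0 ≤ 1 + κ * k) (hx : 0 ≤ x) :
    0 ≤ modeSq κ k k' r x x' := by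
  simp only [modeSq]
  positivity

lemma modeProd_sq {κ k k' r x x' : ℝ} (hκ : κ ≠ 0) :
    modeProd κ k k' r x x' ^ 2
      = (1 / κ ^ 2 - k ^ 2) / 4 * modeSq κ k k' r x x' * modeSq (-κ) k k' r x x' := by
  simp only [modeProd, modeSq, div_eq_mul_inv, mul_inv]
  have : κ⁻¹ * κ = 1 := inv_mul_cancel₀ hκ
  have e : 1 * (κ ^ 2)⁻¹ - k ^ 2 = (κ⁻¹) ^ 2 * ((1 + κ * k) * (1 - κ * k)) := by
    field_simp
    ring
  rw [e]
  ring

/-- The mode is bounded by a multiple of its own exponential and, as `r ≠ 0`, of the reciprocal,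
uniformly in the value of the other exponential. -/
lemma modeSq_decay {κ k k' r c : ℝ} {e e' : ℝ → ℝ} (hk : 0 < k) (h : 0 < 1 + κ * k)
    (h' : 0 < 1 + κ * k') (hr0 : r ≠ 0) (hr1 : r ^ 2 ≤ 1) (hc : 0 ≤ c)
    (hcont : Continuous fun y => modeSq κ k k' r (e y) (e' y))
    (he : ∀ y, e y = c * Real.exp (k * y)) (he' : ∀ y, 0 ≤ e' y) :
    ExpDecay fun y => modeSq κ k k' r (e y) (e' y) := by
  have hE : ∀ y, (1 + κ * k) * c * Real.exp (k * y) = (1 + κ * k) * e y := fun y => by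
    rw [he y]; ring
  have hE0 : ∀ y, 0 ≤ (1 + κ * k) * e y := fun y => by rw [he y]; positivity
  have hz0 : ∀ y, 0 ≤ (1 + κ * k') * e' y := fun y => mul_nonneg h'.le (he' y)
  have hm : ∀ y, modeSq κ k k' r (e y) (e' y)
      = k * ((1 + κ * k) * e y * (1 + r * ((1 + κ * k') * e' y)) ^ 2
        / (1 + (1 + κ * k) * e y + (1 + κ * k') * e' y
          + r ^ 2 * ((1 + κ * k) * e y * ((1 + κ * k') * e' y))) ^ 2) := fun y => by
    simp only [modeSq, eigenNum, tauPoly]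
    rw [← mul_div_assoc]
    congr 1 <;> ring
  have hr2 : 0 < r ^ 2 := by positivity
  have hL : 1 ≤ 1 / r ^ 2 := (one_le_div hr2).2 hr1
  refine expDecay_of_mode (c := (1 + κ * k) * c) (L := k * (1 / r ^ 2)) (by positivity) hk hcont
    (fun y => modeSq_nonneg hk.le h.le (by rw [he y]; positivity)) (fun y => ?_) (fun y => ?_)
  · rw [hE, hm, mul_assoc k (1 / r ^ 2)]
    refine mul_le_mul_of_nonneg_left ?_ hk.le
    refine (mode_bound hr0 hr1 (hE0 y) (hz0 y)).1.trans ?_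
    exact le_mul_of_one_le_left (hE0 y) hL
  · rw [hE, hm, mul_assoc k]
    exact mul_le_mul_of_nonneg_left (mode_bound hr0 hr1 (hE0 y) (hz0 y)).2 hk.le

namespace SolitonData

variable {κ : ℝ} (S : SolitonData κ)

/-- The first exponential. -/
def e₁ (τ y : ℝ) : ℝ := S.b₁ * Real.exp (S.k₁ * (y - 2 * κ ^ 3 / (1 - (κ * S.k₁) ^ 2) * τ))

/-- The second exponential. -/
def e₂ (τ y : ℝ) : ℝ := S.b₂ * Real.exp (S.k₂ * (y - 2 * κ ^ 3 / (1 - (κ * S.k₂) ^ 2) * τ))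

/-- The tau function `f`. -/
def f (τ y : ℝ) : ℝ := tauPoly κ S.k₁ S.k₂ S.r (S.e₁ τ y) (S.e₂ τ y)

/-- The tau function `g`. -/
def g (τ y : ℝ) : ℝ := tauPoly (-κ) S.k₁ S.k₂ S.r (S.e₁ τ y) (S.e₂ τ y)

lemma de₁ (τ y : ℝ) : HasDerivAt (S.e₁ τ) (S.k₁ * S.e₁ τ y) y :=
  ((((hasDerivAt_id y).sub_const _).const_mul S.k₁).exp.const_mul S.b₁).congr_deriv
    (by simp only [e₁, id]; ring)

lemma de₂ (τ y : ℝ) : HasDerivAt (S.e₂ τ) (S.k₂ * S.e₂ τ y) y :=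
  ((((hasDerivAt_id y).sub_const _).const_mul S.k₂).exp.const_mul S.b₂).congr_deriv
    (by simp only [e₂, id]; ring)

lemma de₁_time (τ y : ℝ) : HasDerivAt (fun τ => S.e₁ τ y)
    (-(S.k₁ * (2 * κ ^ 3 / (1 - (κ * S.k₁) ^ 2))) * S.e₁ τ y) τ :=
  (((((hasDerivAt_id τ).const_mul _).const_sub y).const_mul S.k₁).exp.const_mul S.b₁).congr_deriv
    (by simp only [e₁, id]; ring)

lemma de₂_time (τ y : ℝ) : HasDerivAt (fun τ => S.e₂ τ y)
    (-(S.k₂ * (2 * κ ^ 3 / (1 - (κ * S.k₂) ^ 2))) * S.e₂ τ y) τ :=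
  (((((hasDerivAt_id τ).const_mul _).const_sub y).const_mul S.k₂).exp.const_mul S.b₂).congr_deriv
    (by simp only [e₂, id]; ring)

lemma e₁_pos (τ y : ℝ) : 0 < S.e₁ τ y := mul_pos S.b₁_pos (Real.exp_pos _)

lemma e₂_nonneg (τ y : ℝ) : 0 ≤ S.e₂ τ y := mul_nonneg S.b₂_nonneg (Real.exp_pos _).le

lemma e₁_eq (τ y : ℝ) : S.e₁ τ y
    = S.b₁ * Real.exp (-(S.k₁ * (2 * κ ^ 3 / (1 - (κ * S.k₁) ^ 2) * τ))) * Real.exp (S.k₁ * y) := by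
  rw [mul_assoc, ← Real.exp_add, e₁]
  congr 2
  ring

lemma e₂_eq (τ y : ℝ) : S.e₂ τ y
    = S.b₂ * Real.exp (-(S.k₂ * (2 * κ ^ 3 / (1 - (κ * S.k₂) ^ 2) * τ))) * Real.exp (S.k₂ * y) := by
  rw [mul_assoc, ← Real.exp_add, e₂]
  congr 2
  ring

lemma one_add₁ : 0 < 1 + κ * S.k₁ := by
  have := mul_pos S.κ_pos S.k₁_pos
  linarith

lemma one_add₂ : 0 < 1 + κ * S.k₂ := by
  have := mul_pos S.κ_pos S.k₂_pos
  linarith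

lemma one_sub₁ : 0 < 1 + -κ * S.k₁ := by
  have := mul_pos S.κ_pos S.k₁_pos
  have := S.k₁_lt
  nlinarith

lemma one_sub₂ : 0 < 1 + -κ * S.k₂ := by
  have := mul_pos S.κ_pos S.k₂_pos
  have := S.k₂_lt
  nlinarith

lemma f_pos (τ y : ℝ) : 0 < S.f τ y :=
  tauPoly_pos S.one_add₁ S.one_add₂ (S.e₁_pos τ y).le (S.e₂_nonneg τ y)

lemma g_pos (τ y : ℝ) : 0 < S.g τ y :=
  tauPoly_pos S.one_sub₁ S.one_sub₂ (S.e₁_pos τ y).le (S.e₂_nonneg τ y)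

/-- The second mode is the first one with the exponentials exchanged and `r` negated, a symmetry of
the tau functions and of `w`. -/
lemma r_eq_swap : -S.r * (S.k₂ + S.k₁) = S.k₂ - S.k₁ := by linear_combination -S.r_eq

lemma r_sq_le : S.r ^ 2 ≤ 1 := by
  have h1 := S.k₁_pos
  have h2 := S.k₂_pos
  have h3 := S.r_pos
  have h4 := S.r_eq
  have : S.r ≤ 1 := by
    by_contra hlt
    push Not at hlt
    nlinarith
  exact pow_le_one₀ h3.le this

lemma f_swap_ne (τ y : ℝ) : tauPoly κ S.k₂ S.k₁ (-S.r) (S.e₂ τ y) (S.e₁ τ y) ≠ 0 := by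
  rw [tauPoly_swap]
  exact (S.f_pos τ y).ne'

lemma g_swap_ne (τ y : ℝ) : tauPoly (-κ) S.k₂ S.k₁ (-S.r) (S.e₂ τ y) (S.e₁ τ y) ≠ 0 := by
  rw [tauPoly_swap]
  exact (S.g_pos τ y).ne'

/-- `w` at time `t`. -/
def w (t y : ℝ) : ℝ := logDeriv κ S.k₁ S.k₂ S.r (S.e₁ t y) (S.e₂ t y)

/-- `A₁` at time `t`. -/
def A₁ (t y : ℝ) : ℝ := modeSq κ S.k₁ S.k₂ S.r (S.e₁ t y) (S.e₂ t y)

/-- `B₁` at time `t`. -/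
def B₁ (t y : ℝ) : ℝ := modeSq (-κ) S.k₁ S.k₂ S.r (S.e₁ t y) (S.e₂ t y)

/-- `C₁` at time `t`. -/
def C₁ (t y : ℝ) : ℝ := modeProd κ S.k₁ S.k₂ S.r (S.e₁ t y) (S.e₂ t y)

/-- `A₂` at time `t`. -/
def A₂ (t y : ℝ) : ℝ := modeSq κ S.k₂ S.k₁ (-S.r) (S.e₂ t y) (S.e₁ t y)

/-- `B₂` at time `t`. -/
def B₂ (t y : ℝ) : ℝ := modeSq (-κ) S.k₂ S.k₁ (-S.r) (S.e₂ t y) (S.e₁ t y)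

/-- `C₂` at time `t`. -/
def C₂ (t y : ℝ) : ℝ := modeProd κ S.k₂ S.k₁ (-S.r) (S.e₂ t y) (S.e₁ t y)

lemma dA₁ (t y : ℝ) : HasDerivAt (S.A₁ t) (2 * S.w t y * S.A₁ t y + 2 * S.C₁ t y) y :=
  hasDerivAt_modeSq S.κ_pos.ne' S.r_eq (S.f_pos t y).ne' (S.g_pos t y).ne' (S.de₁ t y) (S.de₂ t y)

lemma dA₂ (t y : ℝ) : HasDerivAt (S.A₂ t) (2 * S.w t y * S.A₂ t y + 2 * S.C₂ t y) y := by
  have h := hasDerivAt_modeSq S.κ_pos.ne' S.r_eq_swap (S.f_swap_ne t y) (S.g_swap_ne t y)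
    (S.de₂ t y) (S.de₁ t y)
  rwa [logDeriv_swap] at h

lemma dB₁ (t y : ℝ) : HasDerivAt (S.B₁ t) (-2 * S.w t y * S.B₁ t y - 2 * S.C₁ t y) y := by
  refine (hasDerivAt_modeSq (neg_ne_zero.2 S.κ_pos.ne') S.r_eq (S.g_pos t y).ne' ?_
    (S.de₁ t y) (S.de₂ t y)).congr_deriv ?_
  · rw [neg_neg]
    exact (S.f_pos t y).ne'
  · rw [logDeriv_neg, modeProd_neg]
    simp only [w, B₁, C₁]
    ring

lemma dB₂ (t y : ℝ) : HasDerivAt (S.B₂ t) (-2 * S.w t y * S.B₂ t y - 2 * S.C₂ t y) y := by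
  refine (hasDerivAt_modeSq (neg_ne_zero.2 S.κ_pos.ne') S.r_eq_swap (S.g_swap_ne t y) ?_
    (S.de₂ t y) (S.de₁ t y)).congr_deriv ?_
  · rw [neg_neg]
    exact S.f_swap_ne t y
  · rw [logDeriv_neg, modeProd_neg, logDeriv_swap]
    simp only [w, B₂, C₂]
    ring

lemma dC₁ (t y : ℝ) :
    HasDerivAt (S.C₁ t) ((1 / κ ^ 2 - S.k₁ ^ 2) / 4 * (S.B₁ t y - S.A₁ t y)) y :=
  hasDerivAt_modeProd S.κ_pos.ne' S.r_eq (S.f_pos t y).ne' (S.g_pos t y).ne' (S.de₁ t y)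
    (S.de₂ t y)

lemma dC₂ (t y : ℝ) :
    HasDerivAt (S.C₂ t) ((1 / κ ^ 2 - S.k₂ ^ 2) / 4 * (S.B₂ t y - S.A₂ t y)) y :=
  hasDerivAt_modeProd S.κ_pos.ne' S.r_eq_swap (S.f_swap_ne t y) (S.g_swap_ne t y) (S.de₂ t y)
    (S.de₁ t y)

lemma dpartA₁ (t y : ℝ) : HasDerivAt
    (fun y => tauPart κ S.k₁ S.k₂ S.r (S.e₁ t y) (S.e₂ t y)) (S.A₁ t y) y :=
  hasDerivAt_tauPart S.r_eq (S.f_pos t y).ne' (S.de₁ t y) (S.de₂ t y)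

lemma dpartA₂ (t y : ℝ) : HasDerivAt
    (fun y => tauPart κ S.k₂ S.k₁ (-S.r) (S.e₂ t y) (S.e₁ t y)) (S.A₂ t y) y :=
  hasDerivAt_tauPart S.r_eq_swap (S.f_swap_ne t y) (S.de₂ t y) (S.de₁ t y)

lemma dpartB₁ (t y : ℝ) : HasDerivAt
    (fun y => tauPart (-κ) S.k₁ S.k₂ S.r (S.e₁ t y) (S.e₂ t y)) (S.B₁ t y) y :=
  hasDerivAt_tauPart S.r_eq (S.g_pos t y).ne' (S.de₁ t y) (S.de₂ t y)

lemma dpartB₂ (t y : ℝ) : HasDerivAt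
    (fun y => tauPart (-κ) S.k₂ S.k₁ (-S.r) (S.e₂ t y) (S.e₁ t y)) (S.B₂ t y) y :=
  hasDerivAt_tauPart S.r_eq_swap (S.g_swap_ne t y) (S.de₂ t y) (S.de₁ t y)

lemma dw (t y : ℝ) : HasDerivAt (S.w t)
    (S.k₁ * (S.B₁ t y - S.A₁ t y) + S.k₂ * (S.B₂ t y - S.A₂ t y)) y := by
  have h := ((((S.dpartB₁ t y).const_mul S.k₁).add ((S.dpartB₂ t y).const_mul S.k₂)).const_add
    (1 / (2 * κ))).sub (((S.dpartA₁ t y).const_mul S.k₁).add ((S.dpartA₂ t y).const_mul S.k₂))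
  refine (h.congr_of_eventuallyEq (Eventually.of_forall fun z => ?_)).congr_deriv (by ring)
  simp only [w, logDeriv, tauPolyDeriv_div, Pi.add_apply, Pi.sub_apply]

lemma w_tendsto (t : ℝ) : Tendsto (S.w t) atBot (𝓝 (1 / (2 * κ))) := by
  have hexp : ∀ {c k : ℝ}, 0 < k → Tendsto (fun y => c * Real.exp (k * y)) atBot (𝓝 0) := by
    intro c k hk
    simpa using (Real.tendsto_exp_atBot.comp (tendsto_id.const_mul_atBot hk)).const_mul c
  have h1 : Tendsto (S.e₁ t) atBot (𝓝 0) :=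
    (hexp S.k₁_pos).congr fun y => (S.e₁_eq t y).symm
  have h2 : Tendsto (S.e₂ t) atBot (𝓝 0) :=
    (hexp S.k₂_pos).congr fun y => (S.e₂_eq t y).symm
  have hP : ∀ κ' : ℝ, Tendsto (fun y => tauPoly κ' S.k₁ S.k₂ S.r (S.e₁ t y) (S.e₂ t y)) atBot
      (𝓝 1) := fun κ' => by
    have h := ((((h1.const_mul (1 + κ' * S.k₁)).const_add 1).add
      (h2.const_mul (1 + κ' * S.k₂))).add ((h1.mul h2).const_mul
        (S.r ^ 2 * ((1 + κ' * S.k₁) * (1 + κ' * S.k₂)))))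
    simpa only [mul_zero, add_zero, tauPoly] using h
  have hD : ∀ κ' : ℝ, Tendsto
      (fun y => tauPolyDeriv κ' S.k₁ S.k₂ S.r S.k₁ S.k₂ (S.e₁ t y) (S.e₂ t y)) atBot
      (𝓝 0) := fun κ' => by
    have h := ((((h1.const_mul S.k₁).const_mul (1 + κ' * S.k₁))).add
      ((h2.const_mul S.k₂).const_mul (1 + κ' * S.k₂))).add
        (((h1.mul h2).const_mul (S.k₁ + S.k₂)).const_mul
          (S.r ^ 2 * ((1 + κ' * S.k₁) * (1 + κ' * S.k₂))))
    simpa only [mul_zero, add_zero, tauPolyDeriv] using h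
  have h := (((hD (-κ)).div (hP (-κ)) one_ne_zero).const_add (1 / (2 * κ))).sub
    ((hD κ).div (hP κ) one_ne_zero)
  simp only [zero_div, add_zero, sub_zero] at h
  exact h

/-- The mode system of the soliton at time `t`. -/
def modeSystem (t : ℝ) : ModeSystem κ where
  k₁ := S.k₁
  k₂ := S.k₂
  N₁ := (1 / κ ^ 2 - S.k₁ ^ 2) / 4
  N₂ := (1 / κ ^ 2 - S.k₂ ^ 2) / 4
  w := S.w t
  A₁ := S.A₁ t
  B₁ := S.B₁ t
  C₁ := S.C₁ t
  A₂ := S.A₂ t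
  B₂ := S.B₂ t
  C₂ := S.C₂ t
  κ_pos := S.κ_pos
  k₁_pos := S.k₁_pos
  k₂_pos := S.k₂_pos
  N₁_lower := by
    have := S.κ_pos.ne'
    have h := S.k₁_lt
    have e : 16 * κ ^ 2 * ((1 / κ ^ 2 - S.k₁ ^ 2) / 4) = 4 - 4 * (κ * S.k₁) ^ 2 := by
      field_simp
      ring
    rw [e]
    linarith
  N₂_lower := by
    have := S.κ_pos.ne'
    have h := S.k₂_lt
    have e : 16 * κ ^ 2 * ((1 / κ ^ 2 - S.k₂ ^ 2) / 4) = 4 - 4 * (κ * S.k₂) ^ 2 := by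
      field_simp
      ring
    rw [e]
    linarith
  dw := S.dw t
  dA₁ := S.dA₁ t
  dB₁ := S.dB₁ t
  dC₁ := S.dC₁ t
  dA₂ := S.dA₂ t
  dB₂ := S.dB₂ t
  dC₂ := S.dC₂ t
  A₁_nonneg y := modeSq_nonneg S.k₁_pos.le S.one_add₁.le (S.e₁_pos t y).le
  B₁_nonneg y := modeSq_nonneg S.k₁_pos.le S.one_sub₁.le (S.e₁_pos t y).le
  A₂_nonneg y := modeSq_nonneg S.k₂_pos.le S.one_add₂.le (S.e₂_nonneg t y)
  B₂_nonneg y := modeSq_nonneg S.k₂_pos.le S.one_sub₂.le (S.e₂_nonneg t y)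
  C₁_sq _ := modeProd_sq S.κ_pos.ne'
  C₂_sq _ := modeProd_sq S.κ_pos.ne'
  A₁_decay := modeSq_decay S.k₁_pos S.one_add₁ S.one_add₂ S.r_pos.ne' S.r_sq_le
    (mul_nonneg S.b₁_pos.le (Real.exp_pos _).le)
    (continuous_iff_continuousAt.2 fun y => (S.dA₁ t y).continuousAt) (S.e₁_eq t) (S.e₂_nonneg t)
  B₁_decay := modeSq_decay S.k₁_pos S.one_sub₁ S.one_sub₂ S.r_pos.ne' S.r_sq_le
    (mul_nonneg S.b₁_pos.le (Real.exp_pos _).le)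
    (continuous_iff_continuousAt.2 fun y => (S.dB₁ t y).continuousAt) (S.e₁_eq t) (S.e₂_nonneg t)
  A₂_decay := modeSq_decay S.k₂_pos S.one_add₂ S.one_add₁ (neg_ne_zero.2 S.r_pos.ne')
    (by rw [neg_sq]; exact S.r_sq_le) (mul_nonneg S.b₂_nonneg (Real.exp_pos _).le)
    (continuous_iff_continuousAt.2 fun y => (S.dA₂ t y).continuousAt) (S.e₂_eq t)
    fun y => (S.e₁_pos t y).le
  B₂_decay := modeSq_decay S.k₂_pos S.one_sub₂ S.one_sub₁ (neg_ne_zero.2 S.r_pos.ne')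
    (by rw [neg_sq]; exact S.r_sq_le) (mul_nonneg S.b₂_nonneg (Real.exp_pos _).le)
    (continuous_iff_continuousAt.2 fun y => (S.dB₂ t y).continuousAt) (S.e₂_eq t)
    fun y => (S.e₁_pos t y).le
  w_tendsto := S.w_tendsto t

lemma hasDerivAt_xParam (d t y : ℝ) :
    HasDerivAt (xParam κ d S.f S.g t) (2 * (S.modeSystem t).w y) y := by
  have hf := (S.f_pos t y).ne'
  have hg := (S.g_pos t y).ne'
  have df : HasDerivAt (S.f t) _ y := hasDerivAt_tauPoly (S.de₁ t y) (S.de₂ t y)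
  have dg : HasDerivAt (S.g t) _ y := hasDerivAt_tauPoly (S.de₁ t y) (S.de₂ t y)
  refine (((((hasDerivAt_id y).div_const κ).add_const (κ ^ 2 * t)).add
    (((dg.div df hf).log (div_ne_zero hg hf)).const_mul 2)).add_const d).congr_deriv ?_
  have hκ := S.κ_pos.ne'
  simp only [modeSystem, w, logDeriv, Pi.div_apply]
  change _ = 2 * (1 / (2 * κ) + _ / S.g t y - _ / S.f t y)
  field_simp
  ring

/-- The time derivative of `ln(fg)` is a combination of the partial logarithmic derivatives
`tauPart`, whose `y`-derivatives are the squared eigenfunctions. -/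
lemma uParam_eq_wave (t y : ℝ) : uParam κ S.f S.g t y = (S.modeSystem t).wave y := by
  have hτ : ∀ y, deriv (fun τ => Real.log (S.f τ y * S.g τ y)) t
      = (-(S.k₁ * (2 * κ ^ 3 / (1 - (κ * S.k₁) ^ 2))))
          * tauPart κ S.k₁ S.k₂ S.r (S.e₁ t y) (S.e₂ t y)
        + (-(S.k₂ * (2 * κ ^ 3 / (1 - (κ * S.k₂) ^ 2))))
          * tauPart κ S.k₂ S.k₁ (-S.r) (S.e₂ t y) (S.e₁ t y)
        + ((-(S.k₁ * (2 * κ ^ 3 / (1 - (κ * S.k₁) ^ 2))))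
          * tauPart (-κ) S.k₁ S.k₂ S.r (S.e₁ t y) (S.e₂ t y)
        + (-(S.k₂ * (2 * κ ^ 3 / (1 - (κ * S.k₂) ^ 2))))
          * tauPart (-κ) S.k₂ S.k₁ (-S.r) (S.e₂ t y) (S.e₁ t y)) := by
    intro y
    have hf := (S.f_pos t y).ne'
    have hg := (S.g_pos t y).ne'
    have df : HasDerivAt (fun τ => S.f τ y) _ t :=
      hasDerivAt_tauPoly (S.de₁_time t y) (S.de₂_time t y)
    have dg : HasDerivAt (fun τ => S.g τ y) _ t :=
      hasDerivAt_tauPoly (S.de₁_time t y) (S.de₂_time t y)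
    rw [← tauPolyDeriv_div, ← tauPolyDeriv_div]
    refine ((df.mul dg).log (mul_ne_zero hf hg)).deriv.trans ?_
    change _ = _ / S.f t y + _ / S.g t y
    simp only [Pi.mul_apply]
    field_simp
  have hd : deriv (fun y => deriv (fun τ => Real.log (S.f τ y * S.g τ y)) t) y
      = (-(S.k₁ * (2 * κ ^ 3 / (1 - (κ * S.k₁) ^ 2)))) * S.A₁ t y
        + (-(S.k₂ * (2 * κ ^ 3 / (1 - (κ * S.k₂) ^ 2)))) * S.A₂ t y
        + ((-(S.k₁ * (2 * κ ^ 3 / (1 - (κ * S.k₁) ^ 2)))) * S.B₁ t y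
        + (-(S.k₂ * (2 * κ ^ 3 / (1 - (κ * S.k₂) ^ 2)))) * S.B₂ t y) := by
    simp_rw [hτ]
    exact ((((S.dpartA₁ t y).const_mul _).add ((S.dpartA₂ t y).const_mul _)).add
      (((S.dpartB₁ t y).const_mul _).add ((S.dpartB₂ t y).const_mul _))).deriv
  -- The velocity in the phase is `κ/(2N)`, matching the weights of `wave`.
  have hv : ∀ {k : ℝ}, 0 < 1 + κ * k → 0 < 1 + -κ * k →
      2 * κ ^ 3 / (1 - (κ * k) ^ 2) = κ / 2 / ((1 / κ ^ 2 - k ^ 2) / 4) := by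
    intro k h1 h2
    have hκ := S.κ_pos.ne'
    have h3 : 1 - (κ * k) ^ 2 ≠ 0 := by
      have : (1 - (κ * k) ^ 2) = (1 + κ * k) * (1 + -κ * k) := by ring
      rw [this]
      positivity
    have h4 : 1 / κ ^ 2 - k ^ 2 = (1 - (κ * k) ^ 2) / κ ^ 2 := by
      field_simp
    rw [h4]
    field_simp
    ring
  rw [uParam, hd, hv S.one_add₁ S.one_sub₁, hv S.one_add₂ S.one_sub₂]
  simp only [ModeSystem.wave, modeSystem]
  ring

lemma momentum_waveOfTau (d t : ℝ) : momentum (waveOfTau κ d S.f S.g t)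
    = (S.modeSystem t).profile (xParam κ d S.f S.g t) := by
  rw [← (S.modeSystem t).momentum_wave (S.hasDerivAt_xParam d t)]
  congr 1
  funext x
  exact S.uParam_eq_wave t _

lemma mode₁_ne_zero (t y : ℝ) : S.A₁ t y + S.B₁ t y ≠ 0 := by
  have hn : 0 < eigenNum κ S.k₂ S.r (S.e₂ t y) := by
    have := S.one_add₂
    have := S.r_pos
    have := S.e₂_nonneg t y
    simp only [eigenNum]
    positivity
  have h1 : 0 < S.A₁ t y := by
    have := S.k₁_pos
    have := S.one_add₁
    have := S.e₁_pos t y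
    have hf := S.f_pos t y
    exact div_pos (by positivity) (pow_pos hf 2)
  have h2 : 0 ≤ S.B₁ t y := modeSq_nonneg S.k₁_pos.le S.one_sub₁.le (S.e₁_pos t y).le
  positivity

/-- Since `-r < 0`, either numerator may vanish somewhere, but not both at one point: they differ by
`2rκk₁e₁ > 0`. -/
lemma mode₂_ne_zero (hb : 0 < S.b₂) (t y : ℝ) : S.A₂ t y + S.B₂ t y ≠ 0 := by
  intro h
  have ha : 0 ≤ S.A₂ t y := modeSq_nonneg S.k₂_pos.le S.one_add₂.le (S.e₂_nonneg t y)
  have hb' : 0 ≤ S.B₂ t y := modeSq_nonneg S.k₂_pos.le S.one_sub₂.le (S.e₂_nonneg t y)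
  have he : S.e₂ t y ≠ 0 := (mul_pos hb (Real.exp_pos _)).ne'
  have hA : S.A₂ t y = 0 := by linarith
  have hB : S.B₂ t y = 0 := by linarith
  have zero : ∀ {κ' : ℝ}, 0 < 1 + κ' * S.k₂ →
      tauPoly κ' S.k₂ S.k₁ (-S.r) (S.e₂ t y) (S.e₁ t y) ≠ 0 →
      modeSq κ' S.k₂ S.k₁ (-S.r) (S.e₂ t y) (S.e₁ t y) = 0 →
      eigenNum κ' S.k₁ (-S.r) (S.e₁ t y) = 0 := by
    intro κ' h1 h2 h3
    have h4 := (div_eq_zero_iff.1 h3).resolve_right (pow_ne_zero 2 h2)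
    have h5 := (mul_eq_zero.1 h4).resolve_left
      (mul_ne_zero S.k₂_pos.ne' (mul_ne_zero h1.ne' he))
    exact pow_eq_zero_iff two_ne_zero |>.1 h5
  have z1 := zero S.one_add₂ (S.f_swap_ne t y) hA
  have z2 := zero S.one_sub₂ (S.g_swap_ne t y) hB
  simp only [eigenNum] at z1 z2
  have h3 : 0 < S.r * (κ * S.k₁ * S.e₁ t y) := by
    have := S.r_pos
    have := S.κ_pos
    have := S.k₁_pos
    have := S.e₁_pos t y
    positivity
  linarith

end SolitonData

/-! ### From speeds and phases to soliton data. -/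

lemma kappa_mul_waveNumber_sq {κ c : ℝ} (hκ : 0 < κ) (hc : 3 * κ ^ 2 < c) :
    (κ * waveNumber κ c) ^ 2 = (c - 3 * κ ^ 2) / (c - κ ^ 2) := by
  have h : 0 < c - κ ^ 2 := by nlinarith
  rw [waveNumber, mul_div_cancel₀ _ hκ.ne', Real.sq_sqrt]
  exact div_nonneg (by linarith) h.le

lemma waveNumber_pos {κ c : ℝ} (hκ : 0 < κ) (hc : 3 * κ ^ 2 < c) : 0 < waveNumber κ c := by
  have h : 0 < c - κ ^ 2 := by nlinarith
  exact div_pos (Real.sqrt_pos.2 (div_pos (by linarith) h)) hκ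

/-- The upper bound on the speed is equivalent to `(κk)² < 3/4`, that is, to `16κ²N > 1`, the
condition behind the positivity of `w`. -/
lemma four_mul_waveNumber_sq_lt {κ c : ℝ} (hκ : 0 < κ) (hc : 3 * κ ^ 2 < c)
    (hc' : c < 9 * κ ^ 2) : 4 * (κ * waveNumber κ c) ^ 2 < 3 := by
  have h : 0 < c - κ ^ 2 := by nlinarith
  rw [kappa_mul_waveNumber_sq hκ hc, ← mul_div_assoc, div_lt_iff₀ h]
  linarith

lemma waveNumber_lt {κ c c' : ℝ} (hκ : 0 < κ) (hc : 3 * κ ^ 2 < c) (h : c < c') :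
    waveNumber κ c < waveNumber κ c' := by
  have h1 : 0 < c - κ ^ 2 := by nlinarith
  have h2 : 0 < c' - κ ^ 2 := by linarith
  refine div_lt_div_of_pos_right (Real.sqrt_lt_sqrt (div_nonneg (by linarith) h1.le) ?_) hκ
  rw [div_lt_div_iff₀ h1 h2]
  nlinarith [sq_pos_of_pos hκ]

lemma spectral_eq {κ c : ℝ} (hκ : 0 < κ) (hc : 3 * κ ^ 2 < c) :
    (1 / κ ^ 2 - waveNumber κ c ^ 2) / 4 = 1 / (2 * (c - κ ^ 2)) := by
  have h : c - κ ^ 2 ≠ 0 := by nlinarith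
  have hκ' := hκ.ne'
  have e : waveNumber κ c ^ 2 = (c - 3 * κ ^ 2) / (c - κ ^ 2) / κ ^ 2 := by
    rw [← kappa_mul_waveNumber_sq hκ hc]
    field_simp
  rw [e]
  field_simp
  ring

/-- The amplitude of the exponential of a soliton with phase `y₀`. -/
def amplitude (κ k y₀ : ℝ) : ℝ := Real.exp (k * y₀) / (1 + κ * k)

lemma exp_phase {κ k : ℝ} (h : 1 + κ * k ≠ 0) (y₀ τ y : ℝ) : Real.exp (phase κ k y₀ τ y)
    = (1 + κ * k)
      * (amplitude κ k y₀ * Real.exp (k * (y - 2 * κ ^ 3 / (1 - (κ * k) ^ 2) * τ))) := by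
  rw [amplitude, ← mul_assoc, mul_div_cancel₀ _ h, ← Real.exp_add, phase]
  congr 1
  ring

lemma shiftFactor_mul {κ k : ℝ} (h : 1 + κ * k ≠ 0) (x : ℝ) :
    shiftFactor κ k * ((1 + κ * k) * x) = (1 + -κ * k) * x := by
  rw [shiftFactor]
  field_simp
  ring

lemma amplitude_pos {κ k : ℝ} (hκ : 0 < κ) (hk : 0 < k) (y₀ : ℝ) : 0 < amplitude κ k y₀ :=
  div_pos (Real.exp_pos _) (by positivity)

/-- The data of a 1-soliton. -/
def oneSolitonData {κ c : ℝ} (hκ : 0 < κ) (y₀ : ℝ) (hc : 3 * κ ^ 2 < c) (hc' : c < 9 * κ ^ 2) :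
    SolitonData κ where
  k₁ := waveNumber κ c
  -- The second mode is a dummy with zero amplitude; any smaller positive wave number would do, and
  -- half of the first one gives `r = 1/3`.
  k₂ := waveNumber κ c / 2
  r := 1 / 3
  b₁ := amplitude κ (waveNumber κ c) y₀
  b₂ := 0
  κ_pos := hκ
  k₁_pos := waveNumber_pos hκ hc
  k₂_pos := half_pos (waveNumber_pos hκ hc)
  k₁_lt := four_mul_waveNumber_sq_lt hκ hc hc'
  k₂_lt := by nlinarith [four_mul_waveNumber_sq_lt hκ hc hc']
  r_pos := by norm_num
  r_eq := by ring
  b₁_pos := amplitude_pos hκ (waveNumber_pos hκ hc) y₀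
  b₂_nonneg := le_rfl

/-- The data of a 2-soliton. -/
def twoSolitonData {κ c₁ c₂ : ℝ} (hκ : 0 < κ) (y₁ y₂ : ℝ) (h₂ : 3 * κ ^ 2 < c₂) (h : c₂ < c₁)
    (h₁ : c₁ < 9 * κ ^ 2) : SolitonData κ where
  k₁ := waveNumber κ c₁
  k₂ := waveNumber κ c₂
  r := (waveNumber κ c₁ - waveNumber κ c₂) / (waveNumber κ c₁ + waveNumber κ c₂)
  b₁ := amplitude κ (waveNumber κ c₁) y₁
  b₂ := amplitude κ (waveNumber κ c₂) y₂
  κ_pos := hκ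
  k₁_pos := waveNumber_pos hκ (h₂.trans h)
  k₂_pos := waveNumber_pos hκ h₂
  k₁_lt := four_mul_waveNumber_sq_lt hκ (h₂.trans h) h₁
  k₂_lt := four_mul_waveNumber_sq_lt hκ h₂ (h.trans h₁)
  r_pos := div_pos (sub_pos.2 (waveNumber_lt hκ h₂ h))
    (add_pos (waveNumber_pos hκ (h₂.trans h)) (waveNumber_pos hκ h₂))
  r_eq := div_mul_cancel₀ _
    (add_pos (waveNumber_pos hκ (h₂.trans h)) (waveNumber_pos hκ h₂)).ne'
  b₁_pos := amplitude_pos hκ (waveNumber_pos hκ (h₂.trans h)) y₁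
  b₂_nonneg := (amplitude_pos hκ (waveNumber_pos hκ h₂) y₂).le

section OneSoliton

variable {κ c : ℝ} (hκ : 0 < κ) (y₀ : ℝ) (hc : 3 * κ ^ 2 < c) (hc' : c < 9 * κ ^ 2)

lemma tauF1_eq : tauF1 κ (waveNumber κ c) y₀ = (oneSolitonData hκ y₀ hc hc').f := by
  funext τ y
  have h : 1 + κ * waveNumber κ c ≠ 0 := (oneSolitonData hκ y₀ hc hc').one_add₁.ne'
  simp only [tauF1, exp_phase h, SolitonData.f, tauPoly, SolitonData.e₁, SolitonData.e₂,
    oneSolitonData, zero_mul, mul_zero, add_zero]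

lemma tauG1_eq : tauG1 κ (waveNumber κ c) y₀ = (oneSolitonData hκ y₀ hc hc').g := by
  funext τ y
  have h : 1 + κ * waveNumber κ c ≠ 0 := (oneSolitonData hκ y₀ hc hc').one_add₁.ne'
  simp only [tauG1, exp_phase h, shiftFactor_mul h, SolitonData.g, tauPoly, SolitonData.e₁,
    SolitonData.e₂, oneSolitonData, zero_mul, mul_zero, add_zero]

end OneSoliton

section TwoSoliton

variable {κ c₁ c₂ : ℝ} (hκ : 0 < κ) (y₁ y₂ : ℝ) (h₂ : 3 * κ ^ 2 < c₂) (h : c₂ < c₁)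
  (h₁ : c₁ < 9 * κ ^ 2)

lemma tauF2_eq : tauF2 κ (waveNumber κ c₁) (waveNumber κ c₂) y₁ y₂
    = (twoSolitonData hκ y₁ y₂ h₂ h h₁).f := by
  funext τ y
  have n₁ : 1 + κ * waveNumber κ c₁ ≠ 0 := (twoSolitonData hκ y₁ y₂ h₂ h h₁).one_add₁.ne'
  have n₂ : 1 + κ * waveNumber κ c₂ ≠ 0 := (twoSolitonData hκ y₁ y₂ h₂ h h₁).one_add₂.ne'
  simp only [tauF2, Real.exp_add, exp_phase n₁, exp_phase n₂, SolitonData.f, tauPoly,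
    SolitonData.e₁, SolitonData.e₂, twoSolitonData]
  ring

lemma tauG2_eq : tauG2 κ (waveNumber κ c₁) (waveNumber κ c₂) y₁ y₂
    = (twoSolitonData hκ y₁ y₂ h₂ h h₁).g := by
  funext τ y
  have n₁ : 1 + κ * waveNumber κ c₁ ≠ 0 := (twoSolitonData hκ y₁ y₂ h₂ h h₁).one_add₁.ne'
  have n₂ : 1 + κ * waveNumber κ c₂ ≠ 0 := (twoSolitonData hκ y₁ y₂ h₂ h h₁).one_add₂.ne'
  -- Each shift factor must stand next to its own exponential for `shiftFactor_mul` to apply.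
  have e : ∀ q s s' E E' : ℝ, q * (s * s') * (E * E') = q * ((s * E) * (s' * E')) := by
    intros
    ring
  simp only [tauG2, Real.exp_add, e]
  simp only [exp_phase n₁, exp_phase n₂, shiftFactor_mul n₁, shiftFactor_mul n₂,
    SolitonData.g, tauPoly, SolitonData.e₁, SolitonData.e₂, twoSolitonData]
  ring

end TwoSoliton

lemma forall_eq_mul_iff {p q : ℝ → ℝ} {a : ℝ} (h : ∀ x, p x = a * q x) (hq : ∃ x, q x ≠ 0)
    (b : ℝ) : (∀ x, p x = b * q x) ↔ b = a := by
  constructor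
  · intro hb
    obtain ⟨x, hx⟩ := hq
    exact mul_right_cancel₀ hx ((hb x).symm.trans (h x))
  · rintro rfl
    exact h

end MCH

end

/-! ### The theorem. -/

theorem lemma3p1 (κ : ℝ) (hκ : 0 < κ) :
    -- the single-soliton identities
    (∀ c y₀ d t : ℝ, 3 * κ ^ 2 < c → c < 9 * κ ^ 2 →
      Function.Bijective (MCH.oneSolitonX κ c y₀ d t) ∧
      ∀ μ : ℝ → ℝ, μ = MCH.momentum (MCH.oneSoliton κ c y₀ d t) →
        MCH.IsGradient κ (MCH.F1 κ) μ (MCH.G1 κ μ) ∧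
        MCH.IsGradient κ (MCH.F2 κ) μ (MCH.G2 κ μ) ∧
        MCH.IsGradient κ (MCH.F3 κ) μ (MCH.G3 κ μ) ∧
        (∀ ω₁ : ℝ, (∀ x, MCH.G2 κ μ x = ω₁ * MCH.G1 κ μ x) ↔
          ω₁ = (c + 3 * κ ^ 2) / (2 * κ ^ 2 * (c - κ ^ 2))) ∧
        (∀ ω₂ : ℝ, (∀ x, MCH.G3 κ μ x = ω₂ * MCH.G1 κ μ x) ↔
          ω₂ = (3 * c ^ 2 + 2 * c * κ ^ 2 + 27 * κ ^ 4) / (16 * κ ^ 4 * (c - κ ^ 2) ^ 2))) ∧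
    -- the variational characterization of the 2-solitons
    (∀ c₁ c₂ y₁ y₂ d t : ℝ, 3 * κ ^ 2 < c₂ → c₂ < c₁ → c₁ < 9 * κ ^ 2 →
      Function.Bijective (MCH.twoSolitonX κ c₁ c₂ y₁ y₂ d t) ∧
      ∀ l₁ l₂ : ℝ,
        MCH.IsCriticalPoint κ (MCH.lagrangian κ l₁ l₂)
            (MCH.momentum (MCH.twoSoliton κ c₁ c₂ y₁ y₂ d t)) ↔
          l₁ = -1 / (16 * κ ^ 4)
              + 1 / (2 * κ ^ 2) * (1 / (c₁ - κ ^ 2) + 1 / (c₂ - κ ^ 2))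
              + 2 / ((c₁ - κ ^ 2) * (c₂ - κ ^ 2)) ∧
          l₂ = -(1 / (4 * κ ^ 2) + 1 / (c₁ - κ ^ 2) + 1 / (c₂ - κ ^ 2))) := by
  refine ⟨fun c y₀ d t hc hc' => ?_, fun c₁ c₂ y₁ y₂ d t h₂ h h₁ => ?_⟩
  · have hX := (MCH.oneSolitonData hκ y₀ hc hc').hasDerivAt_xParam d t
    have hM := (MCH.oneSolitonData hκ y₀ hc hc').momentum_waveOfTau d t
    have hN : ((MCH.oneSolitonData hκ y₀ hc hc').modeSystem t).N₁ = 1 / (2 * (c - κ ^ 2)) :=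
      MCH.spectral_eq hκ hc
    have hA : ∀ y, ((MCH.oneSolitonData hκ y₀ hc hc').modeSystem t).A₂ y = 0 := fun y => by
      simp [MCH.SolitonData.modeSystem, MCH.SolitonData.A₂, MCH.modeSq, MCH.SolitonData.e₂,
        MCH.oneSolitonData]
    have hB : ∀ y, ((MCH.oneSolitonData hκ y₀ hc hc').modeSystem t).B₂ y = 0 := fun y => by
      simp [MCH.SolitonData.modeSystem, MCH.SolitonData.B₂, MCH.modeSq, MCH.SolitonData.e₂,
        MCH.oneSolitonData]
    have h1 : ∃ y, ((MCH.oneSolitonData hκ y₀ hc hc').modeSystem t).A₁ y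
        + ((MCH.oneSolitonData hκ y₀ hc hc').modeSystem t).B₁ y ≠ 0 :=
      ⟨0, (MCH.oneSolitonData hκ y₀ hc hc').mode₁_ne_zero t 0⟩
    rw [← MCH.tauF1_eq, ← MCH.tauG1_eq] at hX hM
    have hκ' := hκ.ne'
    have hc0 : c - κ ^ 2 ≠ 0 := by nlinarith
    refine ⟨MCH.ModeSystem.X_bijective _ hX, ?_⟩
    rintro μ rfl
    rw [MCH.oneSoliton, hM]
    -- From here on only the value of `N₁`, the vanishing of the second mode and the presence of the
    -- first one matter.
    generalize (MCH.oneSolitonData hκ y₀ hc hc').modeSystem t = M at *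
    have hp := M.isProfile hX
    have hG := M.exists_G1_profile_ne_zero hX h1
    refine ⟨MCH.IsProfile.isGradient_F1 hκ hp, MCH.IsProfile.isGradient_F2 hκ hp, MCH.IsProfile.isGradient_F3 hκ hp,
      fun ω => ?_, fun ω => ?_⟩
    · rw [MCH.forall_eq_mul_iff (M.G2_profile_of_single hA hB hX) hG, hN]
      have : 4 * (1 / (2 * (c - κ ^ 2))) + 1 / (2 * κ ^ 2)
          = (c + 3 * κ ^ 2) / (2 * κ ^ 2 * (c - κ ^ 2)) := by
        field_simp
        ring
      rw [this]
    · rw [MCH.forall_eq_mul_iff (M.G3_profile_of_single hA hB hX) hG, hN]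
      have : 8 * (1 / (2 * (c - κ ^ 2))) ^ 2 + 1 / (2 * (c - κ ^ 2)) / κ ^ 2 + 3 / (16 * κ ^ 4)
          = (3 * c ^ 2 + 2 * c * κ ^ 2 + 27 * κ ^ 4) / (16 * κ ^ 4 * (c - κ ^ 2) ^ 2) := by
        field_simp
        ring
      rw [this]
  · have hX := (MCH.twoSolitonData hκ y₁ y₂ h₂ h h₁).hasDerivAt_xParam d t
    have hM := (MCH.twoSolitonData hκ y₁ y₂ h₂ h h₁).momentum_waveOfTau d t
    have hN₁ : ((MCH.twoSolitonData hκ y₁ y₂ h₂ h h₁).modeSystem t).N₁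
        = 1 / (2 * (c₁ - κ ^ 2)) := MCH.spectral_eq hκ (h₂.trans h)
    have hN₂ : ((MCH.twoSolitonData hκ y₁ y₂ h₂ h h₁).modeSystem t).N₂
        = 1 / (2 * (c₂ - κ ^ 2)) := MCH.spectral_eq hκ h₂
    have m₁ : ∃ y, ((MCH.twoSolitonData hκ y₁ y₂ h₂ h h₁).modeSystem t).A₁ y
        + ((MCH.twoSolitonData hκ y₁ y₂ h₂ h h₁).modeSystem t).B₁ y ≠ 0 :=
      ⟨0, (MCH.twoSolitonData hκ y₁ y₂ h₂ h h₁).mode₁_ne_zero t 0⟩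
    have m₂ : ∃ y, ((MCH.twoSolitonData hκ y₁ y₂ h₂ h h₁).modeSystem t).A₂ y
        + ((MCH.twoSolitonData hκ y₁ y₂ h₂ h h₁).modeSystem t).B₂ y ≠ 0 :=
      ⟨0, (MCH.twoSolitonData hκ y₁ y₂ h₂ h h₁).mode₂_ne_zero
        (MCH.amplitude_pos hκ (MCH.waveNumber_pos hκ h₂) y₂) t 0⟩
    rw [← MCH.tauF2_eq, ← MCH.tauG2_eq] at hX hM
    have hc₂ : 0 < c₂ - κ ^ 2 := by nlinarith
    have hc₁ : 0 < c₁ - κ ^ 2 := by linarith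
    refine ⟨MCH.ModeSystem.X_bijective _ hX, fun l₁ l₂ => ?_⟩
    rw [MCH.twoSoliton, hM]
    generalize (MCH.twoSolitonData hκ y₁ y₂ h₂ h h₁).modeSystem t = M at *
    have hne : M.N₁ ≠ M.N₂ := by
      rw [hN₁, hN₂]
      intro he
      have := inv_injective (by simpa only [one_div] using he : (2 * (c₁ - κ ^ 2))⁻¹ = (2 * (c₂ - κ ^ 2))⁻¹)
      linarith
    rw [M.isCriticalPoint_iff hX hne m₁ m₂, hN₁, hN₂]
    have e₁ : -1 / (16 * κ ^ 4) + 1 / κ ^ 2 * (1 / (2 * (c₁ - κ ^ 2)) + 1 / (2 * (c₂ - κ ^ 2)))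
          + 8 * (1 / (2 * (c₁ - κ ^ 2)) * (1 / (2 * (c₂ - κ ^ 2))))
        = -1 / (16 * κ ^ 4) + 1 / (2 * κ ^ 2) * (1 / (c₁ - κ ^ 2) + 1 / (c₂ - κ ^ 2))
          + 2 / ((c₁ - κ ^ 2) * (c₂ - κ ^ 2)) := by
      field_simp
      ring
    have e₂ : -(1 / (4 * κ ^ 2) + 2 * (1 / (2 * (c₁ - κ ^ 2))) + 2 * (1 / (2 * (c₂ - κ ^ 2))))
        = -(1 / (4 * κ ^ 2) + 1 / (c₁ - κ ^ 2) + 1 / (c₂ - κ ^ 2)) := by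
      field_simp
    rw [e₁, e₂]
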